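/- Let $m\ge 2$ and let $\Omega\subset\mathbb{C}$ be a bounded $m$-connected planar region, i.e. a bounded, connected, open set whose boundary is the disjoint union of $m$ simple closed curves: an outermost one, $E_1$, and the components $E_2^1,\dots,E_2^{m-1}$ of $E_2$, which lie in the domain bounded by $E_1$. Let $\mathcal{T}$ be a finite cellular decomposition of $\Omega\cup\partial\Omega$, with $\partial\Omega$ as a subcomplex, in which each $2$-cell is a triangle or a quadrilateral and whose $1$-skeleton is a simple graph. Each $2$-cell is identified with a Euclidean triangle or square by its characteristic map, and these identifications agree on common edges; this is the affine structure of $\mathcal{T}$. Let $c(u,v)=c(v,u)>0$ be a conductance function on the edges, let $k>0$, and let $g:\mathcal{T}^{(0)}\to\mathbb{R}$ satisfy $g=k$ on $E_1$, $g=0$ on $E_2$, and $\sum_{y\sim x}c(x,y)(g(x)-g(y))=0$ at every vertex $x\in\Omega$. Assume that $g$ has different values at the two ends of every edge that is not contained in $\partial\Omega$. Let $\bar g:\Omega\cup\partial\Omega\to\mathbb{R}$ be a piecewise-affine extension of $g$: it is affine on each triangle, and each quadrilateral is cut by a diagonal, at whose ends $g$ has different values, into two triangles on each of which $\bar g$ is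 affine. (On a quadrilateral where $g$ has an affine extension, $\bar g$ can be that extension.) Let $L$ be a connected component of a nonempty level set $\{z\in\Omega\cup\partial\Omega:\bar g(z)=l\}$, $l\in\mathbb{R}$. Then $L$ is a generalized piecewise bouquet of circles. That is, $L$ is the union of finitely many bouquets of piecewise linear simple closed curves. A bouquet is a finite nonempty collection of curves which share a point and pairwise meet only there, and this point is a vertex of $\mathcal{T}$ if the bouquet has more than one curve. Any two of the bouquets meet in at most a vertex of $\mathcal{T}$, and all tangencies are external: no circle has a point in the domain bounded by another one. Moreover, for any two different simple closed curves $C,C'\subset L$ the intersection $C\cap C'$ is empty or a single vertex of $\mathcal{T}$, and $C'$ is disjoint from the domain bounded by $C$. -/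

import Mathlib

/-! ## Simple closed curves in the plane -/

/-- A simple closed curve in the plane: the image of a circle under a continuous injection. -/
def IsSimpleClosedCurve (C : Set ℂ) : Prop :=
  ∃ γ : Circle → ℂ, Continuous γ ∧ Function.Injective γ ∧ Set.range γ = C

/-- The domain bounded by a closed curve: the points off the curve which lie in a bounded
component of its complement. -/
def inside (C : Set ℂ) : Set ℂ :=
  {z | z ∈ Cᶜ ∧ Bornology.IsBounded (connectedComponentIn Cᶜ z)}

/-! ## Bounded multiply connected planar regions -/

/-- `Ω` is a bounded `m`-connected planar region: a bounded connected open set whose boundary is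
the disjoint union of `m` simple closed curves, the outermost one `E₁` and the `m - 1`
components of `E₂`. -/
structure IsMultiplyConnectedRegion (m : ℕ) (Ω E₁ : Set ℂ) (E₂ : Fin (m - 1) → Set ℂ) : Prop where
  isOpen : IsOpen Ω
  isConnected : IsConnected Ω
  isBounded : Bornology.IsBounded Ω
  outer_curve : IsSimpleClosedCurve E₁
  inner_curve : ∀ i, IsSimpleClosedCurve (E₂ i)
  inner_disjoint : ∀ i j, i ≠ j → Disjoint (E₂ i) (E₂ j)
  outer_disjoint : ∀ i, Disjoint E₁ (E₂ i)
  frontier_eq : frontier Ω = E₁ ∪ ⋃ i, E₂ i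
  outermost : ∀ i, E₂ i ⊆ inside E₁

/-! ## Cellular decompositions into triangles and quadrilaterals -/

/-- The corners of the model `n`-gon, in cyclic order: the `n`-th roots of unity. -/
noncomputable def modelCorner (n : ℕ) (j : ZMod n) : ℂ :=
  Complex.exp (2 * Real.pi * Complex.I * ((j.val : ℂ) / (n : ℂ)))

/-- The (closed) model `n`-gon. -/
noncomputable def modelPolygon (n : ℕ) : Set ℂ :=
  convexHull ℝ (Set.range (modelCorner n))

/-- The data of a two-dimensional cell complex in the plane, with vertices `V` and 2-cells `F`:
the position of the vertices, a parametrization of every edge, and for every 2-cell its number of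
sides, its corners in cyclic order and its characteristic map, defined on the model polygon.
The characteristic maps carry the affine structure of the complex. The values of `edge u v` where
`u`, `v` are not adjacent or the parameter is outside `[0, 1]`, and those of `cell f` off the
model polygon, play no role. -/
structure PlanarComplex (V F : Type*) where
  pos : V → ℂ
  edge : V → V → ℝ → ℂ
  sides : F → ℕ
  corner : ∀ f, ZMod (sides f) → V
  cell : F → ℂ → ℂ

namespace PlanarComplex

variable {V F : Type*} (T : PlanarComplex V F)

/-- The unordered pair `{u, v}` is a side of the 2-cell `f`. -/
def IsSide (f : F) (u v : V) : Prop :=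
  ∃ j, s(T.corner f j, T.corner f (j + 1)) = s(u, v)

/-- The 1-skeleton, as a simple graph. -/
def graph : SimpleGraph V :=
  SimpleGraph.fromRel fun u v => ∃ f, T.IsSide f u v

/-- The open edge joining `u` and `v`. -/
def openEdge (u v : V) : Set ℂ := T.edge u v '' Set.Ioo 0 1

/-- The closed edge joining `u` and `v`. -/
def closedEdge (u v : V) : Set ℂ := T.edge u v '' Set.Icc 0 1

/-- The closed 2-cell `f`. -/
def closedCell (f : F) : Set ℂ := T.cell f '' modelPolygon (T.sides f)

/-- The open 2-cell `f`. -/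
def openCell (f : F) : Set ℂ := T.cell f '' interior (modelPolygon (T.sides f))

/-- `T` is a cellular decomposition of `Ω ∪ ∂Ω`, with `∂Ω` as a subcomplex, in which every 2-cell
is a triangle or a quadrilateral. -/
structure IsCellDecomposition (Ω : Set ℂ) : Prop where
  pos_injective : Function.Injective T.pos
  exists_corner : ∀ v, ∃ f j, T.corner f j = v
  sides_eq : ∀ f, T.sides f = 3 ∨ T.sides f = 4
  cell_continuousOn : ∀ f, ContinuousOn (T.cell f) (modelPolygon (T.sides f))
  cell_injOn : ∀ f, Set.InjOn (T.cell f) (modelPolygon (T.sides f))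
  cell_corner : ∀ f j, T.cell f (modelCorner (T.sides f) j) = T.pos (T.corner f j)
  /-- Each side of a 2-cell is attached along an edge, compatibly with the parametrizations. -/
  cell_side : ∀ f j, ∀ t ∈ Set.Icc (0 : ℝ) 1,
    T.cell f (AffineMap.lineMap (modelCorner (T.sides f) j) (modelCorner (T.sides f) (j + 1)) t) =
      T.edge (T.corner f j) (T.corner f (j + 1)) t
  edge_symm : ∀ u v, T.graph.Adj u v → ∀ t ∈ Set.Icc (0 : ℝ) 1, T.edge v u t = T.edge u v (1 - t)
  /-- Distinct edges meet at most in endpoints. -/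
  edge_disjoint : ∀ u v u' v', T.graph.Adj u v → T.graph.Adj u' v' → s(u, v) ≠ s(u', v') →
    Disjoint (T.openEdge u v) (T.closedEdge u' v')
  /-- Distinct 2-cells meet at most in their boundaries, and an open 2-cell contains no point of
  the 1-skeleton. -/
  cell_disjoint : ∀ f f', f ≠ f' → Disjoint (T.openCell f) (T.closedCell f')
  /-- The open 2-cells are open subsets of the plane contained in `Ω`. -/
  isOpen_openCell : ∀ f, IsOpen (T.openCell f)
  openCell_subset : ∀ f, T.openCell f ⊆ Ω
  closure_eq : closure Ω = ⋃ f, T.closedCell f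
  /-- Every open edge is either contained in the boundary of `Ω`, and is then a side of exactly
  one 2-cell, or contained in `Ω`, and is then a side of exactly two 2-cells. -/
  edge_side : ∀ u v, T.graph.Adj u v →
    (T.openEdge u v ⊆ frontier Ω ∧ {f | T.IsSide f u v}.ncard = 1) ∨
      (T.openEdge u v ⊆ Ω ∧ {f | T.IsSide f u v}.ncard = 2)

/-! ## The Dirichlet boundary value problem and the extension of its solution -/

open Classical in
/-- The combinatorial Laplacian of `u` at the vertex `x`, for the conductance function `c`. -/
noncomputable def laplacian [Fintype V] (c : V → V → ℝ) (u : V → ℝ) (x : V) : ℝ :=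
  ∑ y with T.graph.Adj x y, c x y * (u x - u y)

/-- `c` is a conductance function on the edges. -/
def IsConductance (c : V → V → ℝ) : Prop :=
  ∀ u v, T.graph.Adj u v → 0 < c u v ∧ c u v = c v u

/-- `g` solves the Dirichlet boundary value problem with value `k` on `E₁` and `0` on `E₂`:
it is harmonic at every vertex in `Ω`. -/
structure IsDirichletSolution [Fintype V] (Ω E₁ E₂ : Set ℂ) (c : V → V → ℝ) (k : ℝ)
    (g : V → ℝ) : Prop where
  harmonic : ∀ v, T.pos v ∈ Ω → T.laplacian c g v = 0
  outer : ∀ v, T.pos v ∈ E₁ → g v = k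
  inner : ∀ v, T.pos v ∈ E₂ → g v = 0

/-- In the affine structure of the 2-cell `f`, the function `h` is affine on the triangle with
corners `i`, `j`, `l`, and takes there the values of `g` at the corners. -/
def IsAffineOnTriangle (g : V → ℝ) (h : ℂ → ℝ) (f : F) (i j l : ZMod (T.sides f)) : Prop :=
  ∀ a b c : ℝ, 0 ≤ a → 0 ≤ b → 0 ≤ c → a + b + c = 1 →
    h (T.cell f (a • modelCorner (T.sides f) i + b • modelCorner (T.sides f) j +
        c • modelCorner (T.sides f) l)) =
      a * g (T.corner f i) + b * g (T.corner f j) + c * g (T.corner f l)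

/-- `h` is a piecewise-affine extension of `g`: it is affine on each triangle, and each
quadrilateral is cut into two triangles by a diagonal at whose ends `g` has different values, `h`
being affine on both triangles. -/
def IsPiecewiseAffineExtension (g : V → ℝ) (h : ℂ → ℝ) : Prop :=
  ∀ f, (T.sides f = 3 → T.IsAffineOnTriangle g h f 0 1 2) ∧
    (T.sides f = 4 → ∃ i : ZMod (T.sides f), g (T.corner f i) ≠ g (T.corner f (i + 2)) ∧
      T.IsAffineOnTriangle g h f i (i + 1) (i + 2) ∧
      T.IsAffineOnTriangle g h f i (i + 3) (i + 2))

/-! ## Generalized piecewise bouquets of circles -/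

/-- A set is piecewise linear if it is given, in the affine structure of each 2-cell, by a finite
union of (possibly degenerate) segments. -/
def IsPiecewiseLinear (C : Set ℂ) : Prop :=
  ∀ f, ∃ S : Set (ℂ × ℂ), S.Finite ∧
    {z ∈ modelPolygon (T.sides f) | T.cell f z ∈ C} = ⋃ s ∈ S, segment ℝ s.1 s.2

/-- A set which is at most a vertex. -/
def IsAtMostVertex (A : Set ℂ) : Prop := ∃ v, A ⊆ {T.pos v}

/-- A finite nonempty collection of piecewise linear circles forming a bouquet: they share a
point, and any two of them meet only there; if there are at least two circles then this point is
a vertex. -/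
structure IsBouquet (b : Set (Set ℂ)) : Prop where
  finite : b.Finite
  nonempty : b.Nonempty
  circle : ∀ C ∈ b, IsSimpleClosedCurve C ∧ T.IsPiecewiseLinear C
  wedge : ∃ p, (∀ C ∈ b, p ∈ C) ∧ (∀ C ∈ b, ∀ C' ∈ b, C ≠ C' → C ∩ C' = {p}) ∧
    (b.Nontrivial → p ∈ Set.range T.pos)

/-- `L` is a generalized piecewise bouquet of circles: a finite union of piecewise bouquets of
circles, any two of which meet at most in a vertex, such that no circle enters the domain
bounded by another one. -/
def IsGeneralizedBouquet (L : Set ℂ) : Prop :=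
  ∃ B : Set (Set (Set ℂ)), B.Finite ∧ (∀ b ∈ B, T.IsBouquet b) ∧ L = ⋃ b ∈ B, ⋃₀ b ∧
    (∀ b ∈ B, ∀ b' ∈ B, b ≠ b' → T.IsAtMostVertex (⋃₀ b ∩ ⋃₀ b')) ∧
    (∀ b ∈ B, ∀ C ∈ b, ∀ b' ∈ B, ∀ C' ∈ b', C ≠ C' → Disjoint C' (inside C))

end PlanarComplex

/-!
The extension is affine and nonconstant on each triangle of a triangulation of the closed region,
and by harmonicity a vertex in the region has neighbours with greater and with smaller values. So
it has no local extremum in the region (`PlanarComplex.IsCut.hasNoLocalExtr`), its values there lie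
strictly between `0` and `k`, and the level sets of the values `0` and `k` are the boundary curves.
It remains to study a level strictly between them. The nondegeneracy of the edges and diagonals
makes its intersection with any triangle empty, a corner, or a segment whose relative interior is
inside the triangle.

*The level set is covered by circles.* Consider the graph whose nodes are the triangles crossed by
the level set and the points where the level segments end, a triangle being adjacent to the ends of
its segment. All degrees are even: a segment has two ends, a crossed edge lies in two triangles, and
around a vertex the values of `g` minus the level change sign an even number of times
(`even_degree_levelGraph`). A finite graph with even degrees has a cycle through each of its edges,
and a cycle is realized by a simple closed curve (`exists_isSimpleClosedCurve_through`).

*No level point is inside a level circle.* By the maximum principle, all points above the level lie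
in the component of the complement of the level set which contains the outer boundary curve, and
this component is unbounded (`IsMultiplyConnectedRegion.isSeparatingLevel`). Every level point is a
limit of points above the level, so no bounded component of the complement of a level circle
contains a level point (`IsSeparatingLevel.disjoint_inside`).

*Two circles meet in at most a vertex.* Suppose that two level circles share a level segment. Let
`U` be the component of the complement of the level set just below this segment. A circle separates
the two sides of the segment (`not_mem_connectedComponentIn_of_diameter`), hence `U` from the points
above the level. Near each point of the frontier of `U` there are points above the level, so
the frontier is contained in both circles; and it does not fit into a proper arc of a circle
(`not_frontier_subset_arc`). So both circles equal this frontier (`eq_of_levelSegment_subset`).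
A level circle contains the whole of a level segment if it meets its relative interior or its end
inside an edge, so different circles meet only at vertices. If they met in two points, an arc of one
and an arc of the other would form a third circle sharing an arc with the second
(`IsSimpleClosedCurve.subsingleton_inter`).

Therefore a component of the level set is the union of its simple closed curves, of which there are
finitely many, all piecewise linear, and each of them can be taken as a bouquet by itself
(`PlanarComplex.isGeneralizedBouquet_sUnion`). The two facts from plane topology, the separation
along a diameter and the statement about arcs, are proved with continuous logarithms and the
Tietze extension theorem, and replace the Jordan curve theorem.
-/

open Set Filter Topology

/-! ### Continuous logarithms and separation in the plane -/

/-- Two continuous logarithms of the same function on a connected set differ by a constant: their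
difference takes values in `2πi ℤ`. -/
theorem eqOn_of_exp_eq {M : Set ℂ} (hM : IsPreconnected M) {f g : ℂ → ℂ}
    (hf : ContinuousOn f M) (hg : ContinuousOn g M)
    (h : ∀ z ∈ M, Complex.exp (f z) = Complex.exp (g z)) {p q : ℂ} (hp : p ∈ M) (hq : q ∈ M) :
    f p - g p = f q - g q := by
  have hpi : (2 * Real.pi * Complex.I : ℂ) ≠ 0 := Complex.two_pi_I_ne_zero
  have hc : ContinuousOn (fun z => ((f z - g z) / (2 * Real.pi * Complex.I)).re) M :=
    Complex.continuous_re.comp_continuousOn ((hf.sub hg).div_const _)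
  have hint : ∀ z ∈ M, ∃ n : ℤ, f z - g z = n * (2 * Real.pi * Complex.I) := by
    intro z hz
    obtain ⟨n, hn⟩ := Complex.exp_eq_exp_iff_exists_int.1 (h z hz)
    exact ⟨n, by rw [hn]; ring⟩
  obtain ⟨n, hn⟩ := hint p hp
  obtain ⟨m, hm⟩ := hint q hq
  have hpre := hM.image _ hc
  by_contra hne
  have hnm : n ≠ m := by
    rintro rfl
    exact hne (hn.trans hm.symm)
  have hvp : ((f p - g p) / (2 * Real.pi * Complex.I)).re = n := by
    rw [hn, mul_div_cancel_right₀ _ hpi]; simp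
  have hvq : ((f q - g q) / (2 * Real.pi * Complex.I)).re = m := by
    rw [hm, mul_div_cancel_right₀ _ hpi]; simp
  have hoc := hpre.ordConnected
  have key : ∀ a b : ℤ, a < b → ((a : ℝ) ∈ (fun z => ((f z - g z) / (2 * Real.pi * Complex.I)).re) '' M) →
      ((b : ℝ) ∈ (fun z => ((f z - g z) / (2 * Real.pi * Complex.I)).re) '' M) → False := by
    intro a b hab ha hb
    have hab' : (a : ℝ) + 1 ≤ b := by exact_mod_cast hab
    have : ((a : ℝ) + 1 / 2) ∈ (fun z => ((f z - g z) / (2 * Real.pi * Complex.I)).re) '' M :=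
      hoc.out ha hb ⟨by linarith, by linarith⟩
    obtain ⟨z, hz, hze⟩ := this
    obtain ⟨j, hj⟩ := hint z hz
    simp only [hj, mul_div_cancel_right₀ _ hpi, Complex.intCast_re] at hze
    have h2 : (2 * j : ℝ) = 2 * a + 1 := by linarith
    have h3 : 2 * j = 2 * a + 1 := by exact_mod_cast h2
    omega
  rcases lt_or_gt_of_ne hnm with h1 | h1
  · exact key n m h1 ⟨p, hp, hvp⟩ ⟨q, hq, hvq⟩
  · exact key m n h1 ⟨q, hq, hvq⟩ ⟨p, hp, hvp⟩

/-- A nonvanishing continuous function on the plane has a continuous logarithm, whereas `z - a`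
has none on a large circle around `a`. -/
theorem not_forall_ne_zero_of_eq_sub {G : ℂ → ℂ} (hG : Continuous G) {a : ℂ} {s : Set ℂ}
    (hs : Bornology.IsBounded s) (h : ∀ z ∉ s, G z = z - a) : ∃ z, G z = 0 := by
  by_contra! hne
  obtain ⟨L, hL, hLG⟩ := Complex.exists_continuousOn_eqOn_exp_comp (X := ℂ) (U := univ) (g := G)
    (by
      have := (convex_univ (𝕜 := ℝ) (E := ℂ)).contractibleSpace univ_nonempty
      exact (inferInstance : SimplyConnectedSpace (univ : Set ℂ))) isOpen_univ hG.continuousOn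
    (by rintro ⟨z, -, hz⟩; exact hne z hz)
  obtain ⟨R, hR0, hR⟩ := hs.subset_ball_lt 0 a
  have hmem : ∀ t : ℝ, G (a + R * Complex.exp (t * Complex.I)) = R * Complex.exp (t * Complex.I) := by
    intro t
    rw [h _ (fun hc => ?_)]
    · ring
    have h3 := hR hc
    simp [Complex.norm_exp_ofReal_mul_I, abs_of_pos hR0] at h3
  have hcont : Continuous (fun t : ℝ => L (a + R * Complex.exp (t * Complex.I))) := by
    have : Continuous L := continuousOn_univ.1 hL
    fun_prop
  have h0 : Continuous (fun z : ℂ => L (a + R * Complex.exp ((z.re : ℝ) * Complex.I))) :=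
    hcont.comp Complex.continuous_re
  have h1 : Continuous (fun z : ℂ => ((z.re : ℝ) : ℂ) * Complex.I + Real.log R) := by fun_prop
  have h2 := eqOn_of_exp_eq (M := univ) isPreconnected_univ h0.continuousOn h1.continuousOn
    (by
      intro z _
      have := hLG (mem_univ (a + R * Complex.exp ((z.re : ℝ) * Complex.I)))
      simp only [Function.comp] at this
      rw [this, hmem, Complex.exp_add, ← Complex.ofReal_exp, Real.exp_log hR0]
      ring) (mem_univ 0) (mem_univ ((2 * Real.pi : ℝ) : ℂ))
  simp only [Complex.ofReal_re, Complex.zero_re] at h2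
  have h3 : Complex.exp (((2 * Real.pi : ℝ) : ℂ) * Complex.I) = 1 := by
    push_cast; exact Complex.exp_two_pi_mul_I
  rw [h3] at h2
  simp at h2

/-- If `a` and `b` lie in a connected set missing the closed set `K`, then `(z - a) / (z - b)` has
a continuous logarithm on `K`. -/
theorem exists_log_div_of_isPreconnected {K S : Set ℂ} (hK : IsClosed K) (hS : IsPreconnected S)
    (hSK : Disjoint S K) {a b : ℂ} (ha : a ∈ S) (hb : b ∈ S) :
    ∃ L : ℂ → ℂ, ContinuousOn L K ∧ ∀ z ∈ K, Complex.exp (L z) = (z - a) / (z - b) := by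
  set P : Set ℂ := {a | a ∉ K ∧ ∃ L : ℂ → ℂ, ContinuousOn L K ∧
    ∀ z ∈ K, Complex.exp (L z) = (z - a) / (z - b)} with hP
  -- closeness to `c` suffices to pass from one of `a`, `a'` to the other
  have step : ∀ c ∉ K, ∃ r > 0, ∀ a ∈ Metric.ball c r, ∀ a' ∈ Metric.ball c r, a ∈ P → a' ∈ P := by
    intro c hc
    obtain ⟨r, hr, hrK⟩ := Metric.isOpen_iff.1 hK.isOpen_compl c hc
    refine ⟨r / 4, by positivity, fun a ha a' ha' haP => ?_⟩
    have hda : dist a c < r / 4 := ha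
    have hda' : dist a' c < r / 4 := ha'
    have hfar : ∀ z ∈ K, r ≤ dist z c := by
      intro z hz
      by_contra! hlt
      exact hrK hlt hz
    have haK : a ∉ K := fun h => by linarith [hfar a h]
    have haK' : a' ∉ K := fun h => by linarith [hfar a' h]
    obtain ⟨L, hLc, hL⟩ := haP.2
    have hsl : ∀ z ∈ K, (z - a') / (z - a) ∈ Complex.slitPlane := by
      intro z hz
      have hza : z - a ≠ 0 := sub_ne_zero.2 (fun h => haK (h ▸ hz))
      have : (z - a') / (z - a) = 1 + (a - a') / (z - a) := by field_simp; ring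
      rw [this]
      apply Complex.mem_slitPlane_of_norm_lt_one
      rw [norm_div, div_lt_one (norm_pos_iff.2 hza), ← dist_eq_norm, ← dist_eq_norm]
      have h1 := hfar z hz
      have h2 := dist_triangle z a c
      have h3 := dist_triangle a c a'
      rw [dist_comm c a'] at h3
      linarith
    refine ⟨haK', fun z => L z + Complex.log ((z - a') / (z - a)), ?_, ?_⟩
    · refine hLc.add (ContinuousOn.clog ?_ hsl)
      refine ContinuousOn.div (by fun_prop) (by fun_prop) ?_
      intro z hz
      exact sub_ne_zero.2 (fun h => haK (h ▸ hz))
    · intro z hz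
      have hza : z - a ≠ 0 := sub_ne_zero.2 (fun h => haK (h ▸ hz))
      have hza' : z - a' ≠ 0 := sub_ne_zero.2 (fun h => haK' (h ▸ hz))
      rw [Complex.exp_add, hL z hz, Complex.exp_log (div_ne_zero hza' hza)]
      field_simp
  have hbK : b ∉ K := disjoint_left.1 hSK hb
  have hbP : b ∈ P := by
    refine ⟨hbK, fun _ => 0, continuousOn_const, fun z hz => ?_⟩
    have hzb : z - b ≠ 0 := sub_ne_zero.2 (fun h => hbK (h ▸ hz))
    rw [Complex.exp_zero, div_self hzb]
  have hopen : IsOpen P := by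
    rw [Metric.isOpen_iff]
    intro c hc
    obtain ⟨r, hr, h⟩ := step c hc.1
    exact ⟨r, hr, fun a' ha' => h c (Metric.mem_ball_self hr) a' ha' hc⟩
  have hSP : S ⊆ P := by
    refine hS.subset_of_closure_inter_subset hopen ⟨b, hb, hbP⟩ ?_
    rintro c ⟨hc, hcS⟩
    obtain ⟨r, hr, h⟩ := step c (disjoint_left.1 hSK hcS)
    obtain ⟨a', ha'P, ha'⟩ := Metric.mem_closure_iff.1 hc r hr
    exact h a' (by rw [Metric.mem_ball, dist_comm]; exact ha') c (Metric.mem_ball_self hr) ha'P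
  exact (hSP ha).2

theorem continuousOn_invFunOn_image {X Y : Type*} [TopologicalSpace X] [Nonempty X]
    [TopologicalSpace Y] [T2Space Y] {K : Set X} (hK : IsCompact K) {f : X → Y}
    (hf : ContinuousOn f K) (hi : InjOn f K) :
    ContinuousOn (Function.invFunOn f K) (f '' K) := by
  have : CompactSpace K := isCompact_iff_compactSpace.1 hK
  have he : IsClosedEmbedding (K.domRestrict f) :=
    (hf.domRestrict).isClosedEmbedding (injOn_iff_injective.1 hi)
  rw [continuousOn_iff_isClosed]
  intro t ht
  refine ⟨f '' (K ∩ t), ?_, ?_⟩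
  · have h1 : IsClosed (K.domRestrict f '' (Subtype.val ⁻¹' t)) :=
      he.isClosedMap _ (ht.preimage continuous_subtype_val)
    convert h1 using 1
    ext y
    simp only [mem_image, mem_inter_iff, mem_preimage, Subtype.exists, exists_and_left]
    constructor
    · rintro ⟨x, ⟨h1, h2⟩, rfl⟩
      exact ⟨x, h2, h1, rfl⟩
    · rintro ⟨x, h2, h1, rfl⟩
      exact ⟨x, ⟨h1, h2⟩, rfl⟩
  · ext y
    simp only [mem_inter_iff, mem_preimage, mem_image]
    constructor
    · rintro ⟨h1, x, hx, rfl⟩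
      rw [hi.leftInvOn_invFunOn hx] at h1
      exact ⟨⟨x, ⟨hx, h1⟩, rfl⟩, x, hx, rfl⟩
    · rintro ⟨⟨x, ⟨hx, h1⟩, rfl⟩, -⟩
      rw [hi.leftInvOn_invFunOn hx]
      exact ⟨h1, x, hx, rfl⟩

theorem exists_continuous_extension {Y : Type} [TopologicalSpace Y] [TietzeExtension.{0, 0} Y]
    {K : Set ℂ} (hK : IsClosed K) {f : ℂ → Y} (hf : ContinuousOn f K) :
    ∃ g : ℂ → Y, Continuous g ∧ EqOn g f K := by
  obtain ⟨g, hg⟩ := ContinuousMap.exists_restrict_eq hK ⟨K.domRestrict f, hf.domRestrict⟩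
  refine ⟨g, g.continuous, fun x hx => ?_⟩
  exact congrArg (fun q : C(K, Y) => q ⟨x, hx⟩) hg

/-- The frontier of a bounded open set is not contained in an arc: otherwise the arc would be a
retract, and moving the points of `U` to the arc would turn `z - a` into a nonvanishing function. -/
theorem not_frontier_subset_arc {U : Set ℂ} (hb : Bornology.IsBounded U)
    (hne : U.Nonempty) {f : ℝ → ℂ} {α β : ℝ} (hf : ContinuousOn f (Icc α β))
    (hi : InjOn f (Icc α β)) (hd : Disjoint U (f '' Icc α β)) : ¬ frontier U ⊆ f '' Icc α β := by
  classical
  intro hfr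
  obtain ⟨a, ha⟩ := hne
  have hr := (continuousOn_invFunOn_image isCompact_Icc hf hi).mono hfr
  have hmem : ∀ z ∈ frontier U, Function.invFunOn f (Icc α β) z ∈ Icc α β := fun z hz =>
    Function.invFunOn_mem (by obtain ⟨x, hx, hxz⟩ := hfr hz; exact ⟨x, hx, hxz⟩)
  obtain ⟨r, hrc, hre⟩ := exists_continuous_extension isClosed_frontier hr
  -- the frontier is nonempty, as the plane is connected
  have hαβ : α ≤ β := by
    by_contra! hlt
    rw [Icc_eq_empty_of_lt hlt, image_empty, subset_empty_iff] at hfr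
    have hcl : IsClopen U := isClopen_iff_frontier_eq_empty.2 hfr
    have := hcl.eq_univ ⟨a, ha⟩
    rw [this] at hb
    exact NormedSpace.unbounded_univ ℝ ℂ hb
  set G : ℂ → ℂ := fun z => if z ∈ U then f (projIcc α β hαβ (r z)) - a else z - a with hGdef
  have hfp : Continuous (fun z => f (projIcc α β hαβ (r z))) :=
    hf.comp_continuous (continuous_subtype_val.comp (continuous_projIcc.comp hrc))
      (fun z => (projIcc α β hαβ (r z)).2)
  have hG : Continuous G := by
    refine continuous_if ?_ (hfp.sub continuous_const).continuousOn (by fun_prop)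
    intro z hz
    have hz' : z ∈ frontier U := hz
    rw [hre hz', projIcc_of_mem hαβ (hmem z hz')]
    rw [Function.invFunOn_eq (show ∃ x ∈ Icc α β, f x = z from hfr hz')]
  obtain ⟨z, hz⟩ := not_forall_ne_zero_of_eq_sub hG hb (a := a) (fun z hz => by simp [hGdef, hz])
  simp only [hGdef] at hz
  split_ifs at hz with h
  · exact disjoint_left.1 hd ha ⟨_, (projIcc α β hαβ (r z)).2, sub_eq_zero.1 hz⟩
  · exact h (by rw [sub_eq_zero.1 hz]; exact ha)

theorem frontier_connectedComponentIn_compl_subset {K : Set ℂ} (hK : IsClosed K) (z : ℂ) :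
    frontier (connectedComponentIn Kᶜ z) ⊆ K := by
  intro x hx
  by_contra hxK
  have hopen : IsOpen (connectedComponentIn Kᶜ z) := hK.isOpen_compl.connectedComponentIn
  rw [hopen.frontier_eq] at hx
  have hxo : IsOpen (connectedComponentIn Kᶜ x) := hK.isOpen_compl.connectedComponentIn
  have hxm : x ∈ connectedComponentIn Kᶜ x := mem_connectedComponentIn hxK
  obtain ⟨y, hy1, hy2⟩ := mem_closure_iff.1 hx.1 _ hxo hxm
  apply hx.2
  rw [connectedComponentIn_eq hy2, ← connectedComponentIn_eq hy1]
  exact hxm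

/-- The closed upper half of the unit disc. -/
def upperHalfDisc : Set ℂ := {w | w ∈ Metric.closedBall (0 : ℂ) 1 ∧ 0 ≤ w.im}

/-- If the closed set `K` crosses the topological disc `φ (closedBall 0 1)` exactly along the
diameter `φ [-1, 1]`, and the ends of the diameter are connected in `K` outside the disc, then `K`
separates the two sides of the diameter. Otherwise a logarithm of `(z - a) / (z - b)` on the
diameter and one outside the disc would match up along the boundary of the upper half disc, and
then `z - a` could be made nonvanishing by changing it inside the half disc. -/
theorem not_mem_connectedComponentIn_of_diameter {φ : ℂ → ℂ} {K M : Set ℂ}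
    (hφ : ContinuousOn φ (Metric.closedBall 0 1)) (hi : InjOn φ (Metric.closedBall 0 1))
    (ho : ∀ W ⊆ Metric.closedBall (0 : ℂ) 1, IsOpen W → IsOpen (φ '' W))
    (hK : IsClosed K)
    (hKφ : ∀ w ∈ Metric.closedBall (0 : ℂ) 1, φ w ∈ K ↔ w.im = 0)
    (hM : IsPreconnected M) (hMK : M ⊆ K) (hMφ : Disjoint M (φ '' Metric.ball 0 1))
    (hM1 : φ 1 ∈ M) (hM2 : φ (-1) ∈ M) {a b : ℂ} (ha : a ∈ Metric.ball (0 : ℂ) 1)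
    (hb : b ∈ Metric.ball (0 : ℂ) 1) (ha0 : 0 < a.im) (hb0 : b.im < 0) :
    φ b ∉ connectedComponentIn Kᶜ (φ a) := by
  classical
  intro hmem
  set B := Metric.closedBall (0 : ℂ) 1 with hB
  have hbB : Metric.ball (0 : ℂ) 1 ⊆ B := Metric.ball_subset_closedBall
  have haK : φ a ∉ K := fun h => ha0.ne' ((hKφ a (hbB ha)).1 h)
  have hbK : φ b ∉ K := fun h => hb0.ne ((hKφ b (hbB hb)).1 h)
  have hbo : IsOpen (φ '' Metric.ball 0 1) := ho _ hbB Metric.isOpen_ball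
  obtain ⟨lam, hlc, hl⟩ := exists_log_div_of_isPreconnected hK
    (isPreconnected_connectedComponentIn (F := Kᶜ) (x := φ a))
    (disjoint_left.2 fun z hz hzK => connectedComponentIn_subset _ _ hz hzK)
    (mem_connectedComponentIn haK) hmem
  obtain ⟨mu, hmc, hm⟩ := exists_log_div_of_isPreconnected hbo.isClosed_compl
    ((convex_ball (0 : ℂ) 1).isPreconnected.image φ (hφ.mono hbB))
    disjoint_compl_right (mem_image_of_mem φ ha) (mem_image_of_mem φ hb)
  have hMc : M ⊆ (φ '' Metric.ball 0 1)ᶜ := fun z hz => disjoint_left.1 hMφ hz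
  have hconst : lam (φ 1) - mu (φ 1) = lam (φ (-1)) - mu (φ (-1)) :=
    eqOn_of_exp_eq hM (hlc.mono hMK) (hmc.mono hMc)
      (fun z hz => by rw [hl z (hMK hz), hm z (hMc hz)]) hM1 hM2
  set d := lam (φ 1) - mu (φ 1) with hd
  have hexpd : Complex.exp d = 1 := by
    rw [hd, Complex.exp_sub, hl _ (hMK hM1), hm _ (hMc hM1)]
    apply div_self
    rw [← hl _ (hMK hM1)]
    exact Complex.exp_ne_zero _
  -- the boundary of the half disc consists of the diameter and of a semicircle
  set D1 : Set ℂ := φ '' {w | w ∈ B ∧ w.im = 0} with hD1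
  set D2 : Set ℂ := φ '' {w | w ∈ B ∧ 0 ≤ w.im ∧ ‖w‖ = 1} with hD2
  have hBc : IsCompact B := isCompact_closedBall 0 1
  have hD1c : IsCompact D1 := (hBc.inter_right
    (isClosed_eq Complex.continuous_im continuous_const)).image_of_continuousOn
      (hφ.mono inter_subset_left)
  have hD2c : IsCompact D2 := (hBc.inter_right
    ((isClosed_le continuous_const Complex.continuous_im).inter
      (isClosed_eq continuous_norm continuous_const))).image_of_continuousOn
      (hφ.mono inter_subset_left)
  have hD1K : D1 ⊆ K := by
    rintro _ ⟨w, ⟨hw, hw0⟩, rfl⟩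
    exact (hKφ w hw).2 hw0
  have hD2o : D2 ⊆ (φ '' Metric.ball 0 1)ᶜ := by
    rintro _ ⟨w, ⟨hw, -, hw1⟩, rfl⟩ ⟨w', hw', he⟩
    have := hi (hbB hw') hw he
    rw [this, mem_ball_zero_iff, hw1] at hw'
    exact lt_irrefl _ hw'
  have hagree : ∀ z ∈ D1, z ∈ D2 → lam z = mu z + d := by
    rintro _ ⟨w, ⟨hw, hw0⟩, rfl⟩ ⟨w', ⟨hw', -, hw1⟩, he⟩
    have hww := hi hw' hw he
    rw [hww] at hw1
    have hsq : w.re ^ 2 = 1 := by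
      have := Complex.sq_norm w
      rw [hw1, Complex.normSq_apply, hw0] at this
      nlinarith
    have : w = 1 ∨ w = -1 := by
      rcases (show w.re = 1 ∨ w.re = -1 by simpa using hsq) with h | h
      · exact Or.inl (Complex.ext h hw0)
      · exact Or.inr (Complex.ext h (by simpa using hw0))
    rcases this with rfl | rfl
    · rw [hd]; ring
    · rw [hconst]; ring
  set nu0 : ℂ → ℂ := fun z => if z ∈ D1 then lam z else mu z + d with hnu0
  have hnu0c : ContinuousOn nu0 (D1 ∪ D2) := by
    refine ContinuousOn.union_of_isClosed ?_ ?_ hD1c.isClosed hD2c.isClosed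
    · exact (hlc.mono hD1K).congr fun z hz => by simp [hnu0, hz]
    · refine ((hmc.mono hD2o).add (continuousOn_const (c := d))).congr fun z hz => ?_
      by_cases h : z ∈ D1
      · simp [hnu0, h, hagree z h hz]
      · simp [hnu0, h]
  have hnu0e : ∀ z ∈ D1 ∪ D2, Complex.exp (nu0 z) = (z - φ a) / (z - φ b) := by
    intro z hz
    by_cases h : z ∈ D1
    · simp only [hnu0, h, if_true]; exact hl z (hD1K h)
    · simp only [hnu0, h, if_false]
      rw [Complex.exp_add, hexpd, mul_one]
      exact hm z (hD2o (hz.resolve_left h))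
  obtain ⟨nu, hnuc, hnue⟩ := exists_continuous_extension (hD1c.isClosed.union hD2c.isClosed) hnu0c
  set H : Set ℂ := φ '' upperHalfDisc with hH
  have hHB : upperHalfDisc ⊆ B := fun w hw => hw.1
  have hHc : IsCompact H := (hBc.inter_right
    (isClosed_le continuous_const Complex.continuous_im)).image_of_continuousOn
      (hφ.mono inter_subset_left)
  have hbH : φ b ∉ H := by
    rintro ⟨w, hw, he⟩
    have := hi hw.1 (hbB hb) he
    rw [this] at hw
    exact absurd hw.2 (not_le.2 hb0)
  have hfrH : frontier H ⊆ D1 ∪ D2 := by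
    intro z hz
    obtain ⟨w, hw, rfl⟩ := hHc.isClosed.frontier_subset hz
    by_contra hn
    have hw0 : w.im ≠ 0 := fun h => hn (Or.inl ⟨w, ⟨hw.1, h⟩, rfl⟩)
    have hw1 : ‖w‖ ≠ 1 := fun h => hn (Or.inr ⟨w, ⟨hw.1, hw.2, h⟩, rfl⟩)
    have hW : IsOpen (φ '' (Metric.ball (0 : ℂ) 1 ∩ {w | 0 < w.im})) :=
      ho _ (inter_subset_left.trans hbB)
        (Metric.isOpen_ball.inter (isOpen_lt continuous_const Complex.continuous_im))
    have : φ w ∈ interior H := by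
      refine interior_maximal (image_mono ?_) hW ⟨w, ⟨?_, ?_⟩, rfl⟩
      · exact fun w' hw' => ⟨hbB hw'.1, le_of_lt hw'.2⟩
      · rw [mem_ball_zero_iff]
        exact lt_of_le_of_ne (mem_closedBall_zero_iff.1 hw.1) hw1
      · exact lt_of_le_of_ne hw.2 (Ne.symm hw0)
    exact hz.2 this
  have hbD : ∀ z ∈ D1 ∪ D2, z - φ b ≠ 0 := by
    intro z hz h0
    have h1 := hnu0e z hz
    rw [h0, div_zero] at h1
    exact Complex.exp_ne_zero _ h1
  set G : ℂ → ℂ := fun z => if z ∈ H then (z - φ b) * Complex.exp (nu z) else z - φ a with hGd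
  have hG : Continuous G := by
    refine continuous_if ?_ (by fun_prop) (by fun_prop)
    intro z hz
    have hz' := hfrH hz
    rw [hnue hz', hnu0e z hz', mul_div_cancel₀ _ (hbD z hz')]
  obtain ⟨z, hz⟩ := not_forall_ne_zero_of_eq_sub hG hHc.isBounded (a := φ a)
    (fun z hz => by simp [hGd, hz])
  simp only [hGd] at hz
  split_ifs at hz with h
  · rcases mul_eq_zero.1 hz with h0 | h0
    · rw [sub_eq_zero.1 h0] at h
      exact hbH h
    · exact Complex.exp_ne_zero _ h0
  · apply h
    rw [sub_eq_zero.1 hz]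
    exact ⟨a, ⟨hbB ha, ha0.le⟩, rfl⟩

/-! ### Arcs and simple closed curves -/

/-- `A` is an arc from `p` to `q`: the image of `[0, 1]` under a continuous injection taking `0` to
`p` and `1` to `q`. -/
def IsArc (A : Set ℂ) (p q : ℂ) : Prop :=
  ∃ f : ℝ → ℂ, ContinuousOn f (Icc 0 1) ∧ InjOn f (Icc 0 1) ∧ f 0 = p ∧ f 1 = q ∧ f '' Icc 0 1 = A

theorem isArc_image_Icc {f : ℝ → ℂ} {a b : ℝ} (hab : a < b) (hf : ContinuousOn f (Icc a b))
    (hi : InjOn f (Icc a b)) : IsArc (f '' Icc a b) (f a) (f b) := by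
  have hba : 0 < b - a := sub_pos.2 hab
  have himg : (fun t : ℝ => a + (b - a) * t) '' Icc 0 1 = Icc a b := by
    ext s
    simp only [mem_image, mem_Icc]
    constructor
    · rintro ⟨t, ⟨h0, h1⟩, rfl⟩
      constructor <;> nlinarith
    · rintro ⟨h0, h1⟩
      refine ⟨(s - a) / (b - a), ⟨by apply div_nonneg <;> linarith, ?_⟩, by field_simp; ring⟩
      rw [div_le_one hba]; linarith
  have hmaps : MapsTo (fun t : ℝ => a + (b - a) * t) (Icc 0 1) (Icc a b) := by
    rw [← himg]; exact mapsTo_image _ _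
  refine ⟨fun t => f (a + (b - a) * t), hf.comp (by fun_prop) hmaps, ?_, by simp, by simp, ?_⟩
  · intro s hs t ht h
    have := hi (hmaps hs) (hmaps ht) h
    have h2 : (b - a) * s = (b - a) * t := by linarith
    exact mul_left_cancel₀ hba.ne' h2
  · rw [← himg, image_image]

theorem IsArc.symm {A : Set ℂ} {p q : ℂ} (h : IsArc A p q) : IsArc A q p := by
  obtain ⟨f, hf, hi, h0, h1, hA⟩ := h
  have hmaps : MapsTo (fun t : ℝ => 1 - t) (Icc 0 1) (Icc 0 1) :=
    fun t ht => ⟨by linarith [ht.2], by linarith [ht.1]⟩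
  refine ⟨fun t => f (1 - t), hf.comp (by fun_prop) hmaps, ?_, by simpa, by simpa, ?_⟩
  · intro s hs t ht h
    have := hi (hmaps hs) (hmaps ht) h
    linarith
  · rw [← hA]
    ext z
    constructor
    · rintro ⟨t, ht, rfl⟩
      exact ⟨1 - t, hmaps ht, rfl⟩
    · rintro ⟨t, ht, rfl⟩
      exact ⟨1 - t, hmaps ht, by simp⟩

/-- Two consecutive arcs, as a single map on `[0, 2]`. -/
theorem exists_concatenation {A B : Set ℂ} {p q r : ℂ} (hA : IsArc A p q) (hB : IsArc B q r) :
    ∃ f : ℝ → ℂ, ContinuousOn f (Icc 0 2) ∧ InjOn f (Icc 0 1) ∧ InjOn f (Icc 1 2) ∧ f 0 = p ∧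
      f 1 = q ∧ f 2 = r ∧ f '' Icc 0 1 = A ∧ f '' Icc 1 2 = B := by
  obtain ⟨f, hf, hi, h0, h1, hfA⟩ := hA
  obtain ⟨g, hg, hj, g0, g1, hgB⟩ := hB
  set F : ℝ → ℂ := fun t => if t ≤ 1 then f t else g (t - 1) with hF
  have e1 : EqOn F f (Icc 0 1) := fun t ht => by simp [hF, ht.2]
  have e2 : EqOn F (fun t => g (t - 1)) (Icc 1 2) := fun t ht => by
    rcases eq_or_lt_of_le ht.1 with h | h
    · simp [hF, ← h, h1, g0]
    · simp [hF, not_le.2 h]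
  have hmaps : MapsTo (fun t : ℝ => t - 1) (Icc 1 2) (Icc 0 1) :=
    fun t ht => ⟨by linarith [ht.1], by linarith [ht.2]⟩
  refine ⟨F, ?_, hi.congr e1.symm, ?_, ?_, ?_, ?_, ?_, ?_⟩
  · rw [← Icc_union_Icc_eq_Icc (zero_le_one' ℝ) one_le_two]
    exact (hf.congr e1).union_of_isClosed ((hg.comp (by fun_prop) hmaps).congr e2)
      isClosed_Icc isClosed_Icc
  · intro s hs t ht h
    rw [e2 hs, e2 ht] at h
    have := hj (hmaps hs) (hmaps ht) h
    linarith
  · simp [hF, h0]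
  · simp [hF, h1]
  · rw [e2 (by simp)]; norm_num [g1]
  · rw [e1.image_eq, hfA]
  · rw [e2.image_eq, ← hgB]
    ext z
    constructor
    · rintro ⟨t, ht, rfl⟩
      exact ⟨t - 1, hmaps ht, rfl⟩
    · rintro ⟨t, ht, rfl⟩
      exact ⟨t + 1, ⟨by linarith [ht.1], by linarith [ht.2]⟩, by simp⟩

theorem IsArc.trans {A B : Set ℂ} {p q r : ℂ} (hA : IsArc A p q) (hB : IsArc B q r)
    (hAB : A ∩ B ⊆ {q}) : IsArc (A ∪ B) p r := by
  obtain ⟨f, hf, hi, hj, h0, h1, h2, rfl, rfl⟩ := exists_concatenation hA hB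
  have key : ∀ s ∈ Icc (0 : ℝ) 1, ∀ t ∈ Icc (1 : ℝ) 2, f s = f t → s = t := by
    intro s hs t ht h
    have hq : f s = q := hAB ⟨⟨s, hs, rfl⟩, ⟨t, ht, h.symm⟩⟩
    rw [hi hs (by simp) (hq.trans h1.symm), hj ht (by simp) ((h.symm.trans hq).trans h1.symm)]
  have hinj : InjOn f (Icc 0 2) := by
    intro s hs t ht h
    rcases le_total s 1 with hs1 | hs1 <;> rcases le_total t 1 with ht1 | ht1
    · exact hi ⟨hs.1, hs1⟩ ⟨ht.1, ht1⟩ h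
    · exact key s ⟨hs.1, hs1⟩ t ⟨ht1, ht.2⟩ h
    · exact (key t ⟨ht.1, ht1⟩ s ⟨hs1, hs.2⟩ h.symm).symm
    · exact hj ⟨hs1, hs.2⟩ ⟨ht1, ht.2⟩ h
  rw [← image_union, Icc_union_Icc_eq_Icc (zero_le_one' ℝ) one_le_two]
  have := isArc_image_Icc (two_pos) hf hinj
  rwa [h0, h2] at this

theorem isSimpleClosedCurve_of_loop {f : ℝ → ℂ} {a : ℝ} (ha : 0 < a)
    (hf : ContinuousOn f (Icc 0 a)) (hi : InjOn f (Ico 0 a)) (h : f 0 = f a) :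
    IsSimpleClosedCurve (f '' Icc 0 a) := by
  have : Fact (0 < a) := ⟨ha⟩
  set F : AddCircle a → ℂ := AddCircle.liftIco a 0 f with hF
  have hFc : Continuous F := AddCircle.liftIco_zero_continuous h hf
  have hFv : ∀ x ∈ Ico (0 : ℝ) a, F (x : AddCircle a) = f x := fun x hx =>
    AddCircle.liftIco_coe_apply (by simpa using hx)
  have hsurj : ∀ z : AddCircle a, ∃ x ∈ Ico (0 : ℝ) a, (x : AddCircle a) = z := by
    intro z
    have := AddCircle.coe_image_Ico_eq a 0
    have hz : z ∈ ((↑) : ℝ → AddCircle a) '' Ico 0 (0 + a) := by rw [this]; trivial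
    simpa using hz
  refine ⟨F ∘ (AddCircle.homeomorphCircle ha.ne').symm, hFc.comp (Homeomorph.continuous _), ?_, ?_⟩
  · refine Function.Injective.comp ?_ (Homeomorph.injective _)
    intro z w hzw
    obtain ⟨x, hx, rfl⟩ := hsurj z
    obtain ⟨y, hy, rfl⟩ := hsurj w
    rw [hFv x hx, hFv y hy] at hzw
    rw [hi hx hy hzw]
  · rw [range_comp, (Homeomorph.surjective _).range_eq, image_univ]
    ext z
    constructor
    · rintro ⟨w, rfl⟩
      obtain ⟨x, hx, rfl⟩ := hsurj w
      exact ⟨x, ⟨hx.1, hx.2.le⟩, (hFv x hx).symm⟩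
    · rintro ⟨x, hx, rfl⟩
      rcases eq_or_lt_of_le hx.2 with he | hl
      · exact ⟨((0 : ℝ) : AddCircle a), by rw [hFv 0 ⟨le_rfl, ha⟩, he, h]⟩
      · exact ⟨x, hFv x ⟨hx.1, hl⟩⟩

theorem IsArc.isSimpleClosedCurve_union {A B : Set ℂ} {p q : ℂ} (hA : IsArc A p q)
    (hB : IsArc B q p) (hAB : A ∩ B ⊆ {p, q}) : IsSimpleClosedCurve (A ∪ B) := by
  obtain ⟨f, hf, hi, hj, h0, h1, h2, rfl, rfl⟩ := exists_concatenation hA hB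
  have key : ∀ s ∈ Icc (0 : ℝ) 1, ∀ t ∈ Ico (1 : ℝ) 2, f s = f t → s = t := by
    intro s hs t ht h
    have ht' : t ∈ Icc (1 : ℝ) 2 := ⟨ht.1, ht.2.le⟩
    rcases hAB ⟨⟨s, hs, rfl⟩, ⟨t, ht', h.symm⟩⟩ with hq | hq
    · have := hj ht' (by simp) ((h.symm.trans hq).trans h2.symm)
      exact absurd this ht.2.ne
    · rw [hi hs (by simp) (hq.trans h1.symm), hj ht' (by simp) ((h.symm.trans hq).trans h1.symm)]
  rw [← image_union, Icc_union_Icc_eq_Icc (zero_le_one' ℝ) one_le_two]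
  refine isSimpleClosedCurve_of_loop two_pos hf ?_ (h0.trans h2.symm)
  intro s hs t ht h
  rcases le_total s 1 with hs1 | hs1 <;> rcases le_total t 1 with ht1 | ht1
  · exact hi ⟨hs.1, hs1⟩ ⟨ht.1, ht1⟩ h
  · exact key s ⟨hs.1, hs1⟩ t ⟨ht1, ht.2⟩ h
  · exact (key t ⟨ht.1, ht1⟩ s ⟨hs1, hs.2⟩ h.symm).symm
  · exact hj ⟨hs1, hs.2.le⟩ ⟨ht1, ht.2.le⟩ h

/-- A simple closed curve has a parametrization of period `1` starting at any of its points. -/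
theorem IsSimpleClosedCurve.exists_loop {C : Set ℂ} (hC : IsSimpleClosedCurve C) {p : ℂ}
    (hp : p ∈ C) : ∃ f : ℝ → ℂ, Continuous f ∧ f 0 = p ∧ f 1 = p ∧ InjOn f (Ico 0 1) ∧
      InjOn f (Icc (-(1 / 4)) (1 / 4)) ∧ f '' Icc 0 1 = C ∧ range f = C := by
  obtain ⟨γ, hγ, hi, rfl⟩ := hC
  obtain ⟨c, rfl⟩ := hp
  have hπ := Real.pi_pos
  have hinj : ∀ s t : ℝ, γ (Circle.exp (2 * Real.pi * s) * c) = γ (Circle.exp (2 * Real.pi * t) * c) →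
      ∃ n : ℤ, s = t + n := by
    intro s t h
    have h1 := mul_right_cancel (hi h)
    obtain ⟨n, hn⟩ := Circle.exp_eq_exp.1 h1
    refine ⟨n, ?_⟩
    have : 2 * Real.pi * s = 2 * Real.pi * (t + n) := by rw [hn]; ring
    exact mul_left_cancel₀ (by positivity) this
  have hclose : ∀ s t : ℝ, |s - t| < 1 →
      γ (Circle.exp (2 * Real.pi * s) * c) = γ (Circle.exp (2 * Real.pi * t) * c) → s = t := by
    intro s t hst h
    obtain ⟨n, hn⟩ := hinj s t h
    rw [hn, add_sub_cancel_left, ← Int.cast_abs] at hst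
    have h2 : |n| < 1 := by exact_mod_cast hst
    rw [hn, Int.abs_lt_one_iff.1 h2]; simp
  have hsurj : ∀ z : Circle, ∃ t ∈ Icc (0 : ℝ) 1, γ (Circle.exp (2 * Real.pi * t) * c) = γ z := by
    intro z
    obtain ⟨θ, hθ⟩ := Circle.exp_surjective (z * c⁻¹)
    refine ⟨Int.fract (θ / (2 * Real.pi)), ⟨Int.fract_nonneg _, (Int.fract_lt_one _).le⟩, ?_⟩
    have : Circle.exp (2 * Real.pi * Int.fract (θ / (2 * Real.pi))) = Circle.exp θ := by
      rw [Circle.exp_eq_exp]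
      refine ⟨-⌊θ / (2 * Real.pi)⌋, ?_⟩
      rw [Int.fract]
      push_cast
      field_simp
      ring
    rw [this, hθ, inv_mul_cancel_right]
  have hrange : ∀ t : ℝ, γ (Circle.exp (2 * Real.pi * t) * c) ∈ range γ := fun t => ⟨_, rfl⟩
  refine ⟨fun t => γ (Circle.exp (2 * Real.pi * t) * c), by fun_prop, by simp, by simp, ?_, ?_, ?_, ?_⟩
  · intro s hs t ht h
    exact hclose s t (by rw [abs_lt]; constructor <;> linarith [hs.1, hs.2, ht.1, ht.2]) h
  · intro s hs t ht h
    exact hclose s t (by rw [abs_lt]; constructor <;> linarith [hs.1, hs.2, ht.1, ht.2]) h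
  · apply Subset.antisymm
    · rintro _ ⟨t, -, rfl⟩
      exact hrange t
    · rintro _ ⟨z, rfl⟩
      exact hsurj z
  · apply Subset.antisymm
    · rintro _ ⟨t, rfl⟩
      exact hrange t
    · rintro _ ⟨z, rfl⟩
      obtain ⟨t, -, ht⟩ := hsurj z
      exact ⟨t, ht⟩

theorem IsSimpleClosedCurve.isCompact {C : Set ℂ} (hC : IsSimpleClosedCurve C) : IsCompact C := by
  obtain ⟨γ, hγ, -, rfl⟩ := hC
  exact isCompact_range hγ

theorem IsSimpleClosedCurve.nonempty {C : Set ℂ} (hC : IsSimpleClosedCurve C) : C.Nonempty := by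
  obtain ⟨γ, hγ, -, rfl⟩ := hC
  exact range_nonempty γ

theorem IsSimpleClosedCurve.isConnected {C : Set ℂ} (hC : IsSimpleClosedCurve C) :
    IsConnected C := by
  obtain ⟨p, hp⟩ := hC.nonempty
  obtain ⟨f, hf, -, -, -, -, -, hC⟩ := hC.exists_loop hp
  rw [← hC]
  exact isConnected_range hf

/-- A simple closed curve is a one-dimensional manifold without boundary: a real coordinate on a
piece of the curve takes all values near its value at a given point. -/
theorem IsSimpleClosedCurve.image_mem_nhds {C : Set ℂ} (hC : IsSimpleClosedCurve C) {x : ℂ}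
    (hx : x ∈ C) {N : Set ℂ} (hN : N ∈ 𝓝 x) {u : ℂ → ℝ} (hu : ContinuousOn u (C ∩ N))
    (hi : InjOn u (C ∩ N)) : u '' (C ∩ N) ∈ 𝓝 (u x) := by
  obtain ⟨f, hf, h0, -, -, hfi, -, hr⟩ := hC.exists_loop hx
  obtain ⟨δ, hδ, hδN⟩ := Metric.mem_nhds_iff.1 (hf.continuousAt.preimage_mem_nhds (h0 ▸ hN))
  set ε := min (δ / 2) (1 / 4) with hε
  have hε0 : 0 < ε := by positivity
  have hmaps : MapsTo f (Icc (-ε) ε) (C ∩ N) := by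
    intro t ht
    refine ⟨hr ▸ mem_range_self t, hδN ?_⟩
    rw [Metric.mem_ball, Real.dist_0_eq_abs, abs_lt]
    have := min_le_left (δ / 2) (1 / 4)
    constructor <;> linarith [ht.1, ht.2]
  have hvc : ContinuousOn (u ∘ f) (Icc (-ε) ε) := hu.comp hf.continuousOn hmaps
  have hvi : InjOn (u ∘ f) (Icc (-ε) ε) := by
    refine hi.comp (hfi.mono (Icc_subset_Icc ?_ ?_)) hmaps
    · linarith [min_le_right (δ / 2) (1 / 4)]
    · exact min_le_right _ _
  have hsub : (u ∘ f) '' Icc (-ε) ε ⊆ u '' (C ∩ N) := by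
    rw [image_comp]; exact image_mono hmaps.image_subset
  have hle : -ε ≤ ε := by linarith
  have m1 : -ε ∈ Icc (-ε) ε := ⟨le_rfl, hle⟩
  have m2 : ε ∈ Icc (-ε) ε := ⟨hle, le_rfl⟩
  have m0 : (0 : ℝ) ∈ Icc (-ε) ε := ⟨by linarith, hε0.le⟩
  refine mem_of_superset ?_ hsub
  rcases hvc.strictMonoOn_of_injOn_Icc' hle hvi with h | h
  · have h1 := h m1 m0 (by linarith)
    have h2 := h m0 m2 hε0
    simp only [Function.comp, h0] at h1 h2
    exact mem_of_superset (Icc_mem_nhds h1 h2) (intermediate_value_Icc hle hvc)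
  · have h1 := h m1 m0 (by linarith)
    have h2 := h m0 m2 hε0
    simp only [Function.comp, h0] at h1 h2
    exact mem_of_superset (Icc_mem_nhds h2 h1) (intermediate_value_Icc' hle hvc)

/-- A compact part of a simple closed curve which misses a point lies in an arc of the curve. -/
theorem IsSimpleClosedCurve.exists_Icc {C K : Set ℂ} (hC : IsSimpleClosedCurve C)
    (hK : IsCompact K) (hKC : K ⊆ C) {y : ℂ} (hy : y ∈ C) (hyK : y ∉ K) :
    ∃ (f : ℝ → ℂ) (α β : ℝ), Continuous f ∧ InjOn f (Icc α β) ∧ f '' Icc α β ⊆ C ∧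
      K ⊆ f '' Icc α β := by
  obtain ⟨f, hf, h0, h1, hfi, -, hf01, -⟩ := hC.exists_loop hy
  set K' := f ⁻¹' K ∩ Icc 0 1 with hK'
  have hK'c : IsCompact K' := isCompact_Icc.inter_left (hK.isClosed.preimage hf)
  have hKim : K ⊆ f '' K' := by
    intro z hz
    obtain ⟨t, ht, rfl⟩ := hf01 ▸ hKC hz
    exact ⟨t, ⟨hz, ht⟩, rfl⟩
  rcases K'.eq_empty_or_nonempty with he | hne
  · rw [he, image_empty] at hKim
    exact ⟨f, 1, 0, hf, by simp, by simp, hKim.trans (empty_subset _)⟩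
  obtain ⟨α, hα, hαmin⟩ := hK'c.exists_isLeast hne
  obtain ⟨β, hβ, hβmax⟩ := hK'c.exists_isGreatest hne
  have hα0 : 0 < α := lt_of_le_of_ne hα.2.1 (fun h => hyK (by rw [← h0, h]; exact hα.1))
  have hβ1 : β < 1 := lt_of_le_of_ne hβ.2.2 (fun h => hyK (by rw [← h1, ← h]; exact hβ.1))
  refine ⟨f, α, β, hf, hfi.mono (Icc_subset_Ico hα0.le hβ1), ?_, ?_⟩
  · rw [← hf01]; exact image_mono (Icc_subset_Icc hα0.le hβ1.le)
  · exact hKim.trans (image_mono fun t ht => ⟨hαmin ht, hβmax ht⟩)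

/-- A simple closed curve does not lie properly in another one. Otherwise it would lie in an arc, and
the parameter of the arc would attain a minimum on it, which `image_mem_nhds` forbids. -/
theorem IsSimpleClosedCurve.eq_of_subset {C C' : Set ℂ} (hC : IsSimpleClosedCurve C)
    (hC' : IsSimpleClosedCurve C') (h : C ⊆ C') : C = C' := by
  refine h.antisymm fun y hy => ?_
  by_contra hyC
  obtain ⟨f, α, β, hf, hfi, -, hCf⟩ := hC'.exists_Icc hC.isCompact h hy hyC
  have hu := (continuousOn_invFunOn_image isCompact_Icc hf.continuousOn hfi).mono hCf
  have hui : InjOn (Function.invFunOn f (Icc α β)) C := by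
    intro z hz w hw hzw
    rw [← Function.invFunOn_eq (hCf hz), hzw, Function.invFunOn_eq (hCf hw)]
  obtain ⟨x, hx, hmin⟩ := hC.isCompact.exists_isMinOn hC.nonempty hu
  have hnh := hC.image_mem_nhds hx univ_mem (by simpa using hu) (by simpa using hui)
  obtain ⟨ε, hε, hb⟩ := Metric.mem_nhds_iff.1 hnh
  obtain ⟨z, hz, hzv⟩ := hb (show Function.invFunOn f (Icc α β) x - ε / 2 ∈ _ by
    rw [Metric.mem_ball, Real.dist_eq, abs_lt]; constructor <;> linarith)
  have := hmin hz.1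
  simp only [mem_ofPred_eq] at this
  linarith

/-- If a simple closed curve crosses a topological disc along a diameter, then the ends of the
diameter are joined by the part of the curve outside the disc. -/
theorem IsSimpleClosedCurve.exists_preconnected_complement {C : Set ℂ}
    (hC : IsSimpleClosedCurve C) {φ : ℂ → ℂ} (hφ : ContinuousOn φ (Metric.closedBall 0 1))
    (hi : InjOn φ (Metric.closedBall 0 1))
    (hCφ : ∀ w ∈ Metric.closedBall (0 : ℂ) 1, φ w ∈ C ↔ w.im = 0) :
    ∃ M ⊆ C, IsPreconnected M ∧ Disjoint M (φ '' Metric.ball 0 1) ∧ φ 1 ∈ M ∧ φ (-1) ∈ M := by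
  have hmem : ∀ r : ℝ, |r| ≤ 1 → (r : ℂ) ∈ Metric.closedBall (0 : ℂ) 1 := fun r hr => by
    simpa using hr
  have hreal : ∀ r : ℝ, |r| ≤ 1 → φ r ∈ C := fun r hr => (hCφ _ (hmem r hr)).2 (by simp)
  have hφr : ContinuousOn (fun r : ℝ => φ r) (Icc (-1) 1) :=
    hφ.comp (by fun_prop) (fun r hr => hmem r (abs_le.2 hr))
  have hir : ∀ r s : ℝ, |r| ≤ 1 → |s| ≤ 1 → φ r = φ s → r = s := fun r s hr hs h => by
    exact_mod_cast hi (hmem r hr) (hmem s hs) h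
  obtain ⟨f, hf, h0, h1, hfi, -, hf01, -⟩ := hC.exists_loop (hreal 0 (by simp))
  have hloc : ∀ r : ℝ, |r| ≤ 1 → r ≠ 0 → ∃ s ∈ Ioo (0 : ℝ) 1, f s = φ r := by
    intro r hr hr0
    obtain ⟨s, hs, hse⟩ := hf01.symm ▸ hreal r hr
    refine ⟨s, ⟨lt_of_le_of_ne hs.1 ?_, lt_of_le_of_ne hs.2 ?_⟩, hse⟩
    · rintro rfl
      exact hr0 (hir r 0 hr (by simp) (by rw [← hse, h0]))
    · rintro rfl
      exact hr0 (hir r 0 hr (by simp) (by rw [← hse, h1]))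
  obtain ⟨s₁, hs₁, he₁⟩ := hloc 1 (by simp) one_ne_zero
  obtain ⟨s₂, hs₂, he₂⟩ := hloc (-1) (by simp) (by norm_num)
  set a := min s₁ s₂ with ha
  set b := max s₁ s₂ with hb
  have ha0 : 0 < a := lt_min hs₁.1 hs₂.1
  have hb1 : b < 1 := max_lt hs₁.2 hs₂.2
  have hab : a ≤ b := min_le_max
  have hends : ∀ r : ℝ, |r| < 1 → φ r ≠ f a ∧ φ r ≠ f b := by
    intro r hr
    have e1 : φ r ≠ f s₁ := by
      rw [he₁]
      intro h
      have := hir r 1 hr.le (by simp) h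
      rw [this] at hr; simp at hr
    have e2 : φ r ≠ f s₂ := by
      rw [he₂]
      intro h
      have := hir r (-1) hr.le (by simp) h
      rw [this] at hr; simp at hr
    constructor
    · rcases min_choice s₁ s₂ with h | h <;> rw [ha, h] <;> assumption
    · rcases max_choice s₁ s₂ with h | h <;> rw [hb, h] <;> assumption
  have hsame : ∀ t ∈ Icc a b, ∀ t' ∈ Icc 0 a ∪ Icc b 1, f t = f t' → f t = f a ∨ f t = f b := by
    intro t ht t' ht' h
    have ht1 : t ∈ Ico (0 : ℝ) 1 := ⟨ha0.le.trans ht.1, ht.2.trans_lt hb1⟩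
    have ht'1 : t' ∈ Icc (0 : ℝ) 1 := by
      rcases ht' with h | h
      · exact ⟨h.1, by linarith [h.2]⟩
      · exact ⟨by linarith [h.1], h.2⟩
    have htt : t = t' := by
      rcases eq_or_lt_of_le ht'1.2 with h' | h'
      · exfalso
        rw [h', h1, ← h0] at h
        have := hfi ht1 ⟨le_rfl, one_pos⟩ h
        linarith [ht.1]
      · exact hfi ht1 ⟨ht'1.1, h'⟩ h
    subst htt
    rcases ht' with h' | h'
    · exact Or.inl (by rw [le_antisymm h'.2 ht.1])
    · exact Or.inr (by rw [le_antisymm ht.2 h'.1])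
  -- a half of the open diameter which enters the part `f [a, b]` of the curve stays in it, but
  -- its end `φ 0 = f 0` is not there
  have hhalf : ∀ c d : ℝ, -1 ≤ c → d ≤ 1 → (0 : ℝ) ∈ closure (Ioo c d) → 0 ∉ Ioo c d →
      ∀ r ∈ Ioo c d, ∀ s ∈ Icc a b, f s ≠ φ r := by
    intro c d hc hd h0cl h0n r hr s hs hse
    have hlt : ∀ r ∈ Ioo c d, |r| < 1 := fun r hr => abs_lt.2 ⟨by linarith [hr.1], by linarith [hr.2]⟩
    have hpre : IsPreconnected ((fun r : ℝ => φ r) '' Ioo c d) :=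
      isPreconnected_Ioo.image _ (hφr.mono fun r hr => abs_le.1 (hlt r hr).le)
    have hcl1 : IsClosed (f '' Icc a b) := (isCompact_Icc.image hf).isClosed
    have hcl2 : IsClosed (f '' (Icc 0 a ∪ Icc b 1)) :=
      ((isCompact_Icc.union isCompact_Icc).image hf).isClosed
    have hsub := isPreconnected_iff_subset_of_disjoint_closed.1 hpre _ _ hcl1 hcl2 (by
      rintro _ ⟨r, hr, rfl⟩
      obtain ⟨t, ht, hte⟩ := hf01.symm ▸ hreal r (hlt r hr).le
      simp only at hte ⊢
      rw [← hte]
      rcases le_total t a with h | h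
      · exact Or.inr ⟨t, Or.inl ⟨ht.1, h⟩, rfl⟩
      rcases le_total t b with h' | h'
      · exact Or.inl ⟨t, ⟨h, h'⟩, rfl⟩
      · exact Or.inr ⟨t, Or.inr ⟨h', ht.2⟩, rfl⟩) (by
      rw [eq_empty_iff_forall_notMem]
      rintro _ ⟨⟨r, hr, rfl⟩, ⟨t, ht, hte⟩, ⟨t', ht', hte'⟩⟩
      simp only at hte hte'
      obtain ⟨n1, n2⟩ := hends r (hlt r hr)
      rcases hsame t ht t' ht' (hte.trans hte'.symm) with h | h
      · exact n1 (hte.symm.trans h)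
      · exact n2 (hte.symm.trans h))
    have hin : (fun r : ℝ => φ r) '' Ioo c d ⊆ f '' Icc a b := by
      rcases hsub with h | h
      · exact h
      · exfalso
        obtain ⟨t', ht', hte'⟩ := h ⟨r, hr, rfl⟩
        obtain ⟨n1, n2⟩ := hends r (hlt r hr)
        rcases hsame s hs t' ht' (hse.trans hte'.symm) with h | h
        · exact n1 (hse.symm.trans h)
        · exact n2 (hse.symm.trans h)
    have h0in : φ (0 : ℝ) ∈ f '' Icc a b := by
      have hcd : closure (Ioo c d) ⊆ Icc (-1) 1 :=
        closure_minimal (fun r hr => abs_le.1 (hlt r hr).le) isClosed_Icc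
      have := (hφr.mono hcd).image_closure (mem_image_of_mem (fun r : ℝ => φ r) h0cl)
      exact closure_minimal hin hcl1 this
    obtain ⟨t, ht, hte⟩ := h0in
    rw [← h0] at hte
    have := hfi ⟨ha0.le.trans ht.1, ht.2.trans_lt hb1⟩ ⟨le_rfl, one_pos⟩ hte
    linarith [ht.1]
  refine ⟨f '' Icc a b, ?_, isPreconnected_Icc.image _ hf.continuousOn, ?_, ?_, ?_⟩
  · rw [← hf01]; exact image_mono (Icc_subset_Icc ha0.le hb1.le)
  · rw [disjoint_left]
    rintro _ ⟨s, hs, rfl⟩ ⟨w, hw, hwe⟩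
    have hfC : f s ∈ C := hf01 ▸ ⟨s, ⟨ha0.le.trans hs.1, hs.2.trans hb1.le⟩, rfl⟩
    have him := (hCφ w (Metric.ball_subset_closedBall hw)).1 (hwe ▸ hfC)
    have hwr : w = (w.re : ℂ) := Complex.ext (by simp) (by simpa using him)
    rw [hwr] at hw hwe
    have hr1 : |w.re| < 1 := by simpa using hw
    rw [abs_lt] at hr1
    rcases lt_trichotomy w.re 0 with h | h | h
    · exact hhalf (-1) 0 le_rfl zero_le_one (by rw [closure_Ioo (by norm_num)]; simp) (by simp)
        _ ⟨hr1.1, h⟩ s hs hwe.symm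
    · rw [h, ← h0] at hwe
      have := hfi ⟨le_rfl, one_pos⟩ ⟨ha0.le.trans hs.1, hs.2.trans_lt hb1⟩ hwe
      linarith [hs.1]
    · exact hhalf 0 1 (by norm_num) le_rfl (by rw [closure_Ioo (by norm_num)]; simp) (by simp)
        _ ⟨h, hr1.2⟩ s hs hwe.symm
  · exact ⟨s₁, ⟨min_le_left _ _, le_max_left _ _⟩, by simpa using he₁⟩
  · exact ⟨s₂, ⟨min_le_right _ _, le_max_right _ _⟩, by simpa using he₂⟩

/-! ### Cycles in finite graphs and their realization by curves -/

/-- In a finite graph with even degrees no edge is a bridge: if the removal of an edge separated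
its ends, then one end would be the only vertex of odd degree in its component. -/
theorem SimpleGraph.exists_cycle_of_even_degree {N : Type*} [Fintype N] (G : SimpleGraph N)
    [DecidableRel G.Adj] (hG : ∀ w, Even (G.degree w)) {u v : N} (huv : G.Adj u v) :
    ∃ (w : N) (p : G.Walk w w), p.IsCycle ∧ s(u, v) ∈ p.edges := by
  classical
  by_contra! hcon
  have hb : G.IsBridge s(u, v) :=
    (SimpleGraph.isBridge_iff_forall_cycle_notMem (G.mem_edgeSet.2 huv)).2 hcon
  rw [SimpleGraph.isBridge_iff] at hb
  set G' := G.deleteEdges {s(u, v)} with hG'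
  -- the component of `u` after the removal of the edge
  let H : SimpleGraph N :=
    { Adj := fun a b => G'.Adj a b ∧ G'.Reachable u a
      symm := ⟨fun a b h => ⟨h.1.symm, h.2.trans h.1.reachable⟩⟩
      loopless := ⟨fun a h => h.1.ne rfl⟩ }
  have hHadj : ∀ a b, H.Adj a b ↔ G'.Adj a b ∧ G'.Reachable u a := fun a b => Iff.rfl
  have hG'adj : ∀ a b, G'.Adj a b ↔ G.Adj a b ∧ s(a, b) ≠ s(u, v) := fun a b => by
    simp [hG', SimpleGraph.deleteEdges_adj]
  have hdeg0 : ∀ w, ¬ G'.Reachable u w → H.degree w = 0 := by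
    intro w hw
    rw [SimpleGraph.degree, Finset.card_eq_zero, Finset.eq_empty_iff_forall_notMem]
    intro x hx
    exact hw ((hHadj _ _).1 ((H.mem_neighborFinset _ _).1 hx)).2
  have hdeg1 : ∀ w, G'.Reachable u w → w ≠ u → H.degree w = G.degree w := by
    intro w hw hwu
    have hwv : w ≠ v := by rintro rfl; exact hb hw
    rw [SimpleGraph.degree, SimpleGraph.degree]
    congr 1
    ext x
    simp only [SimpleGraph.mem_neighborFinset, hHadj, hG'adj, hw, and_true]
    refine and_iff_left fun h => ?_
    rcases Sym2.eq_iff.1 h with h | h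
    · exact hwu h.1
    · exact hwv h.1
  have hdegu : H.degree u + 1 = G.degree u := by
    have : G.neighborFinset u = insert v (H.neighborFinset u) := by
      ext x
      simp only [SimpleGraph.mem_neighborFinset, hHadj, hG'adj, Finset.mem_insert,
        SimpleGraph.Reachable.refl, and_true]
      constructor
      · intro h
        by_cases hx : x = v
        · exact Or.inl hx
        · refine Or.inr ⟨h, fun he => ?_⟩
          rcases Sym2.eq_iff.1 he with h' | h'
          · exact hx h'.2
          · exact huv.ne h'.1
      · rintro (rfl | h)
        · exact huv
        · exact h.1
    rw [SimpleGraph.degree, SimpleGraph.degree, this, Finset.card_insert_of_notMem]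
    simp [hHadj, hG'adj]
  have hodd : ({w | Odd (H.degree w)} : Finset N) = {u} := by
    ext w
    simp only [Finset.mem_filter, Finset.mem_univ, true_and, Finset.mem_singleton]
    constructor
    · intro hw
      by_contra hwu
      by_cases hr : G'.Reachable u w
      · rw [hdeg1 w hr hwu] at hw
        exact (Nat.not_even_iff_odd.2 hw) (hG w)
      · rw [hdeg0 w hr] at hw
        exact absurd hw (by decide)
    · rintro rfl
      have := hG w
      rw [← hdegu] at this
      exact Nat.not_even_iff_odd.1 fun he => by
        rw [Nat.even_add_one] at this
        exact this he
  have := H.even_card_odd_degree_vertices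
  rw [hodd] at this
  exact absurd this (by simp)

section Realization

variable {N : Type*} {G : SimpleGraph N} {pos : N → ℂ} {S : N → N → Set ℂ}

/-- If the edges of a graph are realized by arcs in the plane which meet only at common ends, then
a path of the graph is realized by an arc. -/
theorem SimpleGraph.Walk.IsPath.exists_isArc
    (hsymm : ∀ a b, S a b = S b a) (harc : ∀ a b, G.Adj a b → IsArc (S a b) (pos a) (pos b))
    (hS : ∀ a b c d, G.Adj a b → G.Adj c d → s(a, b) ≠ s(c, d) → ∀ z ∈ S a b, z ∈ S c d →
      ∃ w ∈ s(a, b), w ∈ s(c, d) ∧ z = pos w)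
    {u v : N} (p : G.Walk u v) (hp : p.IsPath) (huv : u ≠ v) :
    ∃ A, IsArc A (pos u) (pos v) ∧ ∀ z, z ∈ A ↔ ∃ a b, s(a, b) ∈ p.edges ∧ z ∈ S a b := by
  induction p with
  | nil => exact absurd rfl huv
  | @cons u w v h q ih =>
    rw [SimpleGraph.Walk.cons_isPath_iff] at hp
    by_cases hwv : w = v
    · subst hwv
      refine ⟨S u w, harc u w h, fun z => ?_⟩
      have hq : q = SimpleGraph.Walk.nil := (SimpleGraph.Walk.isPath_iff_nil.1 hp.1).eq_nil
      subst hq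
      simp only [SimpleGraph.Walk.edges_cons, SimpleGraph.Walk.edges_nil, List.mem_singleton]
      constructor
      · intro hz
        exact ⟨u, w, rfl, hz⟩
      · rintro ⟨a, b, hab, hz⟩
        rcases Sym2.eq_iff.1 hab with ⟨rfl, rfl⟩ | ⟨rfl, rfl⟩
        · exact hz
        · rwa [hsymm]
    · obtain ⟨A, hA, hAm⟩ := ih hp.1 hwv
      refine ⟨S u w ∪ A, (harc u w h).trans hA ?_, fun z => ?_⟩
      · rintro z ⟨hz1, hz2⟩
        obtain ⟨a, b, hab, hz⟩ := (hAm z).1 hz2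
        have hua : u ∉ s(a, b) := fun hu => hp.2 (by
          rcases Sym2.mem_iff.1 hu with rfl | rfl
          · exact q.fst_mem_support_of_mem_edges hab
          · exact q.snd_mem_support_of_mem_edges hab)
        obtain ⟨x, hx1, hx2, rfl⟩ := hS u w a b h (q.adj_of_mem_edges hab)
          (fun he => hua (he ▸ Sym2.mem_mk_left u w)) z hz1 hz
        rcases Sym2.mem_iff.1 hx1 with rfl | rfl
        · exact absurd hx2 hua
        · rfl
      · simp only [SimpleGraph.Walk.edges_cons, List.mem_cons, mem_union, hAm]
        constructor
        · rintro (hz | ⟨a, b, hab, hz⟩)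
          · exact ⟨u, w, Or.inl rfl, hz⟩
          · exact ⟨a, b, Or.inr hab, hz⟩
        · rintro ⟨a, b, hab | hab, hz⟩
          · rcases Sym2.eq_iff.1 hab with ⟨rfl, rfl⟩ | ⟨rfl, rfl⟩
            · exact Or.inl hz
            · exact Or.inl (by rwa [hsymm])
          · exact Or.inr ⟨a, b, hab, hz⟩

/-- If the edges of a graph are realized by arcs in the plane which meet only at common ends, then
a cycle of the graph is realized by a simple closed curve. -/
theorem SimpleGraph.Walk.IsCycle.exists_isSimpleClosedCurve
    (hsymm : ∀ a b, S a b = S b a) (harc : ∀ a b, G.Adj a b → IsArc (S a b) (pos a) (pos b))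
    (hS : ∀ a b c d, G.Adj a b → G.Adj c d → s(a, b) ≠ s(c, d) → ∀ z ∈ S a b, z ∈ S c d →
      ∃ w ∈ s(a, b), w ∈ s(c, d) ∧ z = pos w)
    {u : N} (p : G.Walk u u) (hp : p.IsCycle) :
    ∃ C, IsSimpleClosedCurve C ∧ ∀ z, z ∈ C ↔ ∃ a b, s(a, b) ∈ p.edges ∧ z ∈ S a b := by
  cases p with
  | nil => exact absurd rfl hp.ne_nil
  | @cons _ v _ h q =>
    rw [SimpleGraph.Walk.cons_isCycle_iff] at hp
    obtain ⟨A, hA, hAm⟩ := SimpleGraph.Walk.IsPath.exists_isArc hsymm harc hS q hp.1 h.ne'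
    refine ⟨S u v ∪ A, (harc u v h).isSimpleClosedCurve_union hA ?_, fun z => ?_⟩
    · rintro z ⟨hz1, hz2⟩
      obtain ⟨a, b, hab, hz⟩ := (hAm z).1 hz2
      obtain ⟨x, hx1, -, rfl⟩ := hS u v a b h (q.adj_of_mem_edges hab)
        (fun he => hp.2 (he ▸ hab)) z hz1 hz
      rcases Sym2.mem_iff.1 hx1 with rfl | rfl <;> simp
    · simp only [SimpleGraph.Walk.edges_cons, List.mem_cons, mem_union, hAm]
      constructor
      · rintro (hz | ⟨a, b, hab, hz⟩)
        · exact ⟨u, v, Or.inl rfl, hz⟩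
        · exact ⟨a, b, Or.inr hab, hz⟩
      · rintro ⟨a, b, hab | hab, hz⟩
        · rcases Sym2.eq_iff.1 hab with ⟨rfl, rfl⟩ | ⟨rfl, rfl⟩
          · exact Or.inl hz
          · exact Or.inl (by rwa [hsymm])
        · exact Or.inr ⟨a, b, hab, hz⟩

end Realization

/-! ### Level segments of an affine function on a triangle -/

theorem Fin.sum_three_of_ne {M : Type*} [AddCommMonoid M] {a b c : Fin 3} (hab : a ≠ b)
    (hac : a ≠ c) (hbc : b ≠ c) (f : Fin 3 → M) : ∑ k, f k = f a + f b + f c := by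
  have h : (Finset.univ : Finset (Fin 3)) = {a, b, c} := by decide +revert
  rw [h, Finset.sum_insert (by simp [hab, hac]), Finset.sum_insert (by simp [hbc]),
    Finset.sum_singleton, add_assoc]

theorem Fin.eq_or_eq_or_eq_of_ne {a b c : Fin 3} (hab : a ≠ b) (hac : a ≠ c) (hbc : b ≠ c)
    (k : Fin 3) : k = a ∨ k = b ∨ k = c := by decide +revert

theorem Fin.exists_ne_and_ne (a b : Fin 3) : ∃ c : Fin 3, c ≠ a ∧ c ≠ b := by decide +revert

namespace AffineBasis

variable (b : AffineBasis (Fin 3) ℝ ℂ) (v : Fin 3 → ℝ) (l : ℝ)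

/-- The closed triangle spanned by an affine basis of the plane. -/
def triangle : Set ℂ := {z | ∀ k, 0 ≤ b.coord k z}

/-- The open triangle spanned by an affine basis of the plane. -/
def openTriangle : Set ℂ := {z | ∀ k, 0 < b.coord k z}

/-- The affine function with the values `v` at the points of the basis. -/
noncomputable def interpolate : ℂ →ᵃ[ℝ] ℝ :=
  v 0 • b.coord 0 + v 1 • b.coord 1 + v 2 • b.coord 2

/-- The point `z` is in the relative interior of the side opposite to the corner `k`. -/
def OnSide (k : Fin 3) (z : ℂ) : Prop := b.coord k z = 0 ∧ ∀ j, j ≠ k → 0 < b.coord j z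

/-- The point `z` of the level set is an end of the level segment, of type `Sum.inl k` if it is the
corner `k` and of type `Sum.inr k` if it is inside the side opposite to the corner `k`. -/
def IsLevelEnd : Fin 3 ⊕ Fin 3 → ℂ → Prop
  | Sum.inl k, z => v k = l ∧ z = b k
  | Sum.inr k, z => b.OnSide k z ∧ b.interpolate v z = l

theorem interpolate_apply (z : ℂ) : b.interpolate v z = ∑ k, b.coord k z * v k := by
  simp [interpolate, Fin.sum_univ_three, mul_comm]

theorem openTriangle_subset_triangle : b.openTriangle ⊆ b.triangle := fun _ hz k => (hz k).le

theorem triangle_eq_convexHull : b.triangle = convexHull ℝ (range b) :=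
  (AffineBasis.convexHull_eq_nonneg_coord b).symm

theorem openTriangle_eq_interior : b.openTriangle = interior b.triangle := by
  rw [triangle_eq_convexHull, b.interior_convexHull]; rfl

theorem isOpen_openTriangle : IsOpen b.openTriangle := by
  rw [openTriangle_eq_interior]; exact isOpen_interior

theorem isCompact_triangle : IsCompact b.triangle := by
  rw [triangle_eq_convexHull]
  exact (Set.finite_range b).isCompact_convexHull ℝ

theorem convex_triangle : Convex ℝ b.triangle := by
  rw [triangle_eq_convexHull]
  exact convex_convexHull _ _

theorem point_mem_triangle (k : Fin 3) : b k ∈ b.triangle := by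
  rw [triangle_eq_convexHull]
  exact subset_convexHull _ _ (mem_range_self k)

theorem interpolate_point (k : Fin 3) : b.interpolate v (b k) = v k := by
  rw [interpolate_apply, Finset.sum_eq_single k]
  · simp
  · intro j _ hj
    simp [b.coord_apply_ne hj]
  · simp

theorem coord_lineMap (x y : ℂ) (s : ℝ) (k : Fin 3) :
    b.coord k (AffineMap.lineMap x y s) = (1 - s) * b.coord k x + s * b.coord k y := by
  rw [AffineMap.apply_lineMap, AffineMap.lineMap_apply_module]
  simp

theorem interpolate_lineMap (x y : ℂ) (s : ℝ) :
    b.interpolate v (AffineMap.lineMap x y s) =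
      (1 - s) * b.interpolate v x + s * b.interpolate v y := by
  rw [AffineMap.apply_lineMap, AffineMap.lineMap_apply_module]
  simp

/-- On a level set a point is determined by one coordinate, unless the function is constant along
the corresponding side. -/
theorem eq_of_coord_eq {i j k : Fin 3} (hij : i ≠ j) (hik : i ≠ k) (hjk : j ≠ k)
    (hv : v i ≠ v j) {z w : ℂ} (hk : b.coord k z = b.coord k w)
    (hzw : b.interpolate v z = b.interpolate v w) : z = w := by
  have h1 := b.sum_coord_apply_eq_one z
  have h2 := b.sum_coord_apply_eq_one w
  rw [interpolate_apply, interpolate_apply, Fin.sum_three_of_ne hij hik hjk,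
    Fin.sum_three_of_ne hij hik hjk] at hzw
  rw [Fin.sum_three_of_ne hij hik hjk] at h1 h2
  have e : (b.coord i z - b.coord i w) * (v i - v j) = 0 := by
    rw [hk] at hzw h1
    have : b.coord j z = b.coord j w + b.coord i w - b.coord i z := by linarith
    rw [this] at hzw
    linear_combination hzw
  have hi : b.coord i z = b.coord i w := by
    rcases mul_eq_zero.1 e with h | h
    · linarith
    · exact absurd (by linarith) hv
  apply b.ext_elem
  intro m
  rcases Fin.eq_or_eq_or_eq_of_ne hij hik hjk m with rfl | rfl | rfl
  · exact hi
  · rw [hk] at h1; linarith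
  · exact hk

variable {b v l}

theorem OnSide.mem_triangle {k : Fin 3} {z : ℂ} (h : b.OnSide k z) : z ∈ b.triangle := by
  intro j
  by_cases hj : j = k
  · rw [hj, h.1]
  · exact (h.2 j hj).le

theorem OnSide.eq {k j : Fin 3} {z : ℂ} (h : b.OnSide k z) (hj : b.coord j z = 0) : j = k := by
  by_contra hne
  exact (h.2 j hne).ne' hj

theorem coord_self (k : Fin 3) : b.coord k (b k) = 1 := by simp

/-- A point of a closed triangle is in the open triangle, inside a side, or a corner. -/
theorem mem_triangle_cases {z : ℂ} (hz : z ∈ b.triangle) :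
    z ∈ b.openTriangle ∨ (∃ k, b.OnSide k z) ∨ ∃ k, z = b k := by
  by_cases h : ∃ k, b.coord k z = 0
  · obtain ⟨k, hk⟩ := h
    by_cases h' : ∃ j, j ≠ k ∧ b.coord j z = 0
    · obtain ⟨j, hjk, hj⟩ := h'
      obtain ⟨i, hik, hij⟩ := Fin.exists_ne_and_ne k j
      refine Or.inr (Or.inr ⟨i, b.ext_elem fun m => ?_⟩)
      have h1 := b.sum_coord_apply_eq_one z
      rw [Fin.sum_three_of_ne hik hij hjk.symm, hk, hj] at h1
      rcases Fin.eq_or_eq_or_eq_of_ne hik hij hjk.symm m with rfl | rfl | rfl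
      · rw [coord_self]; linarith
      · rw [hk, b.coord_apply_ne hik.symm]
      · rw [hj, b.coord_apply_ne hij.symm]
    · push Not at h'
      exact Or.inr (Or.inl ⟨k, hk, fun j hj => lt_of_le_of_ne (hz j) (h' j hj).symm⟩)
  · push Not at h
    exact Or.inl fun k => lt_of_le_of_ne (hz k) (h k).symm

theorem OnSide.not_eq_point {k j : Fin 3} {z : ℂ} (h : b.OnSide k z) : z ≠ b j := by
  rintro rfl
  obtain ⟨i, hik, hij⟩ := Fin.exists_ne_and_ne k j
  have := h.2 i hik
  rw [b.coord_apply_ne hij] at this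
  exact lt_irrefl _ this

theorem point_not_mem_openTriangle (j : Fin 3) : b j ∉ b.openTriangle := by
  intro h
  obtain ⟨i, hij, -⟩ := Fin.exists_ne_and_ne j j
  have := h i
  rw [b.coord_apply_ne hij] at this
  exact lt_irrefl _ this

theorem OnSide.not_mem_openTriangle {k : Fin 3} {z : ℂ} (h : b.OnSide k z) :
    z ∉ b.openTriangle := fun h' => (h' k).ne' h.1

theorem IsLevelEnd.mem_triangle {κ : Fin 3 ⊕ Fin 3} {z : ℂ} (h : b.IsLevelEnd v l κ z) :
    z ∈ b.triangle := by
  rcases κ with k | k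
  · rw [h.2]; exact b.point_mem_triangle k
  · exact h.1.mem_triangle

theorem IsLevelEnd.interpolate_eq {κ : Fin 3 ⊕ Fin 3} {z : ℂ} (h : b.IsLevelEnd v l κ z) :
    b.interpolate v z = l := by
  rcases κ with k | k
  · rw [h.2, interpolate_point, h.1]
  · exact h.2

theorem IsLevelEnd.not_mem_openTriangle {κ : Fin 3 ⊕ Fin 3} {z : ℂ} (h : b.IsLevelEnd v l κ z) :
    z ∉ b.openTriangle := by
  rcases κ with k | k
  · rw [h.2]; exact point_not_mem_openTriangle k
  · exact h.1.not_mem_openTriangle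

theorem IsLevelEnd.kind_unique {κ κ' : Fin 3 ⊕ Fin 3} {z : ℂ} (h : b.IsLevelEnd v l κ z)
    (h' : b.IsLevelEnd v l κ' z) : κ = κ' := by
  rcases κ with k | k <;> rcases κ' with k' | k'
  · rw [b.ind.injective (h.2.symm.trans h'.2)]
  · exact absurd h.2 h'.1.not_eq_point
  · exact absurd h'.2 h.1.not_eq_point
  · rw [h.1.eq h'.1.1]

theorem exists_isLevelEnd_of_not_mem {z : ℂ} (hz : z ∈ b.triangle) (hl : b.interpolate v z = l)
    (ho : z ∉ b.openTriangle) : ∃ κ, b.IsLevelEnd v l κ z := by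
  rcases mem_triangle_cases hz with h | ⟨k, h⟩ | ⟨k, rfl⟩
  · exact absurd h ho
  · exact ⟨Sum.inr k, h, hl⟩
  · rw [interpolate_point] at hl
    exact ⟨Sum.inl k, hl, rfl⟩

/-- The point at which the level `l` is attained inside a side. -/
theorem exists_onSide {i j k : Fin 3} (hij : i ≠ j) (hik : i ≠ k) (hjk : j ≠ k) (hi : v i < l)
    (hj : l < v j) : ∃ z, b.OnSide k z ∧ b.interpolate v z = l := by
  have hd : 0 < v j - v i := by linarith
  refine ⟨AffineMap.lineMap (b i) (b j) ((l - v i) / (v j - v i)), ⟨?_, ?_⟩, ?_⟩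
  · rw [coord_lineMap, b.coord_apply_ne hik.symm, b.coord_apply_ne hjk.symm]; simp
  · intro m hm
    have h1 : 0 < (l - v i) / (v j - v i) := by apply div_pos <;> linarith
    have h2 : 0 < 1 - (l - v i) / (v j - v i) := by
      rw [sub_pos, div_lt_one hd]; linarith
    rw [coord_lineMap]
    rcases Fin.eq_or_eq_or_eq_of_ne hij hik hjk m with rfl | rfl | rfl
    · rw [coord_self, b.coord_apply_ne hij]; simpa using h2
    · rw [coord_self, b.coord_apply_ne hij.symm]; simpa using h1
    · exact absurd rfl hm
  · rw [interpolate_lineMap, interpolate_point, interpolate_point]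
    field_simp
    ring

/-- If the level `l` is attained inside a side, then it is strictly between the values at the ends
of the side, unless both of them are `l`. -/
theorem OnSide.lt_or_lt {i j k : Fin 3} (hij : i ≠ j) (hik : i ≠ k) (hjk : j ≠ k) {z : ℂ}
    (h : b.OnSide k z) (hl : b.interpolate v z = l) (hv : ¬ (v i = l ∧ v j = l)) :
    (v i < l ∧ l < v j) ∨ (v j < l ∧ l < v i) := by
  have h1 := b.sum_coord_apply_eq_one z
  rw [interpolate_apply, Fin.sum_three_of_ne hij hik hjk, h.1] at hl
  rw [Fin.sum_three_of_ne hij hik hjk, h.1] at h1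
  have hi := h.2 i hik
  have hj := h.2 j hjk
  have e : b.coord i z * (v i - l) + b.coord j z * (v j - l) = 0 := by
    linear_combination hl - l * h1
  rcases lt_trichotomy (v i) l with h2 | h2 | h2
  · refine Or.inl ⟨h2, ?_⟩
    by_contra! h3
    nlinarith
  · exfalso
    rw [h2, sub_self, mul_zero, zero_add] at e
    rcases mul_eq_zero.1 e with h3 | h3
    · exact hj.ne' h3
    · exact hv ⟨h2, by linarith⟩
  · refine Or.inr ⟨?_, h2⟩
    by_contra! h3
    nlinarith

/-- If an affine function on a triangle has corners with values above and below `l`, then its level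
set is a segment joining two boundary points of different kinds, and the relative interior of this
segment lies in the open triangle. -/
theorem exists_levelEnds (hlo : ∃ i, v i < l) (hhi : ∃ i, l < v i) :
    ∃ κ₁ κ₂ : Fin 3 ⊕ Fin 3, ∃ z₁ z₂ : ℂ, κ₁ ≠ κ₂ ∧ b.IsLevelEnd v l κ₁ z₁ ∧
      b.IsLevelEnd v l κ₂ z₂ ∧
      (∀ z ∈ b.triangle, b.interpolate v z = l → z ∈ segment ℝ z₁ z₂) ∧
      (∀ s ∈ Ioo (0 : ℝ) 1, AffineMap.lineMap z₁ z₂ s ∈ b.openTriangle) := by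
  obtain ⟨i, hi⟩ := hlo
  obtain ⟨j, hj⟩ := hhi
  have hij : i ≠ j := by rintro rfl; exact lt_asymm hi hj
  obtain ⟨k, hki, hkj⟩ := Fin.exists_ne_and_ne i j
  have hik := hki.symm
  have hjk := hkj.symm
  obtain ⟨z₁, hz₁, hz₁l⟩ := exists_onSide (b := b) hij hik hjk hi hj
  -- the other end: on one of the other sides, or the corner `k`
  obtain ⟨κ₂, z₂, hκ₂, hk2, m, hmk, hm⟩ : ∃ κ₂ z₂, b.IsLevelEnd v l κ₂ z₂ ∧ 0 < b.coord k z₂ ∧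
      ∃ m, m ≠ k ∧ b.coord m z₂ = 0 := by
    rcases lt_trichotomy (v k) l with h | h | h
    · obtain ⟨z, hz, hzl⟩ := exists_onSide (b := b) hkj hki hij.symm h hj
      exact ⟨Sum.inr i, z, ⟨hz, hzl⟩, hz.2 k hki, i, hik, hz.1⟩
    · exact ⟨Sum.inl k, b k, ⟨h, rfl⟩, by simp, i, hik, b.coord_apply_ne hik⟩
    · obtain ⟨z, hz, hzl⟩ := exists_onSide (b := b) hik hij hkj hi h
      exact ⟨Sum.inr j, z, ⟨hz, hzl⟩, hz.2 k hkj, j, hjk, hz.1⟩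
  have hκ₁ : b.IsLevelEnd v l (Sum.inr k) z₁ := ⟨hz₁, hz₁l⟩
  refine ⟨Sum.inr k, κ₂, z₁, z₂, ?_, hκ₁, hκ₂, ?_, ?_⟩
  · rintro rfl
    exact hk2.ne' hκ₂.1.1
  · intro z hz hzl
    set s := b.coord k z / b.coord k z₂ with hs
    have hs0 : 0 ≤ s := div_nonneg (hz k) hk2.le
    have hze : z = AffineMap.lineMap z₁ z₂ s := by
      refine b.eq_of_coord_eq v hij hik hjk (by linarith) ?_ ?_
      · rw [coord_lineMap, hz₁.1, hs]; field_simp; ring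
      · rw [interpolate_lineMap, hzl, hz₁l, hκ₂.interpolate_eq]; ring
    have hs1 : s ≤ 1 := by
      have h1 := hz m
      rw [hze, coord_lineMap, hm] at h1
      have h2 := hz₁.2 m hmk
      by_contra! h3
      nlinarith
    rw [segment_eq_image_lineMap]
    exact ⟨s, ⟨hs0, hs1⟩, hze.symm⟩
  · intro s hs n
    rw [coord_lineMap]
    have h2 := hκ₂.mem_triangle n
    have hs1 : 0 < 1 - s := by linarith [hs.2]
    by_cases hn : n = k
    · rw [hn, hz₁.1]
      have := mul_pos hs.1 hk2
      linarith
    · have := mul_pos hs1 (hz₁.2 n hn)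
      have := mul_nonneg hs.1.le h2
      linarith

theorem continuous_interpolate : Continuous (b.interpolate v) :=
  AffineMap.continuous_of_finiteDimensional _

end AffineBasis

/-! ### Triangulated regions and the graph of a level set -/

/-- The data of a triangulated planar region: every triangle is given by a model triangle in the
plane and a chart defined on it; its corners are labelled by vertices, and the side opposite to the
corner `k` is labelled by the edge `edge τ k`. Different edges may have the same ends. -/
structure AffineTriangulation (V Tri Edge : Type*) where
  basis : Tri → AffineBasis (Fin 3) ℝ ℂ
  chart : Tri → ℂ → ℂ
  vert : Tri → Fin 3 → V
  edge : Tri → Fin 3 → Edge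
  pos : V → ℂ

namespace AffineTriangulation

variable {V Tri Edge : Type*} (X : AffineTriangulation V Tri Edge)

/-- The closed model triangle of `τ`. -/
def dom (τ : Tri) : Set ℂ := (X.basis τ).triangle

/-- The data `X` is a triangulation of the set `D`: the charts are embeddings, their images cover
`D`, and two triangles meet only along common edges and at common vertices. -/
structure Triangulates (D : Set ℂ) : Prop where
  continuousOn : ∀ τ, ContinuousOn (X.chart τ) (X.dom τ)
  injOn : ∀ τ, InjOn (X.chart τ) (X.dom τ)
  isOpen_image : ∀ τ, ∀ U ⊆ X.dom τ, IsOpen U → IsOpen (X.chart τ '' U)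
  cover : D = ⋃ τ, X.chart τ '' X.dom τ
  chart_basis : ∀ τ k, X.chart τ (X.basis τ k) = X.pos (X.vert τ k)
  pos_injective : Function.Injective X.pos
  eq_of_mem_openTriangle : ∀ τ τ', ∀ z ∈ (X.basis τ).openTriangle, ∀ z' ∈ X.dom τ',
    X.chart τ z = X.chart τ' z' → τ = τ'
  exists_onSide : ∀ τ τ' k z, (X.basis τ).OnSide k z → ∀ z' ∈ X.dom τ',
    X.chart τ z = X.chart τ' z' → ∃ k', X.edge τ' k' = X.edge τ k ∧ (X.basis τ').OnSide k' z'
  side_eq : ∀ τ τ' k k', X.edge τ k = X.edge τ' k' →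
    X.chart τ '' {z ∈ X.dom τ | (X.basis τ).coord k z = 0} =
      X.chart τ' '' {z ∈ X.dom τ' | (X.basis τ').coord k' z = 0}
  ends_eq : ∀ τ τ' k k', X.edge τ k = X.edge τ' k' → ∀ j, j ≠ k →
    ∃ j', j' ≠ k' ∧ X.vert τ' j' = X.vert τ j

/-- The function `h` is the piecewise affine extension of `g`, and the level `l` is not attained at
both ends of any edge. Edges whose ends have different values belong to exactly two triangles. -/
structure IsRegularAt (g : V → ℝ) (h : ℂ → ℝ) (l : ℝ) : Prop where
  apply_chart : ∀ τ, ∀ z ∈ X.dom τ,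
    h (X.chart τ z) = (X.basis τ).interpolate (g ∘ X.vert τ) z
  not_both : ∀ τ i j, i ≠ j → ¬ (g (X.vert τ i) = l ∧ g (X.vert τ j) = l)
  ncard_edge : ∀ τ i j k, i ≠ j → i ≠ k → j ≠ k → g (X.vert τ i) ≠ g (X.vert τ j) →
    {η : Tri × Fin 3 | X.edge η.1 η.2 = X.edge τ k}.ncard = 2

/-- The triangle `τ` has corners with values below and above `l`. -/
def IsCrossing (g : V → ℝ) (l : ℝ) (τ : Tri) : Prop :=
  (∃ i, g (X.vert τ i) < l) ∧ ∃ i, l < g (X.vert τ i)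

/-- The node of the level set (a vertex, or an edge crossed by it) at which a level segment of the
triangle `τ` ends. -/
def node (τ : Tri) : Fin 3 ⊕ Fin 3 → V ⊕ Edge := Sum.map (X.vert τ) (X.edge τ)

/-- The point `z` of the model triangle of `τ` is an end of the level segment. -/
def IsEnd (g : V → ℝ) (l : ℝ) (τ : Tri) (κ : Fin 3 ⊕ Fin 3) (z : ℂ) : Prop :=
  (X.basis τ).IsLevelEnd (g ∘ X.vert τ) l κ z

/-- The level segment of the triangle `τ` ends at the node `ν`. -/
def IsIncident (g : V → ℝ) (l : ℝ) (ν : V ⊕ Edge) (τ : Tri) : Prop :=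
  X.IsCrossing g l τ ∧ ∃ κ z, X.IsEnd g l τ κ z ∧ X.node τ κ = ν

/-- The bipartite graph of the level set: every crossing triangle is joined to the two nodes at
which its level segment ends. Using triangles as vertices keeps the graph simple, although two
nodes may be joined by several level segments. -/
def levelGraph (g : V → ℝ) (l : ℝ) : SimpleGraph ((V ⊕ Edge) ⊕ Tri) where
  Adj a b := (∃ ν τ, X.IsIncident g l ν τ ∧ a = Sum.inl ν ∧ b = Sum.inr τ) ∨
    ∃ ν τ, X.IsIncident g l ν τ ∧ b = Sum.inl ν ∧ a = Sum.inr τ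
  symm := ⟨fun _ _ h => h.symm⟩
  loopless := ⟨fun a h => by
    rcases h with ⟨ν, τ, -, h1, h2⟩ | ⟨ν, τ, -, h1, h2⟩ <;> rw [h1] at h2 <;> exact absurd h2 (by simp)⟩

variable {X} {D : Set ℂ} {g : V → ℝ} {h : ℂ → ℝ} {l : ℝ}

theorem levelGraph_adj_inl_inr {ν : V ⊕ Edge} {τ : Tri} :
    (X.levelGraph g l).Adj (Sum.inl ν) (Sum.inr τ) ↔ X.IsIncident g l ν τ := by
  constructor
  · rintro (⟨ν', τ', h, h1, h2⟩ | ⟨ν', τ', -, h1, -⟩)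
    · rwa [Sum.inl_injective h1, Sum.inr_injective h2]
    · exact absurd h1 (by simp)
  · exact fun h => Or.inl ⟨ν, τ, h, rfl, rfl⟩

theorem not_levelGraph_adj_inl_inl {ν ν' : V ⊕ Edge} :
    ¬ (X.levelGraph g l).Adj (Sum.inl ν) (Sum.inl ν') := by
  simp [levelGraph]

theorem not_levelGraph_adj_inr_inr {τ τ' : Tri} :
    ¬ (X.levelGraph g l).Adj (Sum.inr τ) (Sum.inr τ') := by
  simp [levelGraph]

theorem Triangulates.vert_injective (hX : X.Triangulates D) (τ : Tri) :
    Function.Injective (X.vert τ) := by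
  intro i j hij
  have h1 := hX.injOn τ ((X.basis τ).point_mem_triangle i) ((X.basis τ).point_mem_triangle j)
    (by rw [hX.chart_basis, hX.chart_basis, hij])
  exact (X.basis τ).ind.injective h1

theorem Triangulates.edge_injective (hX : X.Triangulates D) (τ : Tri) :
    Function.Injective (X.edge τ) := by
  intro k k' hkk
  obtain ⟨i, hik, -⟩ := Fin.exists_ne_and_ne k k
  obtain ⟨j, hji, hjk⟩ := Fin.exists_ne_and_ne i k
  -- a point inside the side opposite to `k`
  obtain ⟨z, hz, -⟩ := AffineBasis.exists_onSide (b := X.basis τ) (v := fun m => if m = i then 0 else 2)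
    (l := 1) hji.symm hik hjk (by simp) (by simp [hji])
  have hmem : X.chart τ z ∈ X.chart τ '' {z ∈ X.dom τ | (X.basis τ).coord k z = 0} :=
    ⟨z, ⟨hz.mem_triangle, hz.1⟩, rfl⟩
  rw [hX.side_eq τ τ k k' hkk] at hmem
  obtain ⟨w, ⟨hw, hw0⟩, hwz⟩ := hmem
  rw [hX.injOn τ hw hz.mem_triangle hwz] at hw0
  exact (hz.eq hw0).symm

theorem Triangulates.node_injective (hX : X.Triangulates D) (τ : Tri) :
    Function.Injective (X.node τ) :=
  Sum.map_injective.2 ⟨hX.vert_injective τ, hX.edge_injective τ⟩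

theorem IsEnd.mem_dom {τ : Tri} {κ : Fin 3 ⊕ Fin 3} {z : ℂ} (hz : X.IsEnd g l τ κ z) :
    z ∈ X.dom τ := AffineBasis.IsLevelEnd.mem_triangle hz

/-- The level set meets an edge at the same point in all triangles at the edge. -/
theorem Triangulates.exists_isEnd_of_edge_eq (hX : X.Triangulates D) (hl : X.IsRegularAt g h l)
    {τ τ' : Tri} {k k' : Fin 3} {z : ℂ} (hz : X.IsEnd g l τ (Sum.inr k) z)
    (he : X.edge τ k = X.edge τ' k') :
    ∃ z', X.IsEnd g l τ' (Sum.inr k') z' ∧ X.chart τ' z' = X.chart τ z := by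
  have hmem : X.chart τ z ∈ X.chart τ '' {z ∈ X.dom τ | (X.basis τ).coord k z = 0} :=
    ⟨z, ⟨hz.mem_dom, hz.1.1⟩, rfl⟩
  rw [hX.side_eq τ τ' k k' he] at hmem
  obtain ⟨w, ⟨hw, hw0⟩, hwz⟩ := hmem
  obtain ⟨k'', -, hk''⟩ := hX.exists_onSide τ τ' k z hz.1 w hw hwz.symm
  obtain rfl := hk''.eq hw0
  refine ⟨w, ⟨hk'', ?_⟩, hwz⟩
  rw [← hl.apply_chart τ' w hw, hwz, hl.apply_chart τ z hz.mem_dom]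
  exact hz.2

theorem IsRegularAt.exists_lt (hl : X.IsRegularAt g h l) {τ : Tri} {k : Fin 3} {z : ℂ}
    (hz : X.IsEnd g l τ (Sum.inr k) z) :
    ∃ i j, i ≠ j ∧ i ≠ k ∧ j ≠ k ∧ g (X.vert τ i) < l ∧ l < g (X.vert τ j) := by
  obtain ⟨i, hik, -⟩ := Fin.exists_ne_and_ne k k
  obtain ⟨j, hji, hjk⟩ := Fin.exists_ne_and_ne i k
  rcases hz.1.lt_or_lt hji.symm hik hjk hz.2 (hl.not_both τ i j hji.symm) with h1 | h1
  · exact ⟨i, j, hji.symm, hik, hjk, h1⟩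
  · exact ⟨j, i, hji, hjk, hik, h1⟩

theorem IsRegularAt.isEnd_unique (hl : X.IsRegularAt g h l) {τ : Tri} {κ : Fin 3 ⊕ Fin 3}
    {z z' : ℂ} (hz : X.IsEnd g l τ κ z) (hz' : X.IsEnd g l τ κ z') : z = z' := by
  rcases κ with k | k
  · exact hz.2.trans hz'.2.symm
  · obtain ⟨i, j, hij, hik, hjk, h1, h2⟩ := hl.exists_lt hz
    exact (X.basis τ).eq_of_coord_eq _ hij hik hjk (show (g ∘ X.vert τ) i ≠ (g ∘ X.vert τ) j from
      (h1.trans h2).ne) (hz.1.1.trans hz'.1.1.symm) (hz.2.trans hz'.2.symm)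

/-- Two level segments end at the same point of the plane if and only if they end at the same
node. -/
theorem Triangulates.node_eq_iff (hX : X.Triangulates D) (hl : X.IsRegularAt g h l)
    {τ τ' : Tri} {κ κ' : Fin 3 ⊕ Fin 3} {z z' : ℂ} (hz : X.IsEnd g l τ κ z)
    (hz' : X.IsEnd g l τ' κ' z') :
    X.node τ κ = X.node τ' κ' ↔ X.chart τ z = X.chart τ' z' := by
  constructor
  · intro hn
    rcases κ with k | k <;> rcases κ' with k' | k'
    · rw [hz.2, hz'.2, hX.chart_basis, hX.chart_basis, Sum.inl_injective hn]
    · exact absurd hn (by simp [node])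
    · exact absurd hn (by simp [node])
    · obtain ⟨w, hw, hwz⟩ := hX.exists_isEnd_of_edge_eq hl hz (Sum.inr_injective hn)
      rw [hl.isEnd_unique hz' hw, hwz]
  · intro hc
    rcases κ with k | k <;> rcases κ' with k' | k'
    · rw [hz.2, hz'.2, hX.chart_basis, hX.chart_basis] at hc
      simp [node, hX.pos_injective hc]
    · obtain ⟨m, -, hm⟩ := hX.exists_onSide τ' τ k' z' hz'.1 z hz.mem_dom hc.symm
      exact absurd hz.2 hm.not_eq_point
    · obtain ⟨m, -, hm⟩ := hX.exists_onSide τ τ' k z hz.1 z' hz'.mem_dom hc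
      exact absurd hz'.2 hm.not_eq_point
    · obtain ⟨m, hme, hm⟩ := hX.exists_onSide τ τ' k z hz.1 z' hz'.mem_dom hc
      rw [hz'.1.eq hm.1] at hme
      simp [node, hme]

/-- The level segment of a crossing triangle. -/
theorem IsCrossing.exists_ends {τ : Tri} (hτ : X.IsCrossing g l τ) :
    ∃ κ₁ κ₂ : Fin 3 ⊕ Fin 3, ∃ z₁ z₂ : ℂ, κ₁ ≠ κ₂ ∧ X.IsEnd g l τ κ₁ z₁ ∧
      X.IsEnd g l τ κ₂ z₂ ∧
      (∀ z ∈ X.dom τ, (X.basis τ).interpolate (g ∘ X.vert τ) z = l → z ∈ segment ℝ z₁ z₂) ∧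
      (∀ s ∈ Ioo (0 : ℝ) 1, AffineMap.lineMap z₁ z₂ s ∈ (X.basis τ).openTriangle) ∧
      ∀ κ z, X.IsEnd g l τ κ z → (κ = κ₁ ∧ z = z₁) ∨ (κ = κ₂ ∧ z = z₂) := by
  obtain ⟨κ₁, κ₂, z₁, z₂, hκ, h1, h2, hseg, ho⟩ :=
    AffineBasis.exists_levelEnds (b := X.basis τ) (v := g ∘ X.vert τ) (l := l) hτ.1 hτ.2
  refine ⟨κ₁, κ₂, z₁, z₂, hκ, h1, h2, hseg, ho, fun κ z hz => ?_⟩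
  have hz' := hseg z hz.mem_dom (AffineBasis.IsLevelEnd.interpolate_eq hz)
  rw [segment_eq_image_lineMap] at hz'
  obtain ⟨s, hs, rfl⟩ := hz'
  rcases eq_or_lt_of_le hs.1 with h0 | h0
  · rw [← h0, AffineMap.lineMap_apply_zero] at hz ⊢
    exact Or.inl ⟨AffineBasis.IsLevelEnd.kind_unique hz h1, rfl⟩
  rcases eq_or_lt_of_le hs.2 with h3 | h3
  · rw [h3, AffineMap.lineMap_apply_one] at hz ⊢
    exact Or.inr ⟨AffineBasis.IsLevelEnd.kind_unique hz h2, rfl⟩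
  · exact absurd (ho s ⟨h0, h3⟩) (AffineBasis.IsLevelEnd.not_mem_openTriangle hz)

section Degree

open Classical in
/-- A triangle with a vertex at the level `l` crosses it if and only if exactly one of the other
two vertices lies above `l`; here this is expressed by counting the sides at the vertex with a
higher end. -/
theorem odd_card_higher_sides_iff (hX : X.Triangulates D) (hl : X.IsRegularAt g h l) {v : V}
    (hv : g v = l) (τ : Tri) :
    Odd (Finset.card {m : Fin 3 | ∃ k j, k ≠ j ∧ k ≠ m ∧ j ≠ m ∧ X.vert τ k = v ∧
      l < g (X.vert τ j)}) ↔ X.IsCrossing g l τ ∧ ∃ k, X.vert τ k = v := by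
  by_cases hk : ∃ k, X.vert τ k = v
  · obtain ⟨k, hk⟩ := hk
    obtain ⟨i, hik, -⟩ := Fin.exists_ne_and_ne k k
    obtain ⟨j, hji, hjk⟩ := Fin.exists_ne_and_ne i k
    have hall := Fin.eq_or_eq_or_eq_of_ne hji.symm hik hjk
    have hgk : g (X.vert τ k) = l := by rw [hk, hv]
    have hgi : g (X.vert τ i) ≠ l := fun h => hl.not_both τ i k hik ⟨h, hgk⟩
    have hgj : g (X.vert τ j) ≠ l := fun h => hl.not_both τ j k hjk ⟨h, hgk⟩
    have hset : ∀ m, (∃ k' j', k' ≠ j' ∧ k' ≠ m ∧ j' ≠ m ∧ X.vert τ k' = v ∧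
        l < g (X.vert τ j')) ↔ (m = j ∧ l < g (X.vert τ i)) ∨ (m = i ∧ l < g (X.vert τ j)) := by
      intro m
      constructor
      · rintro ⟨k', j', h1, h2, h3, h4, h5⟩
        obtain rfl := hX.vert_injective τ (h4.trans hk.symm)
        rcases hall j' with rfl | rfl | rfl
        · rcases hall m with rfl | rfl | rfl
          · exact absurd rfl h3
          · exact Or.inl ⟨rfl, h5⟩
          · exact absurd rfl h2
        · rcases hall m with rfl | rfl | rfl
          · exact Or.inr ⟨rfl, h5⟩
          · exact absurd rfl h3
          · exact absurd rfl h2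
        · exact absurd rfl h1
      · rintro (⟨rfl, h5⟩ | ⟨rfl, h5⟩)
        · exact ⟨k, i, hik.symm, hjk.symm, hji.symm, hk, h5⟩
        · exact ⟨k, j, hjk.symm, hik.symm, hji, hk, h5⟩
    have hcr : X.IsCrossing g l τ ↔ (g (X.vert τ i) < l ∧ l < g (X.vert τ j)) ∨
        (g (X.vert τ j) < l ∧ l < g (X.vert τ i)) := by
      constructor
      · rintro ⟨⟨a, ha⟩, ⟨b, hb⟩⟩
        rcases hall a with rfl | rfl | rfl <;> rcases hall b with rfl | rfl | rfl <;>
          first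
            | exact Or.inl ⟨ha, hb⟩
            | exact Or.inr ⟨ha, hb⟩
            | (exfalso; linarith)
      · rintro (h1 | h1)
        · exact ⟨⟨i, h1.1⟩, ⟨j, h1.2⟩⟩
        · exact ⟨⟨j, h1.1⟩, ⟨i, h1.2⟩⟩
    simp only [hset, hcr]
    have hex : ∃ k, X.vert τ k = v := ⟨k, hk⟩
    simp only [hex, and_true]
    rcases lt_or_gt_of_ne hgi with h1 | h1 <;> rcases lt_or_gt_of_ne hgj with h2 | h2
    · simp [h1, h2, not_lt.2 h1.le, not_lt.2 h2.le]
    · simp [h1, h2, not_lt.2 h1.le, not_lt.2 h2.le, Finset.filter_eq']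
    · simp [h1, h2, not_lt.2 h1.le, not_lt.2 h2.le, Finset.filter_eq']
    · have : ({m : Fin 3 | (m = j ∧ l < g (X.vert τ i)) ∨ (m = i ∧ l < g (X.vert τ j))} :
          Finset (Fin 3)) = {j, i} := by
        ext m; simp [show l < g (X.vert τ i) from h1, show l < g (X.vert τ j) from h2]
      rw [this, Finset.card_pair hji]
      simp [not_lt.2 (le_of_lt h1), not_lt.2 (le_of_lt h2)]
  · have : ({m : Fin 3 | ∃ k j, k ≠ j ∧ k ≠ m ∧ j ≠ m ∧ X.vert τ k = v ∧
      l < g (X.vert τ j)} : Finset (Fin 3)) = ∅ := by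
      rw [Finset.filter_eq_empty_iff]
      rintro m - ⟨k, j, -, -, -, h, -⟩
      exact hk ⟨k, h⟩
    rw [this]
    simp [hk]

variable [Fintype Tri]

open Classical in
/-- Around a vertex at the level `l` an even number of triangles cross this level: the edges from
the vertex to higher vertices have two sides each. -/
theorem even_card_crossing_at (hX : X.Triangulates D) (hl : X.IsRegularAt g h l) {v : V}
    (hv : g v = l) :
    Even (Finset.card {τ | X.IsCrossing g l τ ∧ ∃ k, X.vert τ k = v}) := by
  set P : Finset (Tri × Fin 3) := {η | ∃ k j, k ≠ j ∧ k ≠ η.2 ∧ j ≠ η.2 ∧ X.vert η.1 k = v ∧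
      l < g (X.vert η.1 j)} with hP
  have hPeven : Even P.card := by
    rw [Finset.card_eq_sum_card_fiberwise (f := fun η => X.edge η.1 η.2)
      (t := P.image fun η => X.edge η.1 η.2) (fun η hη => Finset.mem_image_of_mem _ hη)]
    refine Finset.even_sum _ fun ε hε => ?_
    obtain ⟨η, hη, rfl⟩ := Finset.mem_image.1 hε
    obtain ⟨-, k, j, hkj, hk, hj, hkv, hjl⟩ := Finset.mem_filter.1 hη
    have hvw : g (X.vert η.1 k) ≠ g (X.vert η.1 j) := by rw [hkv, hv]; exact hjl.ne
    have h2 := hl.ncard_edge η.1 k j η.2 hkj hk hj hvw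
    have : ({a ∈ P | X.edge a.1 a.2 = X.edge η.1 η.2} : Finset (Tri × Fin 3)).card = 2 := by
      rw [← h2, Set.ncard_eq_toFinset_card']
      congr 1
      ext a
      simp only [Finset.mem_filter, Set.mem_toFinset, Set.mem_ofPred_eq, hP, Finset.mem_univ,
        true_and, and_iff_right_iff_imp]
      intro ha
      obtain ⟨k', hk', hkv'⟩ := hX.ends_eq _ _ _ _ ha.symm k hk
      obtain ⟨j', hj', hjv'⟩ := hX.ends_eq _ _ _ _ ha.symm j hj
      refine ⟨k', j', ?_, hk', hj', hkv'.trans hkv, by rw [hjv']; exact hjl⟩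
      rintro rfl
      exact hvw (by rw [← hkv', hjv'])
    rw [this]
    exact even_two
  rw [Finset.card_eq_sum_card_fiberwise (f := Prod.fst) (t := Finset.univ)
    (fun _ _ => Finset.mem_coe.2 (Finset.mem_univ _)), Finset.even_sum_iff_even_card_odd] at hPeven
  convert! hPeven using 3
  rename_i τ _
  rw [← odd_card_higher_sides_iff hX hl hv τ]
  congr! 1
  refine Finset.card_bij (fun m _ => (τ, m)) ?_ ?_ ?_
  · intro m hm
    simpa [hP] using hm
  · intro m _ m' _ hmm
    exact (Prod.ext_iff.1 hmm).2
  · rintro ⟨τ', m⟩ hm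
    obtain ⟨hm1, rfl⟩ := Finset.mem_filter.1 hm
    exact ⟨m, by simpa [hP] using hm1, rfl⟩

variable [Fintype V] [Fintype Edge]

open Classical in
/-- The degree of a crossing triangle and of a crossed edge is 2, that of a vertex of level `l` is the
number of the crossing triangles at it, and the other nodes are isolated. -/
theorem even_degree_levelGraph (hX : X.Triangulates D) (hl : X.IsRegularAt g h l)
    (w : (V ⊕ Edge) ⊕ Tri) : Even ((X.levelGraph g l).degree w) := by
  rcases w with (v | ε) | τ
  · by_cases hv : g v = l
    · convert! even_card_crossing_at hX hl hv using 1
      symm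
      refine Finset.card_bij (fun τ _ => Sum.inr τ) ?_ ?_ ?_
      · intro τ hτ
        obtain ⟨-, hτ, k, hk⟩ := Finset.mem_filter.1 hτ
        rw [SimpleGraph.mem_neighborFinset, levelGraph_adj_inl_inr]
        exact ⟨hτ, Sum.inl k, X.basis τ k, ⟨by simp [hk, hv], rfl⟩, by simp [node, hk]⟩
      · intro τ _ τ' _ h
        exact Sum.inr_injective h
      · rintro (ν | τ) hτ <;> rw [SimpleGraph.mem_neighborFinset] at hτ
        · exact absurd hτ not_levelGraph_adj_inl_inl
        · obtain ⟨hc, κ, z, hz, hn⟩ := levelGraph_adj_inl_inr.1 hτ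
          rcases κ with k | k
          · exact ⟨τ, by simpa using ⟨hc, k, Sum.inl_injective hn⟩, rfl⟩
          · exact absurd hn (by simp [node])
    · rw [SimpleGraph.degree, Finset.card_eq_zero.2]
      · simp
      rw [Finset.eq_empty_iff_forall_notMem]
      rintro (ν | τ) hτ <;> rw [SimpleGraph.mem_neighborFinset] at hτ
      · exact absurd hτ not_levelGraph_adj_inl_inl
      · obtain ⟨hc, κ, z, hz, hn⟩ := levelGraph_adj_inl_inr.1 hτ
        rcases κ with k | k
        · exact hv (by rw [← Sum.inl_injective hn]; exact hz.1)
        · exact absurd hn (by simp [node])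
  · by_cases hn : ∃ τ k z, X.IsEnd g l τ (Sum.inr k) z ∧ X.edge τ k = ε
    · obtain ⟨τ, k, z, hz, rfl⟩ := hn
      obtain ⟨i, j, hij, hik, hjk, h1, h2⟩ := hl.exists_lt hz
      have h3 := hl.ncard_edge τ i j k hij hik hjk (h1.trans h2).ne
      have : (X.levelGraph g l).degree (Sum.inl (Sum.inr (X.edge τ k))) = 2 := by
        rw [← h3, Set.ncard_eq_toFinset_card', SimpleGraph.degree]
        symm
        refine Finset.card_bij (fun η _ => Sum.inr η.1) ?_ ?_ ?_
        · rintro ⟨τ', k'⟩ hη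
          have hη' : X.edge τ' k' = X.edge τ k := by simpa using hη
          obtain ⟨z', hz', -⟩ := hX.exists_isEnd_of_edge_eq hl hz hη'.symm
          obtain ⟨i', j', -, -, -, h1', h2'⟩ := hl.exists_lt hz'
          rw [SimpleGraph.mem_neighborFinset, levelGraph_adj_inl_inr]
          exact ⟨⟨⟨i', h1'⟩, ⟨j', h2'⟩⟩, Sum.inr k', z', hz', by simp [node, hη']⟩
        · rintro ⟨τ', k'⟩ hη ⟨τ'', k''⟩ hη' he
          have h1 : X.edge τ' k' = X.edge τ k := by simpa using hη
          have h2 : X.edge τ'' k'' = X.edge τ k := by simpa using hη'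
          obtain rfl : τ' = τ'' := Sum.inr_injective he
          rw [hX.edge_injective τ' (h1.trans h2.symm)]
        · rintro (ν | τ') hτ <;> rw [SimpleGraph.mem_neighborFinset] at hτ
          · exact absurd hτ not_levelGraph_adj_inl_inl
          · obtain ⟨hc, κ, z, hz, hn⟩ := levelGraph_adj_inl_inr.1 hτ
            rcases κ with k' | k'
            · exact absurd hn (by simp [node])
            · exact ⟨(τ', k'), by simpa using Sum.inr_injective hn, rfl⟩
      rw [this]
      exact even_two
    · rw [SimpleGraph.degree, Finset.card_eq_zero.2]
      · simp
      rw [Finset.eq_empty_iff_forall_notMem]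
      rintro (ν | τ) hτ <;> rw [SimpleGraph.mem_neighborFinset] at hτ
      · exact absurd hτ not_levelGraph_adj_inl_inl
      · obtain ⟨hc, κ, z, hz, hκ⟩ := levelGraph_adj_inl_inr.1 hτ
        rcases κ with k | k
        · exact absurd hκ (by simp [node])
        · exact hn ⟨τ, k, z, hz, Sum.inr_injective hκ⟩
  · by_cases hτ : X.IsCrossing g l τ
    · obtain ⟨κ₁, κ₂, z₁, z₂, hκ, h1, h2, -, -, hu⟩ := hτ.exists_ends
      have : (X.levelGraph g l).neighborFinset (Sum.inr τ) =
          {Sum.inl (X.node τ κ₁), Sum.inl (X.node τ κ₂)} := by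
        ext a
        simp only [SimpleGraph.mem_neighborFinset, Finset.mem_insert, Finset.mem_singleton]
        constructor
        · intro ha
          rcases a with ν | τ'
          · obtain ⟨hc, κ, z, hz, rfl⟩ := levelGraph_adj_inl_inr.1 ha.symm
            rcases hu κ z hz with ⟨rfl, -⟩ | ⟨rfl, -⟩ <;> simp
          · exact absurd ha not_levelGraph_adj_inr_inr
        · rintro (rfl | rfl)
          · exact (levelGraph_adj_inl_inr.2 ⟨hτ, κ₁, z₁, h1, rfl⟩).symm
          · exact (levelGraph_adj_inl_inr.2 ⟨hτ, κ₂, z₂, h2, rfl⟩).symm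
      rw [SimpleGraph.degree, this, Finset.card_pair]
      · exact even_two
      · intro h
        exact hκ (hX.node_injective τ (Sum.inl_injective h))
    · rw [SimpleGraph.degree, Finset.card_eq_zero.2]
      · simp
      rw [Finset.eq_empty_iff_forall_notMem]
      rintro (ν | τ') ha <;> rw [SimpleGraph.mem_neighborFinset] at ha
      · exact hτ (levelGraph_adj_inl_inr.1 ha.symm).1
      · exact absurd ha not_levelGraph_adj_inr_inr

end Degree

end AffineTriangulation

namespace AffineTriangulation

variable {V Tri Edge : Type*} {X : AffineTriangulation V Tri Edge}
  {D : Set ℂ} {g : V → ℝ} {h : ℂ → ℝ} {l : ℝ}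

/-! ### Simple closed curves through the points of a level set -/

theorem Triangulates.chart_mem (hX : X.Triangulates D) {τ : Tri} {z : ℂ} (hz : z ∈ X.dom τ) :
    X.chart τ z ∈ D := by
  rw [hX.cover]
  exact mem_iUnion.2 ⟨τ, z, hz, rfl⟩

theorem exists_isArc_of_segment (hX : X.Triangulates D) {τ : Tri} {z w : ℂ} (hz : z ∈ X.dom τ)
    (hw : w ∈ X.dom τ) (hzw : z ≠ w) :
    IsArc (X.chart τ '' segment ℝ z w) (X.chart τ z) (X.chart τ w) := by
  have hmaps : MapsTo (fun s : ℝ => (AffineMap.lineMap z w s : ℂ)) (Icc 0 1) (X.dom τ) := by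
    intro s hs
    exact (X.basis τ).convex_triangle.segment_subset hz hw
      (by rw [segment_eq_image_lineMap]; exact ⟨s, hs, rfl⟩)
  refine ⟨fun s => X.chart τ (AffineMap.lineMap z w s), ?_, ?_, by simp, by simp, ?_⟩
  · exact (hX.continuousOn τ).comp AffineMap.lineMap_continuous.continuousOn hmaps
  · intro s hs t ht hst
    exact AffineMap.lineMap_injective ℝ hzw (hX.injOn τ (hmaps hs) (hmaps ht) hst)
  · rw [segment_eq_image_lineMap, image_image]

/-- Every level segment lies in a union of simple closed curves of level `l`. They come from cycles
of the level graph, whose edges are realized by the halves of the level segments. -/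
theorem exists_isSimpleClosedCurve_through [Fintype V] [Fintype Tri] [Fintype Edge]
    (hX : X.Triangulates D) (hl : X.IsRegularAt g h l) {τ : Tri} (hτ : X.IsCrossing g l τ) {z : ℂ}
    (hz : z ∈ X.dom τ) (hzl : (X.basis τ).interpolate (g ∘ X.vert τ) z = l) :
    ∃ C, IsSimpleClosedCurve C ∧ C ⊆ {y ∈ D | h y = l} ∧ X.chart τ z ∈ C := by
  classical
  have hmid : ∀ τ, ∃ m, X.IsCrossing g l τ → ∃ z₁ z₂ : ℂ,
      (∃ κ, X.IsEnd g l τ κ z₁) ∧ (∃ κ, X.IsEnd g l τ κ z₂) ∧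
      (∀ z ∈ X.dom τ, (X.basis τ).interpolate (g ∘ X.vert τ) z = l → z ∈ segment ℝ z₁ z₂) ∧
      m = AffineMap.lineMap z₁ z₂ (1 / 2 : ℝ) ∧ m ∈ (X.basis τ).openTriangle ∧
      (X.basis τ).interpolate (g ∘ X.vert τ) m = l ∧
      ∀ κ z, X.IsEnd g l τ κ z → z = z₁ ∨ z = z₂ := by
    intro τ
    by_cases hτ : X.IsCrossing g l τ
    · obtain ⟨κ₁, κ₂, z₁, z₂, -, h1, h2, h3, h4, h5⟩ := hτ.exists_ends
      refine ⟨AffineMap.lineMap z₁ z₂ (1 / 2 : ℝ), fun _ => ⟨z₁, z₂, ⟨κ₁, h1⟩, ⟨κ₂, h2⟩, h3, rfl,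
        h4 _ (by norm_num), ?_, fun κ z hz => ?_⟩⟩
      · rw [AffineBasis.interpolate_lineMap, AffineBasis.IsLevelEnd.interpolate_eq h1,
          AffineBasis.IsLevelEnd.interpolate_eq h2]
        ring
      · rcases h5 κ z hz with ⟨-, h⟩ | ⟨-, h⟩
        · exact Or.inl h
        · exact Or.inr h
    · exact ⟨0, fun h => absurd h hτ⟩
  -- `M τ` is the midpoint of the level segment
  choose M hM using hmid
  have hp : ∀ ν : V ⊕ Edge, ∃ y : ℂ, ∀ τ κ z, X.IsEnd g l τ κ z → X.node τ κ = ν →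
      y = X.chart τ z := by
    intro ν
    by_cases hν : ∃ τ κ z, X.IsEnd g l τ κ z ∧ X.node τ κ = ν
    · obtain ⟨τ, κ, z, hz, rfl⟩ := hν
      exact ⟨X.chart τ z, fun τ' κ' z' hz' hn => (hX.node_eq_iff hl hz hz').1 hn.symm⟩
    · exact ⟨0, fun τ κ z hz hn => absurd ⟨τ, κ, z, hz, hn⟩ hν⟩
  -- `P ν` is the position of the node `ν`, the same in all triangles where `ν` is an end
  choose P hP using hp
  set S₀ : V ⊕ Edge → Tri → Set ℂ := fun ν τ =>
    {y | ∃ κ z, X.IsEnd g l τ κ z ∧ X.node τ κ = ν ∧ y ∈ X.chart τ '' segment ℝ z (M τ)} with hS₀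
  set S : (V ⊕ Edge) ⊕ Tri → (V ⊕ Edge) ⊕ Tri → Set ℂ := fun a b => match a, b with
    | Sum.inl ν, Sum.inr τ => S₀ ν τ
    | Sum.inr τ, Sum.inl ν => S₀ ν τ
    | _, _ => ∅ with hS
  set pos : (V ⊕ Edge) ⊕ Tri → ℂ := Sum.elim P fun τ => X.chart τ (M τ) with hpos
  have hsymm : ∀ a b, S a b = S b a := by
    rintro (a | a) (b | b) <;> rfl
  have hadj : ∀ a b, (X.levelGraph g l).Adj a b → ∃ ν τ, X.IsIncident g l ν τ ∧
      s(a, b) = s(Sum.inl ν, Sum.inr τ) ∧ S a b = S₀ ν τ := by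
    rintro a b (⟨ν, τ, hi, rfl, rfl⟩ | ⟨ν, τ, hi, rfl, rfl⟩)
    · exact ⟨ν, τ, hi, rfl, rfl⟩
    · exact ⟨ν, τ, hi, Sym2.eq_swap, rfl⟩
  have hMdom : ∀ τ, X.IsCrossing g l τ → M τ ∈ X.dom τ := fun τ hτ => by
    obtain ⟨z₁, z₂, -, -, -, -, h5, -⟩ := hM τ hτ
    exact (X.basis τ).openTriangle_subset_triangle h5
  -- the points of a half of a level segment
  have hhalf : ∀ τ κ z, X.IsCrossing g l τ → X.IsEnd g l τ κ z → ∀ w ∈ segment ℝ z (M τ),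
      w ∈ X.dom τ ∧ (X.basis τ).interpolate (g ∘ X.vert τ) w = l ∧
        (w = z ∨ w ∈ (X.basis τ).openTriangle) := by
    intro τ κ z hτ hz w hw
    refine ⟨(X.basis τ).convex_triangle.segment_subset hz.mem_dom (hMdom τ hτ) hw, ?_⟩
    obtain ⟨z₁, z₂, -, -, -, -, h5, h6, -⟩ := hM τ hτ
    rw [segment_eq_image_lineMap] at hw
    obtain ⟨s, hs, rfl⟩ := hw
    constructor
    · rw [AffineBasis.interpolate_lineMap, h6, AffineBasis.IsLevelEnd.interpolate_eq hz]; ring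
    · rcases eq_or_lt_of_le hs.1 with h0 | h0
      · left; rw [← h0, AffineMap.lineMap_apply_zero]
      · right
        intro k
        rw [AffineBasis.coord_lineMap]
        have h7 := mul_pos h0 (h5 k)
        have h8 := mul_nonneg (sub_nonneg.2 hs.2) (hz.mem_dom k)
        linarith
  have hS₀eq : ∀ τ κ z, X.IsEnd g l τ κ z → S₀ (X.node τ κ) τ = X.chart τ '' segment ℝ z (M τ) := by
    intro τ κ z hz
    ext y
    constructor
    · rintro ⟨κ', z', hz', hn, hy⟩
      obtain rfl := hX.node_injective τ hn
      rwa [hl.isEnd_unique hz hz']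
    · intro hy
      exact ⟨κ, z, hz, rfl, hy⟩
  have harc : ∀ a b, (X.levelGraph g l).Adj a b → IsArc (S a b) (pos a) (pos b) := by
    have key : ∀ ν τ, X.IsIncident g l ν τ → IsArc (S₀ ν τ) (P ν) (X.chart τ (M τ)) := by
      rintro ν τ ⟨hc, κ, z, hz, rfl⟩
      rw [hS₀eq τ κ z hz, hP _ τ κ z hz rfl]
      refine exists_isArc_of_segment hX hz.mem_dom (hMdom τ hc) ?_
      rintro rfl
      obtain ⟨z₁, z₂, -, -, -, -, h5, -⟩ := hM τ hc
      exact AffineBasis.IsLevelEnd.not_mem_openTriangle hz h5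
    rintro a b (⟨ν, τ, hi, rfl, rfl⟩ | ⟨ν, τ, hi, rfl, rfl⟩)
    · exact key ν τ hi
    · exact (key ν τ hi).symm
  have hdisj : ∀ a b c d, (X.levelGraph g l).Adj a b → (X.levelGraph g l).Adj c d →
      s(a, b) ≠ s(c, d) → ∀ y ∈ S a b, y ∈ S c d → ∃ w ∈ s(a, b), w ∈ s(c, d) ∧ y = pos w := by
    intro a b c d hab hcd hne y hy hy'
    obtain ⟨ν, τ, hi, he, hSe⟩ := hadj a b hab
    obtain ⟨ν', τ', hi', he', hSe'⟩ := hadj c d hcd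
    rw [he, he'] at hne ⊢
    rw [hSe] at hy
    rw [hSe'] at hy'
    obtain ⟨hc, -⟩ := hi
    obtain ⟨hc', -⟩ := hi'
    obtain ⟨κ, z, hz, rfl, w, hw, rfl⟩ := hy
    obtain ⟨κ', z', hz', rfl, w', hw', hww⟩ := hy'
    obtain ⟨hwd, -, hwo⟩ := hhalf τ κ z hc hz w hw
    obtain ⟨hwd', -, hwo'⟩ := hhalf τ' κ' z' hc' hz' w' hw'
    by_cases hττ : τ = τ'
    · subst hττ
      obtain rfl := hX.injOn τ hwd' hwd hww
      refine ⟨Sum.inr τ, by simp, by simp, ?_⟩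
      have hzz : z ≠ z' := by
        rintro rfl
        exact hne (by rw [AffineBasis.IsLevelEnd.kind_unique hz hz'])
      -- the two halves meet only in the middle
      have hm2 : (2 : ℂ) * M τ = z + z' := by
        obtain ⟨z₁, z₂, -, -, -, hm, -, -, hu⟩ := hM τ hc
        have : (2 : ℂ) * M τ = z₁ + z₂ := by
          rw [hm, AffineMap.lineMap_apply_module]
          simp only [Complex.real_smul]
          push_cast
          ring
        rw [this]
        rcases hu κ z hz with rfl | rfl <;> rcases hu κ' z' hz' with rfl | rfl
        · exact absurd rfl hzz
        · rfl
        · ring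
        · exact absurd rfl hzz
      rw [segment_eq_image_lineMap] at hw hw'
      obtain ⟨s, hs, rfl⟩ := hw
      obtain ⟨t, ht, hst⟩ := hw'
      rw [AffineMap.lineMap_apply_module, AffineMap.lineMap_apply_module] at hst
      simp only [Complex.real_smul] at hst
      push_cast at hst
      have h1 : ((2 - s - t : ℝ) : ℂ) * (z - z') = 0 := by
        push_cast
        linear_combination (-2) * hst + (t - s : ℂ) * hm2
      rcases mul_eq_zero.1 h1 with h2 | h2
      · have h3 : 2 - s - t = 0 := by exact_mod_cast h2
        have : s = 1 := by linarith [hs.2, ht.2]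
        rw [this, AffineMap.lineMap_apply_one]
        rfl
      · exact absurd (sub_eq_zero.1 h2) hzz
    · have e1 : w = z := hwo.resolve_right fun ho =>
        hττ (hX.eq_of_mem_openTriangle τ τ' w ho w' hwd' hww.symm)
      have e2 : w' = z' := hwo'.resolve_right fun ho =>
        hττ (hX.eq_of_mem_openTriangle τ' τ w' ho w hwd hww).symm
      subst e1 e2
      have hn := (hX.node_eq_iff hl hz hz').2 hww.symm
      refine ⟨Sum.inl (X.node τ κ), by simp, by simp [hn], ?_⟩
      exact (hP _ τ κ w hz rfl).symm
  -- the half of the level segment which contains `z`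
  obtain ⟨z₁, z₂, ⟨κ₁, h1⟩, ⟨κ₂, h2⟩, hseg, hm, -, -, -⟩ := hM τ hτ
  obtain ⟨κ, z₀, hz₀, hzz₀⟩ : ∃ κ z₀, X.IsEnd g l τ κ z₀ ∧ z ∈ segment ℝ z₀ (M τ) := by
    have hz' := hseg z hz hzl
    rw [segment_eq_image_lineMap] at hz'
    obtain ⟨s, hs, rfl⟩ := hz'
    rcases le_total s (1 / 2) with hs2 | hs2
    · refine ⟨κ₁, z₁, h1, ?_⟩
      rw [segment_eq_image_lineMap]
      refine ⟨2 * s, ⟨by linarith [hs.1], by linarith⟩, ?_⟩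
      rw [hm]
      simp only [AffineMap.lineMap_apply_module, Complex.real_smul]
      push_cast
      ring
    · refine ⟨κ₂, z₂, h2, ?_⟩
      rw [segment_eq_image_lineMap]
      refine ⟨2 * (1 - s), ⟨by linarith [hs.2], by linarith⟩, ?_⟩
      rw [hm]
      simp only [AffineMap.lineMap_apply_module, Complex.real_smul]
      push_cast
      ring
  have hadj0 : (X.levelGraph g l).Adj (Sum.inl (X.node τ κ)) (Sum.inr τ) :=
    levelGraph_adj_inl_inr.2 ⟨hτ, κ, z₀, hz₀, rfl⟩
  obtain ⟨u, p, hpc, hpe⟩ := SimpleGraph.exists_cycle_of_even_degree _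
    (fun w => by convert! even_degree_levelGraph hX hl w) hadj0
  obtain ⟨C, hC, hCm⟩ := SimpleGraph.Walk.IsCycle.exists_isSimpleClosedCurve hsymm harc hdisj p hpc
  refine ⟨C, hC, fun y hy => ?_, ?_⟩
  · obtain ⟨a, b, hab, hyS⟩ := (hCm y).1 hy
    obtain ⟨ν, τ', hi, -, hSe⟩ := hadj a b (p.adj_of_mem_edges hab)
    rw [hSe] at hyS
    obtain ⟨κ', z', hz', -, w, hw, rfl⟩ := hyS
    obtain ⟨hwd, hwl, -⟩ := hhalf τ' κ' z' hi.1 hz' w hw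
    exact ⟨hX.chart_mem hwd, by rw [hl.apply_chart τ' w hwd, hwl]⟩
  · refine (hCm _).2 ⟨_, _, hpe, ?_⟩
    show X.chart τ z ∈ S₀ (X.node τ κ) τ
    rw [hS₀eq τ κ z₀ hz₀]
    exact ⟨z, hzz₀, rfl⟩

/-! ### Simple closed curves in a level set -/

/-- Around a point of a level segment there is a disc in which the level set is a diameter. -/
theorem IsCrossing.exists_disc (hX : X.Triangulates D) (hl : X.IsRegularAt g h l) {τ : Tri}
    (hτ : X.IsCrossing g l τ) :
    ∃ φ : ℂ → ℂ, ContinuousOn φ (Metric.closedBall 0 1) ∧ InjOn φ (Metric.closedBall 0 1) ∧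
      (∀ W ⊆ Metric.closedBall (0 : ℂ) 1, IsOpen W → IsOpen (φ '' W)) ∧
      (∀ w ∈ Metric.closedBall (0 : ℂ) 1, φ w ∈ X.chart τ '' (X.basis τ).openTriangle) ∧
      ∃ c > 0, ∀ w ∈ Metric.closedBall (0 : ℂ) 1, h (φ w) = l + c * w.im := by
  obtain ⟨κ₁, κ₂, z₁, z₂, hκ, h1, h2, -, ho, -⟩ := hτ.exists_ends
  obtain ⟨⟨i, hi⟩, ⟨j, hj⟩⟩ := hτ
  set b := X.basis τ with hb
  set v := g ∘ X.vert τ with hv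
  have hvij : 0 < v j - v i := sub_pos.2 (hi.trans hj)
  have hz : z₁ ≠ z₂ := by
    rintro rfl
    exact hκ (AffineBasis.IsLevelEnd.kind_unique h1 h2)
  have hmo : AffineMap.lineMap z₁ z₂ (1 / 2 : ℝ) ∈ b.openTriangle := ho _ (by norm_num)
  set m : ℂ := AffineMap.lineMap z₁ z₂ (1 / 2 : ℝ) with hm
  have hml : b.interpolate v m = l := by
    rw [hm, AffineBasis.interpolate_lineMap, AffineBasis.IsLevelEnd.interpolate_eq h1,
      AffineBasis.IsLevelEnd.interpolate_eq h2]
    ring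
  set ℓ := (b.interpolate v).linear with hℓ
  have hℓ1 : ℓ (z₂ - z₁) = 0 := by
    have := (b.interpolate v).linearMap_vsub z₂ z₁
    rw [vsub_eq_sub, vsub_eq_sub] at this
    rw [hℓ, this, AffineBasis.IsLevelEnd.interpolate_eq h1,
      AffineBasis.IsLevelEnd.interpolate_eq h2, sub_self]
  have hℓ2 : ℓ (b j - b i) = v j - v i := by
    have := (b.interpolate v).linearMap_vsub (b j) (b i)
    rw [vsub_eq_sub, vsub_eq_sub] at this
    rw [hℓ, this, AffineBasis.interpolate_point, AffineBasis.interpolate_point]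
  -- the real part moves along the level segment, the imaginary part across it
  let Λ₀ : ℂ →ₗ[ℝ] ℂ :=
    Complex.reLm.smulRight (z₂ - z₁) + Complex.imLm.smulRight (b j - b i)
  have hΛ₀ : ∀ w : ℂ, Λ₀ w = w.re • (z₂ - z₁) + w.im • (b j - b i) := fun w => rfl
  have hℓΛ : ∀ w, ℓ (Λ₀ w) = w.im * (v j - v i) := by
    intro w
    rw [hΛ₀, map_add, map_smul, map_smul, hℓ1, hℓ2]
    simp
  have hΛi : Function.Injective Λ₀ := by
    rw [injective_iff_map_eq_zero]
    intro w hw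
    have him : w.im = 0 := by
      have := hℓΛ w
      rw [hw, map_zero] at this
      rcases mul_eq_zero.1 this.symm with h | h
      · exact h
      · exact absurd h hvij.ne'
    rw [hΛ₀, him, zero_smul, add_zero] at hw
    rcases smul_eq_zero.1 hw with h | h
    · exact Complex.ext h him
    · exact absurd (sub_eq_zero.1 h).symm hz
  obtain ⟨ε, hε, hεb⟩ := Metric.isOpen_iff.1 b.isOpen_openTriangle m hmo
  set Λ : ℂ →L[ℝ] ℂ := LinearMap.toContinuousLinearMap Λ₀ with hΛ
  set r : ℝ := ε / (2 * (‖Λ‖ + 1)) with hr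
  have hr0 : 0 < r := by positivity
  have hrb : ∀ w ∈ Metric.closedBall (0 : ℂ) 1, m + r • Λ₀ w ∈ b.openTriangle := by
    intro w hw
    apply hεb
    rw [Metric.mem_ball, dist_eq_norm, add_sub_cancel_left, norm_smul, Real.norm_of_nonneg hr0.le]
    have h3 : ‖Λ₀ w‖ ≤ ‖Λ‖ * ‖w‖ := Λ.le_opNorm w
    have h4 : ‖w‖ ≤ 1 := by simpa using hw
    have h5 : ‖Λ₀ w‖ ≤ ‖Λ‖ + 1 := by nlinarith [norm_nonneg Λ]
    calc r * ‖Λ₀ w‖ ≤ r * (‖Λ‖ + 1) := by gcongr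
      _ = ε / 2 := by rw [hr]; field_simp
      _ < ε := by linarith
  have hrd : ∀ w ∈ Metric.closedBall (0 : ℂ) 1, m + r • Λ₀ w ∈ X.dom τ := fun w hw =>
    b.openTriangle_subset_triangle (hrb w hw)
  have hcont : Continuous fun w => m + r • Λ₀ w :=
    continuous_const.add (Λ.continuous.const_smul r)
  have hopen : IsOpenMap fun w => m + r • Λ₀ w := by
    have e1 : IsOpenMap Λ₀ := by
      have := (LinearEquiv.ofInjectiveEndo Λ₀ hΛi).toContinuousLinearEquiv.toHomeomorph.isOpenMap
      exact this
    exact ((Homeomorph.addLeft m).isOpenMap.comp (isOpenMap_smul₀ hr0.ne')).comp e1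
  refine ⟨fun w => X.chart τ (m + r • Λ₀ w), (hX.continuousOn τ).comp hcont.continuousOn hrd, ?_,
    ?_, fun w hw => ⟨_, hrb w hw, rfl⟩, r * (v j - v i), by positivity, ?_⟩
  · intro w hw w' hw' he
    have := hX.injOn τ (hrd w hw) (hrd w' hw') he
    have h3 : r • Λ₀ w = r • Λ₀ w' := add_left_cancel this
    exact hΛi (smul_right_injective ℂ hr0.ne' h3)
  · intro W hW hWo
    rw [← image_image (X.chart τ) (fun w => m + r • Λ₀ w)]
    refine hX.isOpen_image τ _ ?_ (hopen W hWo)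
    rintro _ ⟨w, hw, rfl⟩
    exact hrd w (hW hw)
  · intro w hw
    simp only
    rw [hl.apply_chart τ _ (hrd w hw)]
    have := (b.interpolate v).map_vadd m (r • Λ₀ w)
    simp only [vadd_eq_add] at this
    rw [add_comm m, ← hb, ← hv, this, hml, ← hℓ, map_smul, hℓΛ, smul_eq_mul]
    ring

end AffineTriangulation

/-! ### Level curves and the points above the level -/

/-- If finitely many points contain all intersections of different simple closed curves in `Y`,
then two such curves meet in at most one point: otherwise an arc of `C'` with ends on `C` and an
arc of `C` would form a curve which shares an arc with `C`. -/
theorem IsSimpleClosedCurve.subsingleton_inter {Y W : Set ℂ} (hW : W.Finite)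
    (hmeet : ∀ C C', IsSimpleClosedCurve C → IsSimpleClosedCurve C' → C ⊆ Y → C' ⊆ Y → C ≠ C' →
      C ∩ C' ⊆ W) {C C' : Set ℂ} (hC : IsSimpleClosedCurve C) (hC' : IsSimpleClosedCurve C')
    (hCY : C ⊆ Y) (hCY' : C' ⊆ Y) (hne : C ≠ C') : (C ∩ C').Subsingleton := by
  intro p hp q hq
  by_contra hpq
  have hfin : (C ∩ C').Finite := hW.subset (hmeet C C' hC hC' hCY hCY' hne)
  obtain ⟨f', hf', h0', h1', hi', -, hI', -⟩ := hC'.exists_loop hp.2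
  obtain ⟨f, hf, h0, h1, hi, -, hI, -⟩ := hC.exists_loop hp.1
  -- follow `C'` from `p` to the first point `f' t₀` where it returns to `C`
  set T : Set ℝ := {t | t ∈ Ioo (0 : ℝ) 1 ∧ f' t ∈ C} with hT
  have hTfin : T.Finite := by
    refine Set.Finite.of_finite_image (f := f') (hfin.subset ?_)
      (hi'.mono fun t ht => Ioo_subset_Ico_self ht.1)
    rintro _ ⟨t, ht, rfl⟩
    exact ⟨ht.2, hI' ▸ ⟨t, Ioo_subset_Icc_self ht.1, rfl⟩⟩
  have hTne : T.Nonempty := by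
    obtain ⟨t, ht, rfl⟩ := hI'.symm ▸ hq.2
    refine ⟨t, ⟨lt_of_le_of_ne ht.1 ?_, lt_of_le_of_ne ht.2 ?_⟩, hq.1⟩
    · rintro rfl; exact hpq h0'.symm
    · rintro rfl; exact hpq h1'.symm
  obtain ⟨t₀, ht₀, hmin⟩ := Set.exists_min_image T id hTfin hTne
  have hi0 : InjOn f' (Icc 0 t₀) := hi'.mono (Icc_subset_Ico_right ht₀.1.2)
  obtain ⟨s₀, hs₀, hs₀e⟩ := hI.symm ▸ ht₀.2
  have hne0 : f' t₀ ≠ p := by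
    intro h
    have := hi' ⟨ht₀.1.1.le, ht₀.1.2⟩ ⟨le_rfl, one_pos⟩ (h.trans h0'.symm)
    linarith [ht₀.1.1]
  have hs0 : 0 < s₀ := lt_of_le_of_ne hs₀.1 (by rintro rfl; exact hne0 (hs₀e.symm.trans h0))
  have hs1 : s₀ < 1 := lt_of_le_of_ne hs₀.2 (by rintro rfl; exact hne0 (hs₀e.symm.trans h1))
  have hA := isArc_image_Icc ht₀.1.1 hf'.continuousOn hi0
  have hinj : InjOn f (Icc 0 s₀) := hi.mono (Icc_subset_Ico_right hs1)
  have hA1 := (isArc_image_Icc hs0 hf.continuousOn hinj).symm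
  rw [h0'] at hA
  rw [h0, hs₀e] at hA1
  have hA1C : f '' Icc 0 s₀ ⊆ C := by
    rw [← hI]; exact image_mono (Icc_subset_Icc_right hs₀.2)
  have hAC' : f' '' Icc 0 t₀ ⊆ C' := by
    rw [← hI']; exact image_mono (Icc_subset_Icc_right ht₀.1.2.le)
  have hU : IsSimpleClosedCurve (f' '' Icc 0 t₀ ∪ f '' Icc 0 s₀) := by
    refine hA.isSimpleClosedCurve_union hA1 ?_
    rintro _ ⟨⟨t, ht, rfl⟩, hz⟩
    rcases eq_or_lt_of_le ht.1 with h | h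
    · exact Or.inl (by rw [← h, h0'])
    · have := hmin t ⟨⟨h, ht.2.trans_lt ht₀.1.2⟩, hA1C hz⟩
      exact Or.inr (by rw [le_antisymm ht.2 this]; rfl)
  have heq : f' '' Icc 0 t₀ ∪ f '' Icc 0 s₀ = C := by
    by_contra hUC
    have h3 := hmeet _ _ hU hC (union_subset (hAC'.trans hCY') (hA1C.trans hCY)) hCY hUC
    have h4 : (f '' Icc 0 s₀).Infinite := (Icc_infinite hs0).image hinj
    exact h4 (hW.subset fun z hz => h3 ⟨Or.inr hz, hA1C hz⟩)
  have h5 : t₀ / 2 ∈ T := by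
    refine ⟨⟨by linarith [ht₀.1.1], by linarith [ht₀.1.1, ht₀.1.2]⟩, ?_⟩
    rw [← heq]
    exact Or.inl ⟨t₀ / 2, ⟨by linarith [ht₀.1.1], by linarith [ht₀.1.1]⟩, rfl⟩
  have := hmin _ h5
  simp only [id] at this
  linarith [ht₀.1.1]

theorem isPreconnected_compl_closedBall {R : ℝ} (hR : 0 < R) :
    IsPreconnected (Metric.closedBall (0 : ℂ) R)ᶜ := by
  have h1 : (Metric.closedBall (0 : ℂ) R)ᶜ = Complex.exp '' {w | Real.log R < w.re} := by
    ext z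
    simp only [mem_compl_iff, mem_closedBall_zero_iff, not_le, mem_image, mem_ofPred_eq]
    constructor
    · intro hz
      have hz0 : z ≠ 0 := norm_pos_iff.1 (hR.trans hz)
      refine ⟨Complex.log z, ?_, Complex.exp_log hz0⟩
      rw [Complex.log_re]
      exact Real.log_lt_log hR hz
    · rintro ⟨w, hw, rfl⟩
      rw [Complex.norm_exp, ← Real.log_lt_iff_lt_exp hR]
      exact hw
  rw [h1]
  exact (convex_halfSpace_re_gt _).isPreconnected.image _ Complex.continuous_exp.continuousOn

theorem IsSimpleClosedCurve.infinite {C : Set ℂ} (hC : IsSimpleClosedCurve C) : C.Infinite := by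
  obtain ⟨p, hp⟩ := hC.nonempty
  obtain ⟨f, -, -, -, hi, -, hI, -⟩ := hC.exists_loop hp
  rw [← hI]
  exact ((Ico_infinite one_pos).image hi).mono (image_mono Ico_subset_Icc_self)

/-- A level set for which the maximum principle holds: every point of `D` above the level can be
joined to the point `e`, and through it to infinity, without meeting the level set. -/
structure IsSeparatingLevel (D : Set ℂ) (h : ℂ → ℝ) (l : ℝ) (e : ℂ) : Prop where
  isCompact : IsCompact {z ∈ D | h z = l}
  mem_component : ∀ z ∈ D, l < h z → z ∈ connectedComponentIn {z ∈ D | h z = l}ᶜ e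
  unbounded : ¬ Bornology.IsBounded (connectedComponentIn {z ∈ D | h z = l}ᶜ e)
  exists_higher : ∀ y ∈ {z ∈ D | h z = l}, ∀ N ∈ 𝓝 y, ∃ z ∈ N, z ∈ D ∧ l < h z
  mem_closure : ∀ y ∈ {z ∈ D | h z = l}, y ∈ closure ({z ∈ D | h z = l} \ {y})

/-- The points above the level near a point `y` of the level set are joined to infinity off the level
set, hence so is `y` off a curve `C` in the level set which does not contain `y`. -/
theorem IsSeparatingLevel.disjoint_inside {D : Set ℂ} {h : ℂ → ℝ} {l : ℝ} {e : ℂ}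
    (hs : IsSeparatingLevel D h l e) {C : Set ℂ} (hC : IsCompact C)
    (hCY : C ⊆ {z ∈ D | h z = l}) : Disjoint {z ∈ D | h z = l} (inside C) := by
  rw [disjoint_left]
  rintro y hy ⟨hyC, hyb⟩
  have hopen : IsOpen (connectedComponentIn Cᶜ y) := hC.isClosed.isOpen_compl.connectedComponentIn
  obtain ⟨z, hzN, hzD, hzl⟩ := hs.exists_higher y hy _ (hopen.mem_nhds (mem_connectedComponentIn hyC))
  have hz := hs.mem_component z hzD hzl
  apply hs.unbounded
  refine hyb.subset ?_
  rw [connectedComponentIn_eq hz, connectedComponentIn_eq hzN]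
  exact connectedComponentIn_mono _ (compl_subset_compl.2 hCY)

namespace AffineTriangulation

variable {V Tri Edge : Type*} {X : AffineTriangulation V Tri Edge}
  {D : Set ℂ} {g : V → ℝ} {h : ℂ → ℝ} {l : ℝ} {e : ℂ}

variable (X g l) in
/-- The level segment of the triangle `τ`, in the plane. -/
def levelSegment (τ : Tri) : Set ℂ :=
  X.chart τ '' {z ∈ X.dom τ | (X.basis τ).interpolate (g ∘ X.vert τ) z = l}

variable (X g l) in
/-- The relative interior of the level segment of the triangle `τ`, in the plane. -/
def openLevelSegment (τ : Tri) : Set ℂ :=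
  X.chart τ '' {z ∈ (X.basis τ).openTriangle | (X.basis τ).interpolate (g ∘ X.vert τ) z = l}

theorem openLevelSegment_subset (τ : Tri) : X.openLevelSegment g l τ ⊆ X.levelSegment g l τ :=
  image_mono fun _ hz => ⟨(X.basis τ).openTriangle_subset_triangle hz.1, hz.2⟩

theorem isCompact_levelSegment (hX : X.Triangulates D) (τ : Tri) :
    IsCompact (X.levelSegment g l τ) :=
  ((X.basis τ).isCompact_triangle.inter_right
    (isClosed_eq AffineBasis.continuous_interpolate continuous_const)).image_of_continuousOn
      ((hX.continuousOn τ).mono inter_subset_left)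

theorem mem_levelSet_iff (hX : X.Triangulates D) (hl : X.IsRegularAt g h l) {y : ℂ} :
    y ∈ {z ∈ D | h z = l} ↔ ∃ τ, y ∈ X.levelSegment g l τ := by
  constructor
  · rintro ⟨hy, hyl⟩
    rw [hX.cover] at hy
    obtain ⟨τ, z, hz, rfl⟩ := mem_iUnion.1 hy
    rw [hl.apply_chart τ z hz] at hyl
    exact ⟨τ, z, ⟨hz, hyl⟩, rfl⟩
  · rintro ⟨τ, z, ⟨hz, hzl⟩, rfl⟩
    exact ⟨hX.chart_mem hz, by rw [hl.apply_chart τ z hz, hzl]⟩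

theorem isOpen_chart_openTriangle (hX : X.Triangulates D) (τ : Tri) :
    IsOpen (X.chart τ '' (X.basis τ).openTriangle) :=
  hX.isOpen_image τ _ (X.basis τ).openTriangle_subset_triangle (X.basis τ).isOpen_openTriangle

theorem mem_openLevelSegment_of_mem (hl : X.IsRegularAt g h l) {τ : Tri}
    {y : ℂ} (hy : y ∈ X.chart τ '' (X.basis τ).openTriangle) (hyl : h y = l) :
    y ∈ X.openLevelSegment g l τ := by
  obtain ⟨z, hz, rfl⟩ := hy
  rw [hl.apply_chart τ z ((X.basis τ).openTriangle_subset_triangle hz)] at hyl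
  exact ⟨z, ⟨hz, hyl⟩, rfl⟩

/-- A triangle which does not cross the level contains at most a corner of the level set. -/
theorem eq_corner_of_not_isCrossing (hl : X.IsRegularAt g h l) {τ : Tri}
    (hτ : ¬ X.IsCrossing g l τ) {z : ℂ} (hz : z ∈ X.dom τ)
    (hzl : (X.basis τ).interpolate (g ∘ X.vert τ) z = l) :
    ∃ k, z = X.basis τ k ∧ g (X.vert τ k) = l := by
  have hsum := (X.basis τ).sum_coord_apply_eq_one z
  have hzero : ∑ k, (X.basis τ).coord k z * (g (X.vert τ k) - l) = 0 := by
    rw [AffineBasis.interpolate_apply] at hzl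
    simp only [mul_sub, Finset.sum_sub_distrib, ← Finset.sum_mul, hsum]
    simp only [Function.comp] at hzl
    rw [hzl]; ring
  have hall : ∀ k, (X.basis τ).coord k z * (g (X.vert τ k) - l) = 0 := by
    rcases not_and_or.1 hτ with h1 | h1
    · push Not at h1
      intro k
      exact (Finset.sum_eq_zero_iff_of_nonneg
        (fun k _ => mul_nonneg (hz k) (sub_nonneg.2 (h1 k)))).1 hzero k (Finset.mem_univ k)
    · push Not at h1
      intro k
      exact (Finset.sum_eq_zero_iff_of_nonpos
        (fun k _ => mul_nonpos_of_nonneg_of_nonpos (hz k) (sub_nonpos.2 (h1 k)))).1 hzero k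
          (Finset.mem_univ k)
  obtain ⟨k, hk⟩ : ∃ k, g (X.vert τ k) = l := by
    by_contra! hno
    have : ∀ k, (X.basis τ).coord k z = 0 := fun k =>
      (mul_eq_zero.1 (hall k)).resolve_right (sub_ne_zero.2 (hno k))
    simp [this] at hsum
  have hne : ∀ j, j ≠ k → (X.basis τ).coord j z = 0 := fun j hj =>
    (mul_eq_zero.1 (hall j)).resolve_right
      (sub_ne_zero.2 fun h => hl.not_both τ j k hj ⟨h, hk⟩)
  refine ⟨k, (X.basis τ).ext_elem fun j => ?_, hk⟩
  by_cases hj : j = k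
  · subst hj
    rw [Finset.sum_eq_single j (fun i _ hi => hne i hi) (by simp)] at hsum
    simpa using hsum
  · rw [hne j hj, (X.basis τ).coord_apply_ne hj]

/-- The level set is covered by the level segments of crossing triangles: the triangles which do not
cross the level contribute only corners, and no point of the level set is isolated. -/
theorem exists_isCrossing [Finite Tri] (hX : X.Triangulates D) (hl : X.IsRegularAt g h l)
    (hs : IsSeparatingLevel D h l e) {y : ℂ} (hy : y ∈ {z ∈ D | h z = l}) :
    ∃ τ, X.IsCrossing g l τ ∧ y ∈ X.levelSegment g l τ := by
  have h1 := hs.mem_closure y hy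
  have h2 : {z ∈ D | h z = l} \ {y} ⊆ ⋃ τ, X.levelSegment g l τ \ {y} := by
    rintro z ⟨hz, hzy⟩
    obtain ⟨τ, hτ⟩ := (mem_levelSet_iff hX hl).1 hz
    exact mem_iUnion.2 ⟨τ, hτ, hzy⟩
  have h3 := closure_mono h2 h1
  rw [closure_iUnion_of_finite] at h3
  obtain ⟨τ, hτ⟩ := mem_iUnion.1 h3
  have hyτ : y ∈ X.levelSegment g l τ :=
    closure_minimal sdiff_subset (isCompact_levelSegment hX τ).isClosed hτ
  refine ⟨τ, ?_, hyτ⟩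
  by_contra hc
  have hemp : X.levelSegment g l τ \ {y} = ∅ := by
    rw [eq_empty_iff_forall_notMem]
    rintro _ ⟨⟨z, ⟨hz, hzl⟩, rfl⟩, hzy⟩
    obtain ⟨w, ⟨hw, hwl⟩, rfl⟩ := hyτ
    obtain ⟨k, rfl, hk⟩ := eq_corner_of_not_isCrossing hl hc hz hzl
    obtain ⟨k', rfl, hk'⟩ := eq_corner_of_not_isCrossing hl hc hw hwl
    have : k = k' := by
      by_contra hne
      exact hl.not_both τ k k' hne ⟨hk, hk'⟩
    exact hzy (by rw [this]; rfl)
  rw [hemp, closure_empty] at hτ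
  exact hτ

/-- A simple closed curve in the level set which enters a level segment runs through it. -/
theorem levelSegment_subset_of_mem (hX : X.Triangulates D) (hl : X.IsRegularAt g h l)
    {C : Set ℂ} (hC : IsSimpleClosedCurve C) (hCY : C ⊆ {z ∈ D | h z = l}) {τ : Tri}
    (hτ : X.IsCrossing g l τ) (hne : (X.openLevelSegment g l τ ∩ C).Nonempty) :
    X.levelSegment g l τ ⊆ C := by
  obtain ⟨κ₁, κ₂, z₁, z₂, hκ, h1, h2, hseg, ho, -⟩ := hτ.exists_ends
  have hz : z₁ ≠ z₂ := by
    rintro rfl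
    exact hκ (AffineBasis.IsLevelEnd.kind_unique h1 h2)
  have hdom : ∀ s ∈ Icc (0 : ℝ) 1, AffineMap.lineMap z₁ z₂ s ∈ X.dom τ := fun s hs =>
    (X.basis τ).convex_triangle.segment_subset h1.mem_dom h2.mem_dom
      (by rw [segment_eq_image_lineMap]; exact ⟨s, hs, rfl⟩)
  set σ : ℝ → ℂ := fun s => X.chart τ (AffineMap.lineMap z₁ z₂ s) with hσ
  have hσc : ContinuousOn σ (Icc 0 1) :=
    (hX.continuousOn τ).comp AffineMap.lineMap_continuous.continuousOn hdom
  have hσi : InjOn σ (Icc 0 1) := fun s hs t ht hst =>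
    AffineMap.lineMap_injective ℝ hz (hX.injOn τ (hdom s hs) (hdom t ht) hst)
  have hσY : ∀ y ∈ X.levelSegment g l τ, ∃ s ∈ Icc (0 : ℝ) 1, σ s = y := by
    rintro _ ⟨z, ⟨hz, hzl⟩, rfl⟩
    have := hseg z hz hzl
    rw [segment_eq_image_lineMap] at this
    obtain ⟨s, hs, rfl⟩ := this
    exact ⟨s, hs, rfl⟩
  have hu := continuousOn_invFunOn_image isCompact_Icc hσc hσi
  set u := Function.invFunOn σ (Icc 0 1) with hudef
  have huσ : ∀ s ∈ Icc (0 : ℝ) 1, u (σ s) = s := fun s hs => hσi.leftInvOn_invFunOn hs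
  set N := X.chart τ '' (X.basis τ).openTriangle with hN
  have hNo : IsOpen N := isOpen_chart_openTriangle hX τ
  have hCN : C ∩ N ⊆ σ '' Icc 0 1 := by
    rintro y ⟨hyC, hyN⟩
    obtain ⟨s, hs, hsy⟩ := hσY y (openLevelSegment_subset τ
      (mem_openLevelSegment_of_mem hl hyN (hCY hyC).2))
    exact ⟨s, hs, hsy⟩
  -- the set of parameters of points on the curve is open and closed
  set P : Set ℝ := {s | s ∈ Ioo (0 : ℝ) 1 ∧ σ s ∈ C} with hP
  have hPo : IsOpen P := by
    rw [isOpen_iff_mem_nhds]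
    rintro s ⟨hs, hsC⟩
    have h3 := hC.image_mem_nhds hsC (N := N) (hNo.mem_nhds ⟨_, ho s hs, rfl⟩) (hu.mono hCN) (by
      intro y hy y' hy' hyy
      obtain ⟨t, ht, rfl⟩ := hCN hy
      obtain ⟨t', ht', rfl⟩ := hCN hy'
      rw [huσ t ht, huσ t' ht'] at hyy
      rw [hyy])
    rw [huσ s (Ioo_subset_Icc_self hs)] at h3
    filter_upwards [h3, isOpen_Ioo.mem_nhds hs] with t ht ht01
    obtain ⟨y, hy, hyt⟩ := ht
    obtain ⟨t', ht', rfl⟩ := hCN hy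
    rw [huσ t' ht'] at hyt
    subst hyt
    exact ⟨ht01, hy.1⟩
  have hCc : IsClosed (Icc (0 : ℝ) 1 ∩ σ ⁻¹' C) :=
    hσc.preimage_isClosed_of_isClosed isClosed_Icc hC.isCompact.isClosed
  have hsub : Ioo (0 : ℝ) 1 ⊆ P := by
    refine isPreconnected_Ioo.subset_of_closure_inter_subset hPo ?_ ?_
    · obtain ⟨y, hy, hyC⟩ := hne
      obtain ⟨s, hs, rfl⟩ := hσY y (openLevelSegment_subset τ hy)
      obtain ⟨z, ⟨hzo, -⟩, hze⟩ := hy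
      have hzs := hX.injOn τ ((X.basis τ).openTriangle_subset_triangle hzo) (hdom s hs) hze
      rw [hzs] at hzo
      have hs' : s ∈ Ioo (0 : ℝ) 1 := by
        refine ⟨lt_of_le_of_ne hs.1 ?_, lt_of_le_of_ne hs.2 ?_⟩
        · rintro rfl
          rw [AffineMap.lineMap_apply_zero] at hzo
          exact AffineBasis.IsLevelEnd.not_mem_openTriangle h1 hzo
        · rintro rfl
          rw [AffineMap.lineMap_apply_one] at hzo
          exact AffineBasis.IsLevelEnd.not_mem_openTriangle h2 hzo
      exact ⟨s, hs', hs', hyC⟩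
    · rintro s ⟨hs, hs01⟩
      have : closure P ⊆ Icc (0 : ℝ) 1 ∩ σ ⁻¹' C :=
        closure_minimal (fun t ht => ⟨Ioo_subset_Icc_self ht.1, ht.2⟩) hCc
      exact ⟨hs01, (this hs).2⟩
  have hsub' : Icc (0 : ℝ) 1 ⊆ Icc (0 : ℝ) 1 ∩ σ ⁻¹' C := by
    have h5 : Ioo (0 : ℝ) 1 ⊆ Icc (0 : ℝ) 1 ∩ σ ⁻¹' C := fun s hs =>
      ⟨Ioo_subset_Icc_self hs, (hsub hs).2⟩
    have := closure_minimal h5 hCc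
    rwa [closure_Ioo zero_ne_one] at this
  intro y hy
  obtain ⟨s, hs, rfl⟩ := hσY y hy
  exact (hsub' hs).2

/-- A point of a level segment which is not in the open segment is one of its ends. -/
theorem exists_isEnd_of_mem {τ : Tri} {z : ℂ} (hz : z ∈ X.dom τ)
    (hzl : (X.basis τ).interpolate (g ∘ X.vert τ) z = l)
    (ho : X.chart τ z ∉ X.openLevelSegment g l τ) : ∃ κ, X.IsEnd g l τ κ z :=
  AffineBasis.exists_isLevelEnd_of_not_mem hz hzl fun h => ho ⟨z, ⟨h, hzl⟩, rfl⟩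

/-- A simple closed curve in the level set which passes through a point inside an edge contains the
level segments on both sides of the edge: it cannot turn back at this point. -/
theorem levelSegment_subset_of_edge [Finite Tri] (hX : X.Triangulates D)
    (hl : X.IsRegularAt g h l) {C : Set ℂ} (hC : IsSimpleClosedCurve C)
    (hCY : C ⊆ {z ∈ D | h z = l}) {τ : Tri} {k : Fin 3} {z : ℂ}
    (hz : X.IsEnd g l τ (Sum.inr k) z) (hzC : X.chart τ z ∈ C) : X.levelSegment g l τ ⊆ C := by
  obtain ⟨i, j, hij, hik, hjk, hi, hj⟩ := hl.exists_lt hz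
  have hτ : X.IsCrossing g l τ := ⟨⟨i, hi⟩, ⟨j, hj⟩⟩
  by_contra hsub
  have hdisj : ∀ y ∈ C, y ∉ X.openLevelSegment g l τ := fun y hy hyo =>
    hsub (levelSegment_subset_of_mem hX hl hC hCY hτ ⟨y, hyo, hy⟩)
  set x := X.chart τ z with hx
  -- the other triangle at the edge
  obtain ⟨⟨τ', k'⟩, hne, hedge, hpair⟩ : ∃ η : Tri × Fin 3, (τ, k) ≠ η ∧
      X.edge η.1 η.2 = X.edge τ k ∧ ∀ η', X.edge η'.1 η'.2 = X.edge τ k → η' = (τ, k) ∨ η' = η := by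
    have h2 := hl.ncard_edge τ i j k hij hik hjk (hi.trans hj).ne
    obtain ⟨η₁, η₂, h12, hset⟩ := Set.ncard_eq_two.1 h2
    have hm : (τ, k) ∈ ({η₁, η₂} : Set (Tri × Fin 3)) := hset ▸ (rfl : X.edge τ k = X.edge τ k)
    have hm1 : X.edge η₁.1 η₁.2 = X.edge τ k := by
      have : η₁ ∈ ({η₁, η₂} : Set (Tri × Fin 3)) := by simp
      rwa [← hset] at this
    have hm2 : X.edge η₂.1 η₂.2 = X.edge τ k := by
      have : η₂ ∈ ({η₁, η₂} : Set (Tri × Fin 3)) := by simp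
      rwa [← hset] at this
    have hall : ∀ η', X.edge η'.1 η'.2 = X.edge τ k → η' = η₁ ∨ η' = η₂ := by
      intro η' hη'
      have : η' ∈ {η : Tri × Fin 3 | X.edge η.1 η.2 = X.edge τ k} := hη'
      rw [hset] at this
      simpa using this
    rcases hm with hm | hm
    · exact ⟨η₂, by rw [hm]; exact h12, hm2, by rw [hm]; exact hall⟩
    · exact ⟨η₁, by rw [hm]; exact h12.symm, hm1, by rw [hm]; exact fun η' h => (hall η' h).symm⟩
  simp only at hedge
  obtain ⟨z', hz', hzz'⟩ := hX.exists_isEnd_of_edge_eq hl hz hedge.symm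
  obtain ⟨κ₁, κ₂, z₁, z₂, -, -, -, -, -, hu⟩ := hτ.exists_ends
  -- near `x` the curve lies in the triangle `τ'`
  set B : Set ℂ := (⋃ σ ∈ {σ | x ∉ X.chart σ '' X.dom σ}, X.chart σ '' X.dom σ) ∪
    (X.chart τ '' {z₁, z₂} \ {x}) with hB
  have hdomc : ∀ σ, IsCompact (X.chart σ '' X.dom σ) := fun σ =>
    (X.basis σ).isCompact_triangle.image_of_continuousOn (hX.continuousOn σ)
  have hBc : IsClosed B := by
    refine IsClosed.union (Set.Finite.isClosed_biUnion (Set.toFinite _)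
      fun σ _ => (hdomc σ).isClosed) ?_
    exact ((Set.toFinite _).subset sdiff_subset).isClosed
  have hxB : x ∉ B := by
    rintro (h | h)
    · obtain ⟨σ, hσ, hxσ⟩ := mem_iUnion₂.1 h
      exact hσ hxσ
    · exact h.2 rfl
  have hCB : C ∩ Bᶜ ⊆ X.chart τ' '' {w ∈ X.dom τ' |
      (X.basis τ').interpolate (g ∘ X.vert τ') w = l} := by
    rintro y ⟨hyC, hyB⟩
    obtain ⟨σ, w, ⟨hw, hwl⟩, rfl⟩ := (mem_levelSet_iff hX hl).1 (hCY hyC)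
    have hxσ : x ∈ X.chart σ '' X.dom σ := by
      by_contra hxσ
      exact hyB (Or.inl (mem_iUnion₂.2 ⟨σ, hxσ, w, hw, rfl⟩))
    obtain ⟨w', hw', hw'x⟩ := hxσ
    obtain ⟨k'', hk'', -⟩ := hX.exists_onSide τ σ k z hz.1 w' hw' hw'x.symm
    rcases hpair (σ, k'') hk'' with h3 | h3
    · obtain rfl : σ = τ := (Prod.ext_iff.1 h3).1
      obtain ⟨κ, hκ⟩ := exists_isEnd_of_mem hw hwl (hdisj _ hyC)
      have hwx : X.chart σ w = x := by
        by_contra hwx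
        apply hyB
        refine Or.inr ⟨⟨w, ?_, rfl⟩, hwx⟩
        rcases hu κ w hκ with ⟨-, rfl⟩ | ⟨-, rfl⟩ <;> simp
      exact ⟨z', ⟨hz'.mem_dom, hz'.2⟩, by rw [hzz', hwx]⟩
    · obtain rfl : σ = τ' := (Prod.ext_iff.1 h3).1
      exact ⟨w, ⟨hw, hwl⟩, rfl⟩
  have hinv := continuousOn_invFunOn_image
    (show IsCompact (X.dom τ') from (X.basis τ').isCompact_triangle) (hX.continuousOn τ')
    (hX.injOn τ')
  -- this coordinate is nonnegative on the triangle and vanishes at `x`, so its values on the curve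
  -- are not a neighbourhood of its value at `x`
  set u : ℂ → ℝ := fun y => (X.basis τ').coord k'
    (Function.invFunOn (X.chart τ') (X.dom τ') y) with hudef
  have hue : ∀ w ∈ X.dom τ', u (X.chart τ' w) = (X.basis τ').coord k' w := fun w hw => by
    rw [hudef]
    simp only
    rw [(hX.injOn τ').leftInvOn_invFunOn hw]
  have huc : ContinuousOn u (C ∩ Bᶜ) :=
    (continuous_barycentric_coord _ _).comp_continuousOn
      (hinv.mono (hCB.trans (image_mono fun w hw => hw.1)))
  have hui : InjOn u (C ∩ Bᶜ) := by
    intro y hy y' hy' hyy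
    obtain ⟨w, ⟨hw, hwl⟩, rfl⟩ := hCB hy
    obtain ⟨w', ⟨hw', hwl'⟩, rfl⟩ := hCB hy'
    rw [hue w hw, hue w' hw'] at hyy
    obtain ⟨i', j', hij', hik', hjk', hi', hj'⟩ := hl.exists_lt hz'
    rw [(X.basis τ').eq_of_coord_eq (g ∘ X.vert τ') hij' hik' hjk'
      (show g (X.vert τ' i') ≠ g (X.vert τ' j') from (hi'.trans hj').ne) hyy (hwl.trans hwl'.symm)]
  have hnh := hC.image_mem_nhds hzC (N := Bᶜ) (hBc.isOpen_compl.mem_nhds hxB) huc hui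
  have hux : u x = 0 := by
    rw [show x = X.chart τ' z' from hzz'.symm, hue z' hz'.mem_dom]
    exact hz'.1.1
  rw [hux] at hnh
  obtain ⟨δ, hδ, hδb⟩ := Metric.mem_nhds_iff.1 hnh
  obtain ⟨y, hy, hyu⟩ := hδb (show -δ / 2 ∈ Metric.ball (0 : ℝ) δ by
    rw [Metric.mem_ball, Real.dist_0_eq_abs, abs_lt]; constructor <;> linarith)
  obtain ⟨w, ⟨hw, -⟩, rfl⟩ := hCB hy
  rw [hue w hw] at hyu
  have := hw k'
  linarith

/-- Two simple closed curves in the level set which share a level segment are equal. Let `U` be the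
component of the complement of the level set below the segment. As each of the curves separates
`U` from the points above the level, its points are the only ones where `U` can be left. So the
frontier of `U` is contained in both curves, but it does not fit into an arc. -/
theorem eq_of_levelSegment_subset (hX : X.Triangulates D) (hl : X.IsRegularAt g h l)
    (hs : IsSeparatingLevel D h l e) {C C' : Set ℂ} (hC : IsSimpleClosedCurve C)
    (hC' : IsSimpleClosedCurve C') (hCY : C ⊆ {z ∈ D | h z = l}) (hCY' : C' ⊆ {z ∈ D | h z = l})
    {τ : Tri} (hτ : X.IsCrossing g l τ) (hτC : X.levelSegment g l τ ⊆ C)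
    (hτC' : X.levelSegment g l τ ⊆ C') : C = C' := by
  obtain ⟨φ, hφc, hφi, hφo, hφτ, c, hc, hφh⟩ := hτ.exists_disc hX hl
  set Y := {z ∈ D | h z = l} with hY
  have hB : ∀ r : ℝ, |r| ≤ 1 / 2 → (r * Complex.I : ℂ) ∈ Metric.ball (0 : ℂ) 1 := by
    intro r hr
    simp only [mem_ball_zero_iff, norm_mul, Complex.norm_real, Real.norm_eq_abs, Complex.norm_I,
      mul_one]
    linarith
  have hup := hB (1 / 2) (by rw [abs_of_pos] <;> norm_num)
  have hdn := hB (-(1 / 2)) (by rw [abs_neg, abs_of_pos] <;> norm_num)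
  set b : ℂ := ((1 / 2 : ℝ) : ℂ) * Complex.I with hb
  set a : ℂ := ((-(1 / 2) : ℝ) : ℂ) * Complex.I with ha
  have hbim : b.im = 1 / 2 := by simp [hb]
  have haim : a.im = -(1 / 2) := by simp [ha]
  have hφD : ∀ w ∈ Metric.closedBall (0 : ℂ) 1, φ w ∈ D := by
    intro w hw
    obtain ⟨z, hz, hzw⟩ := hφτ w hw
    rw [← hzw]
    exact hX.chart_mem ((X.basis τ).openTriangle_subset_triangle hz)
  have hsep : ∀ K, IsSimpleClosedCurve K → K ⊆ Y → X.levelSegment g l τ ⊆ K →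
      φ a ∉ connectedComponentIn Kᶜ (φ b) := by
    intro K hK hKY hτK
    have hKφ : ∀ w ∈ Metric.closedBall (0 : ℂ) 1, φ w ∈ K ↔ w.im = 0 := by
      intro w hw
      constructor
      · intro hwK
        have := (hKY hwK).2
        rw [hφh w hw] at this
        rcases mul_eq_zero.1 (show c * w.im = 0 by linarith) with h | h
        · exact absurd h hc.ne'
        · exact h
      · intro hw0
        refine hτK (openLevelSegment_subset τ
          (mem_openLevelSegment_of_mem hl (hφτ w hw) ?_))
        rw [hφh w hw, hw0, mul_zero, add_zero]
    obtain ⟨M, hMK, hMp, hMd, hM1, hM2⟩ := hK.exists_preconnected_complement hφc hφi hKφ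
    exact not_mem_connectedComponentIn_of_diameter hφc hφi hφo hK.isCompact.isClosed hKφ hMp hMK
      hMd hM1 hM2 hup hdn (by rw [hbim]; norm_num) (by rw [haim]; norm_num)
  have haY : φ a ∈ Yᶜ := by
    rintro ⟨-, h3⟩
    rw [hφh a (Metric.ball_subset_closedBall hdn), haim] at h3
    nlinarith
  have hbhigh : l < h (φ b) := by
    rw [hφh b (Metric.ball_subset_closedBall hup), hbim]
    nlinarith
  have hbcomp := hs.mem_component (φ b) (hφD b (Metric.ball_subset_closedBall hup)) hbhigh
  have hYc : IsClosed Y := hs.isCompact.isClosed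
  set U := connectedComponentIn Yᶜ (φ a) with hU
  have hUo : IsOpen U := hYc.isOpen_compl.connectedComponentIn
  have haU : φ a ∈ U := mem_connectedComponentIn haY
  have hUfr : frontier U ⊆ Y := frontier_connectedComponentIn_compl_subset hYc _
  have hfrK : ∀ K, IsSimpleClosedCurve K → K ⊆ Y → X.levelSegment g l τ ⊆ K →
      frontier U ⊆ K := by
    intro K hK hKY hτK x hx
    by_contra hxK
    have hKc := compl_subset_compl.2 hKY
    have hQo : IsOpen (connectedComponentIn Kᶜ x) :=
      hK.isCompact.isClosed.isOpen_compl.connectedComponentIn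
    have hxQ : x ∈ connectedComponentIn Kᶜ x := mem_connectedComponentIn hxK
    obtain ⟨z, hzQ, hzD, hzl⟩ := hs.exists_higher x (hUfr hx) _ (hQo.mem_nhds hxQ)
    obtain ⟨w, hwQ, hwU⟩ := mem_closure_iff.1 (frontier_subset_closure hx) _ hQo hxQ
    have h1 : φ a ∈ connectedComponentIn Kᶜ x := by
      rw [connectedComponentIn_eq hwQ]
      refine connectedComponentIn_mono w hKc ?_
      rw [← connectedComponentIn_eq hwU]
      exact haU
    have h2 : φ b ∈ connectedComponentIn Kᶜ x := by
      rw [connectedComponentIn_eq hzQ]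
      refine connectedComponentIn_mono z hKc ?_
      rw [← connectedComponentIn_eq (hs.mem_component z hzD hzl)]
      exact hbcomp
    apply hsep K hK hKY hτK
    rw [← connectedComponentIn_eq h2]
    exact h1
  have hUb : Bornology.IsBounded U := by
    obtain ⟨R, hR0, hR⟩ := hs.isCompact.isBounded.subset_closedBall_lt 0 0
    refine (Metric.isBounded_closedBall (x := (0 : ℂ)) (r := R)).subset fun u hu => ?_
    by_contra huR
    have hE : (Metric.closedBall (0 : ℂ) R)ᶜ ⊆ Yᶜ := compl_subset_compl.2 hR
    obtain ⟨y, hy, hyR⟩ : ∃ y ∈ connectedComponentIn Yᶜ e, y ∉ Metric.closedBall (0 : ℂ) R := by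
      by_contra! hno
      exact hs.unbounded (Metric.isBounded_closedBall.subset hno)
    have h1 := (isPreconnected_compl_closedBall hR0).subset_connectedComponentIn huR hE hyR
    rw [← connectedComponentIn_eq hu] at h1
    have h2 : φ b ∈ U := by
      rw [hU, connectedComponentIn_eq h1, ← connectedComponentIn_eq hy]
      exact hbcomp
    apply hsep C hC hCY hτC
    rw [hU, connectedComponentIn_eq h2] at haU
    exact connectedComponentIn_mono _ (compl_subset_compl.2 hCY) haU
  have hdis : ∀ K ⊆ Y, Disjoint U K := fun K hKY => disjoint_left.2 fun z hz hzK =>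
    connectedComponentIn_subset _ _ hz (hKY hzK)
  have hcpt : IsCompact (frontier U) := by
    exact hs.isCompact.of_isClosed_subset isClosed_frontier hUfr
  have hproper : ∀ K, IsSimpleClosedCurve K → K ⊆ Y → X.levelSegment g l τ ⊆ K →
      ∀ y ∈ K, y ∈ frontier U := by
    intro K hK hKY hτK y hyK
    by_contra hyU
    obtain ⟨f, α, β, hf, hfi, hfK, hfr⟩ := hK.exists_Icc hcpt (hfrK K hK hKY hτK) hyK hyU
    exact not_frontier_subset_arc hUb ⟨_, haU⟩ hf.continuousOn hfi
      ((hdis K hKY).mono_right hfK) hfr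
  exact Subset.antisymm
    (fun y hy => hfrK C' hC' hCY' hτC' (hproper C hC hCY hτC y hy))
    (fun y hy => hfrK C hC hCY hτC (hproper C' hC' hCY' hτC' y hy))

/-- Two different simple closed curves in the level set meet only at vertices. -/
theorem inter_subset_range_pos [Finite Tri] (hX : X.Triangulates D) (hl : X.IsRegularAt g h l)
    (hs : IsSeparatingLevel D h l e) {C C' : Set ℂ} (hC : IsSimpleClosedCurve C)
    (hC' : IsSimpleClosedCurve C') (hCY : C ⊆ {z ∈ D | h z = l}) (hCY' : C' ⊆ {z ∈ D | h z = l})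
    (hne : C ≠ C') : C ∩ C' ⊆ range X.pos := by
  rintro y ⟨hyC, hyC'⟩
  obtain ⟨τ, hτ, z, ⟨hz, hzl⟩, rfl⟩ := exists_isCrossing hX hl hs (hCY hyC)
  by_cases ho : X.chart τ z ∈ X.openLevelSegment g l τ
  · exact absurd (eq_of_levelSegment_subset hX hl hs hC hC' hCY hCY' hτ
      (levelSegment_subset_of_mem hX hl hC hCY hτ ⟨_, ho, hyC⟩)
      (levelSegment_subset_of_mem hX hl hC' hCY' hτ ⟨_, ho, hyC'⟩)) hne
  · obtain ⟨k | k, hκ⟩ := exists_isEnd_of_mem hz hzl ho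
    · rw [hκ.2, hX.chart_basis]
      exact mem_range_self _
    · exact absurd (eq_of_levelSegment_subset hX hl hs hC hC' hCY hCY' hτ
        (levelSegment_subset_of_edge hX hl hC hCY hκ hyC)
        (levelSegment_subset_of_edge hX hl hC' hCY' hκ hyC')) hne

/-- The level segment of a crossing triangle is finite apart from its interior. -/
theorem finite_levelSegment_diff {τ : Tri} (hτ : X.IsCrossing g l τ) :
    (X.levelSegment g l τ \ X.openLevelSegment g l τ).Finite := by
  obtain ⟨κ₁, κ₂, z₁, z₂, -, -, -, -, -, hu⟩ := hτ.exists_ends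
  refine (Set.toFinite (X.chart τ '' {z₁, z₂})).subset ?_
  rintro _ ⟨⟨z, ⟨hz, hzl⟩, rfl⟩, ho⟩
  obtain ⟨κ, hκ⟩ := exists_isEnd_of_mem hz hzl ho
  refine ⟨z, ?_, rfl⟩
  rcases hu κ z hκ with ⟨-, rfl⟩ | ⟨-, rfl⟩ <;> simp

theorem exists_levelSegment_subset [Finite Tri] (hX : X.Triangulates D)
    (hl : X.IsRegularAt g h l) (hs : IsSeparatingLevel D h l e) {C : Set ℂ}
    (hC : IsSimpleClosedCurve C) (hCY : C ⊆ {z ∈ D | h z = l}) :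
    ∃ τ, X.IsCrossing g l τ ∧ X.levelSegment g l τ ⊆ C := by
  by_contra! hno
  have hfin : (⋃ τ ∈ {τ | X.IsCrossing g l τ},
      X.levelSegment g l τ \ X.openLevelSegment g l τ).Finite :=
    Set.Finite.biUnion (Set.toFinite _) fun τ hτ => finite_levelSegment_diff hτ
  refine hC.infinite (hfin.subset fun y hy => ?_)
  obtain ⟨τ, hτ, hyτ⟩ := exists_isCrossing hX hl hs (hCY hy)
  exact mem_iUnion₂.2 ⟨τ, hτ, hyτ, fun ho =>
    hno τ hτ (levelSegment_subset_of_mem hX hl hC hCY hτ ⟨y, ho, hy⟩)⟩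

/-- There are finitely many simple closed curves in the level set. -/
theorem finite_isSimpleClosedCurve [Finite Tri] (hX : X.Triangulates D)
    (hl : X.IsRegularAt g h l) (hs : IsSeparatingLevel D h l e) :
    {C | IsSimpleClosedCurve C ∧ C ⊆ {z ∈ D | h z = l}}.Finite := by
  rcases isEmpty_or_nonempty Tri with hemp | hne
  · refine Set.finite_empty.subset fun C hC => ?_
    obtain ⟨τ, -⟩ := exists_levelSegment_subset hX hl hs hC.1 hC.2
    exact isEmptyElim τ
  have hch : ∀ C, ∃ τ, IsSimpleClosedCurve C ∧ C ⊆ {z ∈ D | h z = l} →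
      X.IsCrossing g l τ ∧ X.levelSegment g l τ ⊆ C := by
    intro C
    by_cases hC : IsSimpleClosedCurve C ∧ C ⊆ {z ∈ D | h z = l}
    · obtain ⟨τ, hτ⟩ := exists_levelSegment_subset hX hl hs hC.1 hC.2
      exact ⟨τ, fun _ => hτ⟩
    · exact ⟨Classical.arbitrary Tri, fun h => absurd h hC⟩
  choose F hF using hch
  refine Set.Finite.of_injOn (f := F) (t := univ) (fun _ _ => mem_univ _) ?_ (Set.toFinite _)
  intro C hC C' hC' hFF
  obtain ⟨h1, h2⟩ := hF C hC
  obtain ⟨-, h3⟩ := hF C' hC'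
  rw [← hFF] at h3
  exact eq_of_levelSegment_subset hX hl hs hC.1 hC'.1 hC.2 hC'.2 h1 h2 h3

/-- A simple closed curve in the level set is a finite union of segments in each triangle. -/
theorem exists_finite_segments (hX : X.Triangulates D) (hl : X.IsRegularAt g h l) {C : Set ℂ}
    (hC : IsSimpleClosedCurve C) (hCY : C ⊆ {z ∈ D | h z = l}) (τ : Tri) :
    ∃ S : Set (ℂ × ℂ), S.Finite ∧
      {z ∈ X.dom τ | X.chart τ z ∈ C} = ⋃ s ∈ S, segment ℝ s.1 s.2 := by
  have hlev : ∀ z ∈ X.dom τ, X.chart τ z ∈ C → (X.basis τ).interpolate (g ∘ X.vert τ) z = l :=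
    fun z hz hzC => by rw [← hl.apply_chart τ z hz, (hCY hzC).2]
  have hpts : {z ∈ X.dom τ | X.chart τ z ∈ C}.Finite → ∃ S : Set (ℂ × ℂ), S.Finite ∧
      {z ∈ X.dom τ | X.chart τ z ∈ C} = ⋃ s ∈ S, segment ℝ s.1 s.2 := by
    intro hfin
    refine ⟨(fun z => (z, z)) '' {z ∈ X.dom τ | X.chart τ z ∈ C}, hfin.image _, ?_⟩
    ext z
    simp [segment_same]
  by_cases hτ : X.IsCrossing g l τ
  · obtain ⟨κ₁, κ₂, z₁, z₂, -, h1, h2, hseg, -, hu⟩ := hτ.exists_ends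
    by_cases hsub : X.levelSegment g l τ ⊆ C
    · refine ⟨{(z₁, z₂)}, Set.finite_singleton _, ?_⟩
      rw [biUnion_singleton]
      ext z
      constructor
      · rintro ⟨hz, hzC⟩
        exact hseg z hz (hlev z hz hzC)
      · intro hz
        have hzd := (X.basis τ).convex_triangle.segment_subset h1.mem_dom h2.mem_dom hz
        refine ⟨hzd, hsub ⟨z, ⟨hzd, ?_⟩, rfl⟩⟩
        rw [segment_eq_image_lineMap] at hz
        obtain ⟨s, -, rfl⟩ := hz
        rw [AffineBasis.interpolate_lineMap, AffineBasis.IsLevelEnd.interpolate_eq h1,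
          AffineBasis.IsLevelEnd.interpolate_eq h2]
        ring
    · apply hpts
      refine (Set.toFinite {z₁, z₂}).subset ?_
      rintro z ⟨hz, hzC⟩
      obtain ⟨κ, hκ⟩ := exists_isEnd_of_mem hz (hlev z hz hzC) fun ho =>
        hsub (levelSegment_subset_of_mem hX hl hC hCY hτ ⟨_, ho, hzC⟩)
      rcases hu κ z hκ with ⟨-, rfl⟩ | ⟨-, rfl⟩ <;> simp
  · apply hpts
    refine (Set.finite_range (X.basis τ)).subset ?_
    rintro z ⟨hz, hzC⟩
    obtain ⟨k, rfl, -⟩ := eq_corner_of_not_isCrossing hl hτ hz (hlev z hz hzC)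
    exact mem_range_self k

end AffineTriangulation

/-! ### Cutting model polygons into triangles -/

theorem modelCorner_eq_pow (n : ℕ) (j : ZMod n) :
    modelCorner n j = Complex.exp (2 * Real.pi * Complex.I / n) ^ j.val := by
  rw [modelCorner, ← Complex.exp_nat_mul]
  congr 1
  ring

theorem modelCorner_injective (n : ℕ) [NeZero n] : Function.Injective (modelCorner n) := by
  intro j j' h
  rw [modelCorner_eq_pow, modelCorner_eq_pow] at h
  exact ZMod.val_injective n
    ((Complex.isPrimitiveRoot_exp n (NeZero.ne n)).pow_inj (ZMod.val_lt j) (ZMod.val_lt j') h)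

theorem norm_modelCorner (n : ℕ) (j : ZMod n) : ‖modelCorner n j‖ = 1 := by
  have : (2 * Real.pi * Complex.I * ((j.val : ℂ) / (n : ℂ))) =
      ((2 * Real.pi * (j.val / n) : ℝ) : ℂ) * Complex.I := by push_cast; ring
  rw [modelCorner, this, Complex.norm_exp_ofReal_mul_I]

/-- The corners of the square are placed symmetrically: the two diagonals have the same midpoint. -/
theorem modelCorner_four_add (i : ZMod 4) :
    modelCorner 4 (i + 3) = modelCorner 4 i + modelCorner 4 (i + 2) - modelCorner 4 (i + 1) := by
  have h4 : Complex.exp (2 * Real.pi * Complex.I / (4 : ℕ)) = Complex.I := by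
    rw [show (2 * Real.pi * Complex.I / (4 : ℕ) : ℂ) = Real.pi / 2 * Complex.I by push_cast; ring,
      Complex.exp_pi_div_two_mul_I]
  simp only [modelCorner_eq_pow, h4]
  have h3 : Complex.I ^ 3 = -Complex.I := by rw [pow_succ, Complex.I_sq]; ring
  fin_cases i
  · change Complex.I ^ 3 = Complex.I ^ 0 + Complex.I ^ 2 - Complex.I ^ 1
    rw [h3, Complex.I_sq]; ring
  · change Complex.I ^ 0 = Complex.I ^ 1 + Complex.I ^ 3 - Complex.I ^ 2
    rw [h3, Complex.I_sq]; ring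
  · change Complex.I ^ 1 = Complex.I ^ 2 + Complex.I ^ 0 - Complex.I ^ 3
    rw [h3, Complex.I_sq]; ring
  · change Complex.I ^ 2 = Complex.I ^ 3 + Complex.I ^ 1 - Complex.I ^ 0
    rw [h3, Complex.I_sq]; ring

/-- The corners of the triangles into which the model polygon is cut by the diagonal at the
corner `i`. For a triangle only the value `false` is of use, and the result is the triangle itself.
The side opposite to the corner `1` is the diagonal. -/
def triangleCorner (n : ℕ) (i : ZMod n) (b : Bool) : Fin 3 → ZMod n :=
  ![i, if b then i + 3 else i + 1, i + 2]

theorem exists_triangleCorner_eq {n : ℕ} (h4 : n = 4) (i : ZMod n) {b b' : Bool} (hbb : b ≠ b')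
    (j : ZMod n) : (∃ k, triangleCorner n i b k = j) ∨ ∃ k, triangleCorner n i b' k = j := by
  subst h4; revert i j b b'; decide

section triangleCorner

variable {n : ℕ} {i : ZMod n} {b b' : Bool}

theorem triangleCorner_injective (hn : n = 3 ∨ n = 4) (hb : n = 3 → b = false) :
    Function.Injective (triangleCorner n i b) := by
  rcases hn with rfl | rfl
  · obtain rfl := hb rfl
    revert i; decide
  · revert i b; decide

theorem triangleCorner_side (hn : n = 3 ∨ n = 4) (hb : n = 3 → b = false) (k : Fin 3) (hk : ¬ (n = 4 ∧ k = 1)) :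
    triangleCorner n i b (k + 2) = triangleCorner n i b (k + 1) + 1 ∨
      triangleCorner n i b (k + 1) = triangleCorner n i b (k + 2) + 1 := by
  rcases hn with rfl | rfl
  · obtain rfl := hb rfl
    revert i k; decide
  · revert i b k; decide

theorem exists_triangleCorner_side (hn : n = 3 ∨ n = 4) (i j : ZMod n) : ∃ b k, (n = 3 → b = false) ∧
    ¬ (n = 4 ∧ k = (1 : Fin 3)) ∧
      s(triangleCorner n i b (k + 1), triangleCorner n i b (k + 2)) = s(j, j + 1) := by
  rcases hn with rfl | rfl <;> revert i j <;> decide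

theorem triangleCorner_side_unique (hn : n = 3 ∨ n = 4) (hb : n = 3 → b = false) (hb' : n = 3 → b' = false)
    (k k' : Fin 3) (hk : ¬ (n = 4 ∧ k = 1)) (hk' : ¬ (n = 4 ∧ k' = 1))
    (h : s(triangleCorner n i b (k + 1), triangleCorner n i b (k + 2)) =
      s(triangleCorner n i b' (k' + 1), triangleCorner n i b' (k' + 2))) : b = b' ∧ k = k' := by
  rcases hn with rfl | rfl
  · obtain rfl := hb rfl
    obtain rfl := hb' rfl
    revert i k k'; decide
  · revert i b b' k k'; decide

end triangleCorner

/-- The affine basis formed by the corners of a triangle of the model polygon. -/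
noncomputable def modelBasis (n : ℕ) (hn : n = 3 ∨ n = 4) (i : ZMod n) (b : Bool)
    (hb : n = 3 → b = false) : AffineBasis (Fin 3) ℝ ℂ where
  toFun k := modelCorner n (triangleCorner n i b k)
  ind' := by
    have : NeZero n := ⟨by omega⟩
    refine EuclideanGeometry.Cospherical.affineIndependent (s := Metric.sphere (0 : ℂ) 1)
      ⟨0, 1, fun p hp => by simpa using hp⟩ ?_
      ((modelCorner_injective n).comp (triangleCorner_injective hn hb))
    rintro _ ⟨k, rfl⟩
    simpa using norm_modelCorner n _
  tot' := by
    have : NeZero n := ⟨by omega⟩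
    rw [AffineIndependent.affineSpan_eq_top_iff_card_eq_finrank_add_one]
    · simp
    · refine EuclideanGeometry.Cospherical.affineIndependent (s := Metric.sphere (0 : ℂ) 1)
        ⟨0, 1, fun p hp => by simpa using hp⟩ ?_
        ((modelCorner_injective n).comp (triangleCorner_injective hn hb))
      rintro _ ⟨k, rfl⟩
      simpa using norm_modelCorner n _

theorem modelBasis_apply {n : ℕ} (hn : n = 3 ∨ n = 4) (i : ZMod n) (b : Bool)
    (hb : n = 3 → b = false) (k : Fin 3) :
    modelBasis n hn i b hb k = modelCorner n (triangleCorner n i b k) := rfl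

namespace AffineBasis

variable {b b' : AffineBasis (Fin 3) ℝ ℂ}

theorem sum_coord_smul (b : AffineBasis (Fin 3) ℝ ℂ) (z : ℂ) : ∑ k, b.coord k z • b k = z :=
  b.linear_combination_coord_eq_self z

theorem apply_eq_sum (b : AffineBasis (Fin 3) ℝ ℂ) (f : ℂ →ᵃ[ℝ] ℝ) (z : ℂ) :
    f z = ∑ k, b.coord k z * f (b k) := by
  have h : f = b.interpolate fun k => f (b k) := by
    refine AffineMap.ext_on b.tot ?_
    rintro _ ⟨k, rfl⟩
    rw [interpolate_point]
  conv_lhs => rw [h]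
  rw [interpolate_apply]

/-- The coordinates with respect to the two triangles into which a parallelogram is cut by a
diagonal, the side opposite to the corner `1`. -/
theorem coord_of_parallelogram (h0 : b' 0 = b 0) (h2 : b' 2 = b 2)
    (h1 : b' 1 = b 0 + b 2 - b 1) (z : ℂ) :
    b'.coord 1 z = -b.coord 1 z ∧ b'.coord 0 z = b.coord 0 z + b.coord 1 z ∧
      b'.coord 2 z = b.coord 2 z + b.coord 1 z := by
  have hb1 : b 1 = (b' 0 - b' 1) +ᵥ b' 2 := by rw [h0, h1, h2, vadd_eq_add]; ring
  have key : ∀ k, b'.coord k (b 1) = b'.coord k (b' 0) - b'.coord k (b' 1) + b'.coord k (b' 2) := by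
    intro k
    rw [hb1, AffineMap.map_vadd, ← vsub_eq_sub, AffineMap.linearMap_vsub]
    simp
  have hk : ∀ k, b'.coord k z = b.coord 0 z * b'.coord k (b' 0) +
      b.coord 1 z * (b'.coord k (b' 0) - b'.coord k (b' 1) + b'.coord k (b' 2)) +
      b.coord 2 z * b'.coord k (b' 2) := by
    intro k
    rw [b.apply_eq_sum (b'.coord k) z, Fin.sum_univ_three, key, ← h0, ← h2]
  refine ⟨?_, ?_, ?_⟩ <;> rw [hk]
  all_goals simp; try ring

theorem _root_.Fin.ne_add_one_three (k : Fin 3) : k ≠ k + 1 ∧ k ≠ k + 2 ∧ k + 1 ≠ k + 2 := by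
  decide +revert

theorem lineMap_of_coord_eq_zero {k : Fin 3} {z : ℂ} (hz : b.coord k z = 0) :
    z = AffineMap.lineMap (b (k + 1)) (b (k + 2)) (b.coord (k + 2) z) := by
  have h1 := b.sum_coord_apply_eq_one z
  have h2 := b.sum_coord_smul z
  obtain ⟨hk1, hk2, hk3⟩ := Fin.ne_add_one_three k
  rw [Fin.sum_three_of_ne hk1 hk2 hk3, hz] at h1 h2
  have h3 : b.coord (k + 1) z = 1 - b.coord (k + 2) z := by linarith
  rw [h3, zero_smul, zero_add] at h2
  rw [AffineMap.lineMap_apply_module]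
  exact h2.symm

theorem coord_lineMap_side (k : Fin 3) (t : ℝ) :
    b.coord k (AffineMap.lineMap (b (k + 1)) (b (k + 2)) t) = 0 ∧
    b.coord (k + 1) (AffineMap.lineMap (b (k + 1)) (b (k + 2)) t) = 1 - t ∧
    b.coord (k + 2) (AffineMap.lineMap (b (k + 1)) (b (k + 2)) t) = t := by
  obtain ⟨hk1, hk2, hk3⟩ := Fin.ne_add_one_three k
  simp only [coord_lineMap, coord_self, b.coord_apply_ne hk1, b.coord_apply_ne hk2,
    b.coord_apply_ne hk3, b.coord_apply_ne hk3.symm]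
  refine ⟨by ring, by ring, by ring⟩

/-- A side of a triangle as a segment. -/
theorem side_eq_image (k : Fin 3) : {z ∈ b.triangle | b.coord k z = 0} =
    (AffineMap.lineMap (b (k + 1)) (b (k + 2)) : ℝ → ℂ) '' Icc 0 1 := by
  have hall : ∀ j : Fin 3, j = k ∨ j = k + 1 ∨ j = k + 2 := by revert k; decide
  ext z
  constructor
  · rintro ⟨hz, h0⟩
    refine ⟨b.coord (k + 2) z, ⟨hz _, ?_⟩, (lineMap_of_coord_eq_zero h0).symm⟩
    rw [← b.sum_coord_apply_eq_one z]
    exact Finset.single_le_sum (f := fun j => b.coord j z) (fun j _ => hz j) (Finset.mem_univ _)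
  · rintro ⟨t, ht, rfl⟩
    obtain ⟨h0, h1, h2⟩ := b.coord_lineMap_side k t
    refine ⟨fun j => ?_, h0⟩
    rcases hall j with rfl | rfl | rfl
    · exact h0.ge
    · rw [h1]; linarith [ht.2]
    · rw [h2]; exact ht.1

theorem OnSide.exists_lineMap {k : Fin 3} {z : ℂ} (hz : b.OnSide k z) :
    ∃ t ∈ Ioo (0 : ℝ) 1, z = AffineMap.lineMap (b (k + 1)) (b (k + 2)) t := by
  obtain ⟨hk1, hk2, -⟩ := Fin.ne_add_one_three k
  have h := lineMap_of_coord_eq_zero hz.1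
  refine ⟨b.coord (k + 2) z, ⟨hz.2 _ hk2.symm, ?_⟩, h⟩
  have h1 := hz.2 _ hk1.symm
  rw [h, (b.coord_lineMap_side k _).2.1] at h1
  linarith

end AffineBasis

section modelPolygon

variable {n : ℕ} {hn : n = 3 ∨ n = 4} {i : ZMod n} {b b' : Bool} {hb : n = 3 → b = false}
  {hb' : n = 3 → b' = false}

theorem isCompact_modelPolygon (n : ℕ) [NeZero n] : IsCompact (modelPolygon n) :=
  (Set.finite_range _).isCompact_convexHull ℝ

theorem modelCorner_mem_modelPolygon (j : ZMod n) : modelCorner n j ∈ modelPolygon n :=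
  subset_convexHull ℝ _ (mem_range_self j)

theorem modelBasis_triangle_subset : (modelBasis n hn i b hb).triangle ⊆ modelPolygon n := by
  rw [AffineBasis.triangle_eq_convexHull]
  refine convexHull_mono ?_
  rintro _ ⟨k, rfl⟩
  exact mem_range_self _

theorem modelBasis_openTriangle_subset :
    (modelBasis n hn i b hb).openTriangle ⊆ interior (modelPolygon n) :=
  interior_maximal ((AffineBasis.openTriangle_subset_triangle _).trans modelBasis_triangle_subset)
    (AffineBasis.isOpen_openTriangle _)

/-- Barycentric coordinates in the two triangles of a square, whose free corners are opposite. -/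
theorem modelBasis_coord (h4 : n = 4) (hbb : b ≠ b') (z : ℂ) :
    (modelBasis n hn i b' hb').coord 1 z = -(modelBasis n hn i b hb).coord 1 z ∧
    (modelBasis n hn i b' hb').coord 0 z =
      (modelBasis n hn i b hb).coord 0 z + (modelBasis n hn i b hb).coord 1 z ∧
    (modelBasis n hn i b' hb').coord 2 z =
      (modelBasis n hn i b hb).coord 2 z + (modelBasis n hn i b hb).coord 1 z := by
  subst h4
  refine AffineBasis.coord_of_parallelogram (b := modelBasis 4 hn i b hb)
    (b' := modelBasis 4 hn i b' hb') rfl rfl ?_ z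
  simp only [modelBasis_apply]
  have := modelCorner_four_add i
  cases b <;> cases b' <;> simp [triangleCorner] at hbb ⊢ <;> rw [this] <;> ring

theorem modelPolygon_eq_triangle (h3 : n = 3) :
    modelPolygon n = (modelBasis n hn i b hb).triangle := by
  refine Subset.antisymm ?_ modelBasis_triangle_subset
  rw [AffineBasis.triangle_eq_convexHull]
  refine convexHull_mono ?_
  subst h3
  obtain rfl := hb rfl
  rintro _ ⟨j, rfl⟩
  obtain ⟨k, rfl⟩ : ∃ k, triangleCorner 3 i false k = j := by
    clear hb hn; revert i j; decide
  exact ⟨k, rfl⟩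

theorem modelPolygon_subset_union (h4 : n = 4) (hbb : b ≠ b') : modelPolygon n ⊆
    (modelBasis n hn i b hb).triangle ∪ (modelBasis n hn i b' hb').triangle := by
  set B := modelBasis n hn i b hb with hB
  set B' := modelBasis n hn i b' hb' with hB'
  have hconv : ∀ f : ℂ →ᵃ[ℝ] ℝ, Convex ℝ {z | 0 ≤ f z} := fun f =>
    (convex_Ici (0 : ℝ)).affine_preimage f
  have hsub : modelPolygon n ⊆ ({z | 0 ≤ B.coord 0 z} ∩ {z | 0 ≤ B.coord 2 z}) ∩
      ({z | 0 ≤ B'.coord 0 z} ∩ {z | 0 ≤ B'.coord 2 z}) := by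
    refine convexHull_min ?_ (((hconv _).inter (hconv _)).inter ((hconv _).inter (hconv _)))
    rintro _ ⟨j, rfl⟩
    have hj : (∃ k, modelCorner n j = B k) ∨ ∃ k, modelCorner n j = B' k := by
      rcases exists_triangleCorner_eq h4 i hbb j with ⟨k, rfl⟩ | ⟨k, rfl⟩
      · exact Or.inl ⟨k, rfl⟩
      · exact Or.inr ⟨k, rfl⟩
    rcases hj with ⟨k, hk⟩ | ⟨k, hk⟩ <;> rw [hk]
    · have h := modelBasis_coord (hn := hn) (i := i) (hb := hb) (hb' := hb') h4 hbb (B k)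
      rw [← hB, ← hB'] at h
      have := B.point_mem_triangle k
      exact ⟨⟨this 0, this 2⟩, by rw [mem_ofPred_eq, h.2.1]; exact add_nonneg (this 0) (this 1),
        by rw [mem_ofPred_eq, h.2.2]; exact add_nonneg (this 2) (this 1)⟩
    · have h := modelBasis_coord (hn := hn) (i := i) (hb := hb') (hb' := hb) h4 hbb.symm (B' k)
      rw [← hB, ← hB'] at h
      have := B'.point_mem_triangle k
      exact ⟨⟨by rw [mem_ofPred_eq, h.2.1]; exact add_nonneg (this 0) (this 1),
        by rw [mem_ofPred_eq, h.2.2]; exact add_nonneg (this 2) (this 1)⟩, this 0, this 2⟩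
  intro z hz
  obtain ⟨⟨h0, h2⟩, h0', h2'⟩ := hsub hz
  have h1 := (modelBasis_coord (hn := hn) (i := i) (hb := hb) (hb' := hb') h4 hbb z).1
  rw [← hB, ← hB'] at h1
  rcases le_total 0 (B.coord 1 z) with h | h
  · left
    intro k
    fin_cases k
    exacts [h0, h, h2]
  · right
    intro k
    fin_cases k
    exacts [h0', h1.symm ▸ neg_nonneg.2 h, h2']

theorem onSide_diagonal_iff (h4 : n = 4) {z : ℂ} :
    (modelBasis n hn i b' hb').OnSide 1 z ↔ (modelBasis n hn i b hb).OnSide 1 z := by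
  by_cases hbb : b = b'
  · subst hbb; rfl
  have h : ∀ B B' : AffineBasis (Fin 3) ℝ ℂ, (B'.coord 1 z = -B.coord 1 z ∧
      B'.coord 0 z = B.coord 0 z + B.coord 1 z ∧ B'.coord 2 z = B.coord 2 z + B.coord 1 z) →
      B.OnSide 1 z → B'.OnSide 1 z := by
    rintro B B' ⟨h1, h0, h2⟩ ⟨hB, hBp⟩
    rw [hB] at h1 h0 h2
    refine ⟨by simpa using h1, fun j hj => ?_⟩
    fin_cases j
    · have := hBp 0 (by decide); simpa [h0] using this
    · exact absurd rfl hj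
    · have := hBp 2 (by decide); simpa [h2] using this
  exact ⟨h _ _ (modelBasis_coord h4 (Ne.symm hbb) z), h _ _ (modelBasis_coord h4 hbb z)⟩

/-- The diagonal runs in the interior of the square. -/
theorem mem_interior_of_onSide_diagonal (h4 : n = 4) {z : ℂ}
    (hz : (modelBasis n hn i b hb).OnSide 1 z) : z ∈ interior (modelPolygon n) := by
  have hb' : n = 3 → (!b) = false := fun h => absurd h (by omega)
  set B := modelBasis n hn i b hb with hB
  set B' := modelBasis n hn i (!b) hb' with hB'
  have hcoord := modelBasis_coord (hn := hn) (i := i) (hb := hb) (hb' := hb') h4 (by simp)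
  rw [← hB, ← hB'] at hcoord
  have hopen : ∀ (B : AffineBasis (Fin 3) ℝ ℂ) k, IsOpen {z | 0 < B.coord k z} := fun B k =>
    isOpen_lt continuous_const (continuous_barycentric_coord B k)
  have hz' : B'.OnSide 1 z := (onSide_diagonal_iff h4).2 hz
  refine mem_interior.2 ⟨({z | 0 < B.coord 0 z} ∩ {z | 0 < B.coord 2 z}) ∩
      ({z | 0 < B'.coord 0 z} ∩ {z | 0 < B'.coord 2 z}), ?_,
      ((hopen _ _).inter (hopen _ _)).inter ((hopen _ _).inter (hopen _ _)),
      ⟨hz.2 0 (by decide), hz.2 2 (by decide)⟩, hz'.2 0 (by decide), hz'.2 2 (by decide)⟩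
  rintro w ⟨⟨h0, h2⟩, h0', h2'⟩
  have h1 := (hcoord w).1
  rcases le_total 0 (B.coord 1 w) with h | h
  · refine modelBasis_triangle_subset (hn := hn) (hb := hb) (i := i) fun k => ?_
    fin_cases k
    exacts [h0.le, h, h2.le]
  · refine modelBasis_triangle_subset (hn := hn) (hb := hb') (i := i) fun k => ?_
    fin_cases k
    exacts [h0'.le, h1.symm ▸ neg_nonneg.2 h, h2'.le]

theorem not_mem_openTriangle_of_ne (h4 : n = 4) (hbb : b ≠ b') {z : ℂ}
    (hz : z ∈ (modelBasis n hn i b hb).triangle) :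
    z ∉ (modelBasis n hn i b' hb').openTriangle := by
  intro h
  have h1 := h 1
  rw [(modelBasis_coord (hb := hb) h4 hbb z).1] at h1
  linarith [hz 1]

end modelPolygon

namespace PlanarComplex

variable {V F : Type*} {T : PlanarComplex V F} {Ω : Set ℂ}

/-! ### The triangulation obtained from a cellular decomposition -/

/-- The triangles into which the 2-cells are cut: a quadrilateral gives two of them, a triangle
only the one marked `false`. -/
abbrev Triangle (T : PlanarComplex V F) := {τ : F × Bool // T.sides τ.1 = 3 → τ.2 = false}

open Classical in
/-- The triangulation which results when every quadrilateral `f` is cut by the diagonal at its corner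
`d f`. Its edges are those of `T`, given by their ends, and one diagonal for every quadrilateral;
the side opposite to the corner `1` of a half of a quadrilateral is the diagonal. -/
noncomputable def triangulation (hT : T.IsCellDecomposition Ω) (d : ∀ f, ZMod (T.sides f)) :
    AffineTriangulation V T.Triangle (Sym2 V ⊕ F) where
  basis τ := modelBasis _ (hT.sides_eq τ.1.1) (d τ.1.1) τ.1.2 τ.2
  chart τ := T.cell τ.1.1
  vert τ k := T.corner τ.1.1 (triangleCorner _ (d τ.1.1) τ.1.2 k)
  edge τ k := if T.sides τ.1.1 = 4 ∧ k = 1 then Sum.inr τ.1.1 else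
    Sum.inl s(T.corner τ.1.1 (triangleCorner _ (d τ.1.1) τ.1.2 (k + 1)),
      T.corner τ.1.1 (triangleCorner _ (d τ.1.1) τ.1.2 (k + 2)))
  pos := T.pos

namespace IsCellDecomposition

theorem neZero_sides (hT : T.IsCellDecomposition Ω) (f : F) : NeZero (T.sides f) :=
  ⟨by have := hT.sides_eq f; omega⟩

theorem corner_injective (hT : T.IsCellDecomposition Ω) (f : F) :
    Function.Injective (T.corner f) := by
  have := hT.neZero_sides f
  intro j j' h
  apply modelCorner_injective (T.sides f)
  apply hT.cell_injOn f (modelCorner_mem_modelPolygon j) (modelCorner_mem_modelPolygon j')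
  rw [hT.cell_corner, hT.cell_corner, h]

theorem adj_corner (hT : T.IsCellDecomposition Ω) (f : F) (j : ZMod (T.sides f)) :
    T.graph.Adj (T.corner f j) (T.corner f (j + 1)) := by
  rw [graph, SimpleGraph.fromRel_adj]
  refine ⟨fun h => ?_, Or.inl ⟨f, j, rfl⟩⟩
  have : Fact (1 < T.sides f) := ⟨by have := hT.sides_eq f; omega⟩
  exact one_ne_zero (left_eq_add.1 (hT.corner_injective f h))

theorem exists_isSide {u v : V} (h : T.graph.Adj u v) : ∃ f, T.IsSide f u v := by
  rw [graph, SimpleGraph.fromRel_adj] at h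
  rcases h.2 with h | ⟨f, j, h⟩
  · exact h
  · exact ⟨f, j, h.trans Sym2.eq_swap⟩

theorem openEdge_swap (hT : T.IsCellDecomposition Ω) {u v : V} (h : T.graph.Adj u v) :
    T.openEdge v u ⊆ T.openEdge u v := by
  rintro _ ⟨t, ht, rfl⟩
  exact ⟨1 - t, ⟨by linarith [ht.2], by linarith [ht.1]⟩,
    (hT.edge_symm u v h t (Ioo_subset_Icc_self ht)).symm⟩

theorem closedEdge_swap (hT : T.IsCellDecomposition Ω) {u v : V} (h : T.graph.Adj u v) :
    T.closedEdge v u ⊆ T.closedEdge u v := by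
  rintro _ ⟨t, ht, rfl⟩
  exact ⟨1 - t, ⟨by linarith [ht.2], by linarith [ht.1]⟩, (hT.edge_symm u v h t ht).symm⟩

theorem openEdge_congr (hT : T.IsCellDecomposition Ω) {u v u' v' : V} (h : T.graph.Adj u v)
    (he : s(u, v) = s(u', v')) : T.openEdge u v = T.openEdge u' v' := by
  rcases Sym2.eq_iff.1 he with ⟨rfl, rfl⟩ | ⟨rfl, rfl⟩
  · rfl
  · exact (hT.openEdge_swap h.symm).antisymm (hT.openEdge_swap h)

theorem closedEdge_congr (hT : T.IsCellDecomposition Ω) {u v u' v' : V} (h : T.graph.Adj u v)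
    (he : s(u, v) = s(u', v')) : T.closedEdge u v = T.closedEdge u' v' := by
  rcases Sym2.eq_iff.1 he with ⟨rfl, rfl⟩ | ⟨rfl, rfl⟩
  · rfl
  · exact (hT.closedEdge_swap h.symm).antisymm (hT.closedEdge_swap h)

theorem openEdge_subset_closedEdge (u v : V) : T.openEdge u v ⊆ T.closedEdge u v :=
  image_mono Ioo_subset_Icc_self

theorem side_subset (f : F) (j : ZMod (T.sides f)) {t : ℝ} (ht : t ∈ Icc (0 : ℝ) 1) :
    AffineMap.lineMap (modelCorner (T.sides f) j) (modelCorner (T.sides f) (j + 1)) t ∈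
      modelPolygon (T.sides f) :=
  (convex_convexHull ℝ _).lineMap_mem (modelCorner_mem_modelPolygon j)
    (modelCorner_mem_modelPolygon (j + 1)) ht

/-- An open edge contains no vertex. -/
theorem pos_notMem_openEdge (hT : T.IsCellDecomposition Ω) {u v : V} (h : T.graph.Adj u v) (w : V) :
    T.pos w ∉ T.openEdge u v := by
  obtain ⟨f, j, rfl⟩ := hT.exists_corner w
  have := hT.neZero_sides f
  have hadj := hT.adj_corner f j
  have h0 : T.pos (T.corner f j) = T.edge (T.corner f j) (T.corner f (j + 1)) 0 := by
    rw [← hT.cell_side f j 0 (by simp), AffineMap.lineMap_apply_zero, hT.cell_corner]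
  intro hmem
  by_cases he : s(u, v) = s(T.corner f j, T.corner f (j + 1))
  · rw [hT.openEdge_congr h he] at hmem
    obtain ⟨t, ht, htp⟩ := hmem
    rw [← hT.cell_side f j t (Ioo_subset_Icc_self ht), ← hT.cell_corner] at htp
    have h1 := hT.cell_injOn f (side_subset f j (Ioo_subset_Icc_self ht))
      (modelCorner_mem_modelPolygon j) htp
    rw [AffineMap.lineMap_eq_left_iff] at h1
    rcases h1 with h1 | h1
    · exact hadj.ne (congrArg _ (modelCorner_injective _ h1))
    · exact ht.1.ne' h1
  · exact disjoint_left.1 (hT.edge_disjoint u v _ _ h hadj he) hmem (h0 ▸ ⟨0, by simp, rfl⟩)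

/-- The image of an open subset of the model polygon is open: its complement in the open cell is
covered by a compact set. -/
theorem isOpen_image_cell (hT : T.IsCellDecomposition Ω) (f : F) {U : Set ℂ} (hU : IsOpen U)
    (hUp : U ⊆ modelPolygon (T.sides f)) : IsOpen (T.cell f '' U) := by
  have := hT.neZero_sides f
  have h : T.cell f '' U = T.openCell f \ T.cell f '' (modelPolygon (T.sides f) \ U) := by
    ext y
    constructor
    · rintro ⟨z, hz, rfl⟩
      refine ⟨⟨z, interior_maximal hUp hU hz, rfl⟩, ?_⟩
      rintro ⟨w, ⟨hw, hwU⟩, hwz⟩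
      exact hwU (hT.cell_injOn f hw (hUp hz) hwz ▸ hz)
    · rintro ⟨⟨z, hz, rfl⟩, hn⟩
      by_contra hzU
      exact hn ⟨z, ⟨interior_subset hz, fun h => hzU ⟨z, h, rfl⟩⟩, rfl⟩
  rw [h]
  refine (hT.isOpen_openCell f).sdiff (IsCompact.isClosed ?_)
  exact ((isCompact_modelPolygon _).diff hU).image_of_continuousOn
    ((hT.cell_continuousOn f).mono sdiff_subset)

variable (hT : T.IsCellDecomposition Ω) (d : ∀ f, ZMod (T.sides f))

theorem edge_diagonal {τ : T.Triangle} {k : Fin 3} (h : T.sides τ.1.1 = 4 ∧ k = 1) :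
    (triangulation hT d).edge τ k = Sum.inr τ.1.1 := if_pos h

theorem edge_side_eq {τ : T.Triangle} {k : Fin 3} (h : ¬ (T.sides τ.1.1 = 4 ∧ k = 1)) :
    (triangulation hT d).edge τ k =
      Sum.inl s((triangulation hT d).vert τ (k + 1), (triangulation hT d).vert τ (k + 2)) := if_neg h

theorem dom_subset (τ : T.Triangle) :
    (triangulation hT d).dom τ ⊆ modelPolygon (T.sides τ.1.1) :=
  modelBasis_triangle_subset (hn := hT.sides_eq τ.1.1) (hb := τ.2)

theorem adj_vert {τ : T.Triangle} {k : Fin 3} (h : ¬ (T.sides τ.1.1 = 4 ∧ k = 1)) :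
    T.graph.Adj ((triangulation hT d).vert τ (k + 1)) ((triangulation hT d).vert τ (k + 2)) := by
  rcases triangleCorner_side (hT.sides_eq τ.1.1) τ.2 (i := d τ.1.1) k h with h1 | h1
  · have := hT.adj_corner τ.1.1 (triangleCorner _ (d τ.1.1) τ.1.2 (k + 1))
    rwa [← h1] at this
  · have := hT.adj_corner τ.1.1 (triangleCorner _ (d τ.1.1) τ.1.2 (k + 2))
    rw [← h1] at this
    exact this.symm

theorem chart_lineMap {τ : T.Triangle} {k : Fin 3} (h : ¬ (T.sides τ.1.1 = 4 ∧ k = 1)) {t : ℝ}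
    (ht : t ∈ Icc (0 : ℝ) 1) :
    (triangulation hT d).chart τ (AffineMap.lineMap ((triangulation hT d).basis τ (k + 1))
      ((triangulation hT d).basis τ (k + 2)) t) =
    T.edge ((triangulation hT d).vert τ (k + 1)) ((triangulation hT d).vert τ (k + 2)) t := by
  have hadj := hT.adj_vert d h
  rcases triangleCorner_side (hT.sides_eq τ.1.1) τ.2 (i := d τ.1.1) k h with h1 | h1
  · have := hT.cell_side τ.1.1 (triangleCorner _ (d τ.1.1) τ.1.2 (k + 1)) t ht
    rwa [← h1] at this
  · have ht' : 1 - t ∈ Icc (0 : ℝ) 1 := ⟨by linarith [ht.2], by linarith [ht.1]⟩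
    have := hT.cell_side τ.1.1 (triangleCorner _ (d τ.1.1) τ.1.2 (k + 2)) (1 - t) ht'
    rw [← h1, AffineMap.lineMap_apply_one_sub] at this
    refine this.trans ?_
    exact (hT.edge_symm _ _ hadj (1 - t) ht').trans (by rw [sub_sub_cancel])

theorem image_side {τ : T.Triangle} {k : Fin 3} (h : ¬ (T.sides τ.1.1 = 4 ∧ k = 1)) :
    (triangulation hT d).chart τ '' {z ∈ (triangulation hT d).dom τ |
      ((triangulation hT d).basis τ).coord k z = 0} =
    T.closedEdge ((triangulation hT d).vert τ (k + 1)) ((triangulation hT d).vert τ (k + 2)) := by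
  rw [AffineTriangulation.dom, AffineBasis.side_eq_image, image_image, closedEdge]
  exact image_congr fun t ht => hT.chart_lineMap d h ht

theorem chart_mem_openEdge {τ : T.Triangle} {k : Fin 3} (h : ¬ (T.sides τ.1.1 = 4 ∧ k = 1)) {z : ℂ}
    (hz : ((triangulation hT d).basis τ).OnSide k z) : (triangulation hT d).chart τ z ∈
    T.openEdge ((triangulation hT d).vert τ (k + 1)) ((triangulation hT d).vert τ (k + 2)) := by
  obtain ⟨t, ht, rfl⟩ := hz.exists_lineMap
  exact ⟨t, ht, (hT.chart_lineMap d h (Ioo_subset_Icc_self ht)).symm⟩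

theorem chart_mem_openCell {τ : T.Triangle} {z : ℂ}
    (hz : z ∈ ((triangulation hT d).basis τ).openTriangle) :
    (triangulation hT d).chart τ z ∈ T.openCell τ.1.1 :=
  ⟨z, modelBasis_openTriangle_subset (hn := hT.sides_eq τ.1.1) (hb := τ.2) hz, rfl⟩

theorem chart_mem_openCell_of_diagonal {τ : T.Triangle} (h : T.sides τ.1.1 = 4) {z : ℂ}
    (hz : ((triangulation hT d).basis τ).OnSide 1 z) :
    (triangulation hT d).chart τ z ∈ T.openCell τ.1.1 :=
  ⟨z, mem_interior_of_onSide_diagonal (hn := hT.sides_eq τ.1.1) (hb := τ.2) h hz, rfl⟩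

theorem cell_eq_of_mem_openCell {τ : T.Triangle} {f : F} {y : ℂ} (hy : y ∈ T.openCell f)
    {z : ℂ} (hz : z ∈ (triangulation hT d).dom τ) (hyz : y = (triangulation hT d).chart τ z) :
    f = τ.1.1 := by
  by_contra hne
  exact disjoint_left.1 (hT.cell_disjoint _ _ hne) hy (hyz ▸ ⟨z, hT.dom_subset d τ hz, rfl⟩)

/-- The polygon of every 2-cell is the union of its triangles. -/
theorem exists_mem_dom {f : F} {z : ℂ} (hz : z ∈ modelPolygon (T.sides f)) :
    ∃ τ : T.Triangle, τ.1.1 = f ∧ z ∈ (triangulation hT d).dom τ := by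
  rcases hT.sides_eq f with h | h
  · refine ⟨⟨(f, false), fun _ => rfl⟩, rfl, ?_⟩
    exact (modelPolygon_eq_triangle (hn := hT.sides_eq f) (i := d f) (b := false)
      (hb := fun _ => rfl) h).subset hz
  · have hb : ∀ b : Bool, T.sides f = 3 → b = false := fun b h' => absurd h' (by omega)
    rcases modelPolygon_subset_union (hn := hT.sides_eq f) (i := d f) (hb := hb false)
      (hb' := hb true) h (by simp) hz with hz | hz
    · exact ⟨⟨(f, false), hb false⟩, rfl, hz⟩
    · exact ⟨⟨(f, true), hb true⟩, rfl, hz⟩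

/-- The triangles cut out of the model polygons, with the restrictions of the characteristic maps,
triangulate the closed region. -/
theorem triangulates_triangulation : (triangulation hT d).Triangulates (closure Ω) where
  continuousOn τ := (hT.cell_continuousOn τ.1.1).mono (hT.dom_subset d τ)
  injOn τ := (hT.cell_injOn τ.1.1).mono (hT.dom_subset d τ)
  isOpen_image τ U hU hUo := hT.isOpen_image_cell τ.1.1 hUo (hU.trans (hT.dom_subset d τ))
  cover := by
    rw [hT.closure_eq]
    refine Subset.antisymm (iUnion_subset fun f => ?_) (iUnion_subset fun τ => ?_)
    · rintro _ ⟨z, hz, rfl⟩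
      obtain ⟨τ, rfl, hzτ⟩ := hT.exists_mem_dom d hz
      exact mem_iUnion.2 ⟨τ, z, hzτ, rfl⟩
    · exact (image_mono (hT.dom_subset d τ)).trans (subset_iUnion T.closedCell τ.1.1)
  chart_basis τ k := hT.cell_corner τ.1.1 _
  pos_injective := hT.pos_injective
  eq_of_mem_openTriangle τ τ' z hz z' hz' hzz := by
    obtain ⟨⟨f, b⟩, hb⟩ := τ
    obtain ⟨⟨f', b'⟩, hb'⟩ := τ'
    obtain rfl : f = f' := hT.cell_eq_of_mem_openCell d (hT.chart_mem_openCell d hz) hz' hzz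
    obtain rfl : z = z' := hT.cell_injOn f
      (hT.dom_subset d ⟨⟨f, b⟩, hb⟩ (AffineBasis.openTriangle_subset_triangle _ hz)) (hT.dom_subset d _ hz') hzz
    have : b = b' := by
      by_contra hbb
      have h4 : T.sides f = 4 := by
        refine (hT.sides_eq f).resolve_left fun h3 => hbb ?_
        rw [show b = false from hb h3, show b' = false from hb' h3]
      exact not_mem_openTriangle_of_ne (hn := hT.sides_eq f) (hb := hb') (hb' := hb) h4
        (Ne.symm hbb) hz' hz
    subst this
    rfl
  exists_onSide τ τ' k z hz z' hz' hzz := by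
    have hdiag : ∀ (τ τ' : T.Triangle) (z z' : ℂ), T.sides τ.1.1 = 4 →
        ((triangulation hT d).basis τ).OnSide 1 z → z' ∈ (triangulation hT d).dom τ' →
        (triangulation hT d).chart τ z = (triangulation hT d).chart τ' z' →
        τ.1.1 = τ'.1.1 ∧ ((triangulation hT d).basis τ').OnSide 1 z' := by
      rintro ⟨⟨f, b⟩, hb⟩ ⟨⟨f', b'⟩, hb'⟩ z z' h4 hz hz' hzz
      obtain rfl : f = f' :=
        hT.cell_eq_of_mem_openCell d (hT.chart_mem_openCell_of_diagonal d h4 hz) hz' hzz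
      obtain rfl : z = z' := hT.cell_injOn f
        (hT.dom_subset d ⟨⟨f, b⟩, hb⟩ hz.mem_triangle) (hT.dom_subset d _ hz') hzz
      exact ⟨rfl, (onSide_diagonal_iff (hn := hT.sides_eq f) (hb := hb) (hb' := hb') h4).2 hz⟩
    by_cases hk : T.sides τ.1.1 = 4 ∧ k = 1
    · obtain ⟨h4, rfl⟩ := hk
      obtain ⟨hf, h1⟩ := hdiag τ τ' z z' h4 hz hz' hzz
      refine ⟨1, ?_, h1⟩
      rw [hT.edge_diagonal d ⟨h4, rfl⟩, hT.edge_diagonal d ⟨hf ▸ h4, rfl⟩, hf]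
    have hadj := hT.adj_vert d hk
    have hmem := hT.chart_mem_openEdge d hk hz
    rcases AffineBasis.mem_triangle_cases hz' with ho | ⟨k', hk'⟩ | ⟨j, rfl⟩
    · exfalso
      obtain ⟨⟨f, b⟩, hb⟩ := τ
      obtain ⟨⟨f', b'⟩, hb'⟩ := τ'
      obtain rfl : f' = f := hT.cell_eq_of_mem_openCell d (hT.chart_mem_openCell d ho)
        (AffineBasis.OnSide.mem_triangle hz) hzz.symm
      obtain rfl : z = z' := hT.cell_injOn f'
        (hT.dom_subset d ⟨⟨f', b⟩, hb⟩ hz.mem_triangle) (hT.dom_subset d _ hz') hzz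
      by_cases hbb : b = b'
      · subst hbb
        exact hz.not_mem_openTriangle ho
      · have h4 : T.sides f' = 4 := by
          refine (hT.sides_eq f').resolve_left fun h3 => hbb ?_
          rw [show b = false from hb h3, show b' = false from hb' h3]
        exact not_mem_openTriangle_of_ne (hn := hT.sides_eq f') (hb := hb) (hb' := hb') h4 hbb
          hz.mem_triangle ho
    · by_cases hd : T.sides τ'.1.1 = 4 ∧ k' = 1
      · obtain ⟨h4, rfl⟩ := hd
        obtain ⟨hf, h1⟩ := hdiag τ' τ z' z h4 hk' hz.mem_triangle hzz.symm
        exact absurd ⟨hf ▸ h4, (hz.eq h1.1).symm⟩ hk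
      · refine ⟨k', ?_, hk'⟩
        have hmem' := hT.chart_mem_openEdge d hd hk'
        rw [hT.edge_side_eq d hk, hT.edge_side_eq d hd]
        congr 1
        by_contra hne
        exact disjoint_left.1 (hT.edge_disjoint _ _ _ _ hadj (hT.adj_vert d hd) (Ne.symm hne)) hmem
          (openEdge_subset_closedEdge _ _ (hzz ▸ hmem'))
    · exfalso
      refine hT.pos_notMem_openEdge hadj ((triangulation hT d).vert τ' j) ?_
      rw [hzz] at hmem
      rwa [← show (triangulation hT d).chart τ' ((triangulation hT d).basis τ' j) =
        T.pos ((triangulation hT d).vert τ' j) from hT.cell_corner τ'.1.1 _]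
  side_eq τ τ' k k' he := by
    by_cases hk : T.sides τ.1.1 = 4 ∧ k = 1 <;> by_cases hk' : T.sides τ'.1.1 = 4 ∧ k' = 1
    · obtain ⟨⟨f, b⟩, hb⟩ := τ
      obtain ⟨⟨f', b'⟩, hb'⟩ := τ'
      rw [hT.edge_diagonal d hk, hT.edge_diagonal d hk'] at he
      obtain rfl : f = f' := Sum.inr_injective he
      obtain ⟨h4, rfl⟩ := hk
      obtain ⟨-, rfl⟩ := hk'
      congr 1
      rw [AffineTriangulation.dom, AffineTriangulation.dom, AffineBasis.side_eq_image,
        AffineBasis.side_eq_image]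
      rfl
    · rw [hT.edge_diagonal d hk, hT.edge_side_eq d hk'] at he
      exact absurd he (by simp)
    · rw [hT.edge_side_eq d hk, hT.edge_diagonal d hk'] at he
      exact absurd he (by simp)
    · rw [hT.image_side d hk, hT.image_side d hk']
      rw [hT.edge_side_eq d hk, hT.edge_side_eq d hk'] at he
      exact hT.closedEdge_congr (hT.adj_vert d hk) (Sum.inl_injective he)
  ends_eq τ τ' k k' he j hj := by
    have hall : ∀ k j : Fin 3, j ≠ k → j = k + 1 ∨ j = k + 2 := by decide
    obtain ⟨hk1, hk2, -⟩ := Fin.ne_add_one_three k'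
    by_cases hk : T.sides τ.1.1 = 4 ∧ k = 1 <;> by_cases hk' : T.sides τ'.1.1 = 4 ∧ k' = 1
    · obtain ⟨⟨f, b⟩, hb⟩ := τ
      obtain ⟨⟨f', b'⟩, hb'⟩ := τ'
      rw [hT.edge_diagonal d hk, hT.edge_diagonal d hk'] at he
      obtain rfl : f = f' := Sum.inr_injective he
      obtain ⟨h4, rfl⟩ := hk
      obtain ⟨-, rfl⟩ := hk'
      refine ⟨j, hj, ?_⟩
      rcases hall 1 j hj with rfl | rfl <;> rfl
    · rw [hT.edge_diagonal d hk, hT.edge_side_eq d hk'] at he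
      exact absurd he (by simp)
    · rw [hT.edge_side_eq d hk, hT.edge_diagonal d hk'] at he
      exact absurd he (by simp)
    · rw [hT.edge_side_eq d hk, hT.edge_side_eq d hk'] at he
      rcases Sym2.eq_iff.1 (Sum.inl_injective he) with ⟨h1, h2⟩ | ⟨h1, h2⟩ <;>
        rcases hall k j hj with rfl | rfl
      · exact ⟨_, hk1.symm, h1.symm⟩
      · exact ⟨_, hk2.symm, h2.symm⟩
      · exact ⟨_, hk2.symm, h1.symm⟩
      · exact ⟨_, hk1.symm, h2.symm⟩

/-- Every 2-cell with the side `{u, v}` contributes exactly one triangle at this edge. -/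
theorem ncard_sides (u v : V) :
    {η : T.Triangle × Fin 3 | (triangulation hT d).edge η.1 η.2 = Sum.inl s(u, v)}.ncard =
      {f | T.IsSide f u v}.ncard := by
  refine ncard_congr (fun η _ => η.1.1.1) ?_ ?_ ?_
  · rintro ⟨τ, k⟩ h
    by_cases hk : T.sides τ.1.1 = 4 ∧ k = 1
    · exact absurd ((hT.edge_diagonal d hk).symm.trans h) (by simp)
    have h' := Sum.inl_injective ((hT.edge_side_eq d hk).symm.trans h)
    rcases triangleCorner_side (hT.sides_eq τ.1.1) τ.2 (i := d τ.1.1) k hk with h1 | h1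
    · refine ⟨triangleCorner _ (d τ.1.1) τ.1.2 (k + 1), ?_⟩
      rw [← h1]
      exact h'
    · refine ⟨triangleCorner _ (d τ.1.1) τ.1.2 (k + 2), ?_⟩
      rw [← h1, Sym2.eq_swap]
      exact h'
  · rintro ⟨⟨⟨f, b⟩, hb⟩, k⟩ ⟨⟨⟨f', b'⟩, hb'⟩, k'⟩ h h' hf
    obtain rfl : f = f' := hf
    by_cases hk : T.sides f = 4 ∧ k = 1
    · exact absurd ((hT.edge_diagonal d (τ := ⟨⟨f, b⟩, hb⟩) hk).symm.trans h) (by simp)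
    by_cases hk' : T.sides f = 4 ∧ k' = 1
    · exact absurd ((hT.edge_diagonal d (τ := ⟨⟨f, b'⟩, hb'⟩) hk').symm.trans h') (by simp)
    have h1 := Sum.inl_injective ((hT.edge_side_eq d (τ := ⟨⟨f, b⟩, hb⟩) hk).symm.trans h)
    have h2 := Sum.inl_injective ((hT.edge_side_eq d (τ := ⟨⟨f, b'⟩, hb'⟩) hk').symm.trans h')
    have h3 : s(triangleCorner _ (d f) b (k + 1), triangleCorner _ (d f) b (k + 2)) =
        s(triangleCorner _ (d f) b' (k' + 1), triangleCorner _ (d f) b' (k' + 2)) :=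
      Sym2.map.injective (hT.corner_injective f) (h1.trans h2.symm)
    obtain ⟨rfl, rfl⟩ := triangleCorner_side_unique (hT.sides_eq f) hb hb' k k' hk hk' h3
    rfl
  · rintro f ⟨j, hj⟩
    obtain ⟨b, k, hb, hk, hjk⟩ := exists_triangleCorner_side (hT.sides_eq f) (d f) j
    refine ⟨⟨⟨⟨f, b⟩, hb⟩, k⟩, ?_, rfl⟩
    refine (hT.edge_side_eq d (τ := ⟨⟨f, b⟩, hb⟩) hk).trans (congrArg _ ?_)
    exact (congrArg (Sym2.map (T.corner f)) hjk).trans hj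

theorem ncard_diagonal {f : F} (h4 : T.sides f = 4) :
    {η : T.Triangle × Fin 3 | (triangulation hT d).edge η.1 η.2 = Sum.inr f}.ncard = 2 := by
  have hb : ∀ b : Bool, T.sides f = 3 → b = false := fun b h' => absurd h' (by omega)
  have : {η : T.Triangle × Fin 3 | (triangulation hT d).edge η.1 η.2 = Sum.inr f} =
      {(⟨⟨f, false⟩, hb false⟩, 1), (⟨⟨f, true⟩, hb true⟩, 1)} := by
    ext ⟨⟨⟨f', b⟩, hb'⟩, k⟩
    constructor
    · intro h
      by_cases hk : T.sides f' = 4 ∧ k = 1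
      · obtain rfl : f' = f :=
          Sum.inr_injective ((hT.edge_diagonal d (τ := ⟨⟨f', b⟩, hb'⟩) hk).symm.trans h)
        obtain ⟨-, rfl⟩ := hk
        cases b
        · left; rfl
        · right; rfl
      · exact absurd ((hT.edge_side_eq d (τ := ⟨⟨f', b⟩, hb'⟩) hk).symm.trans h) (by simp)
    · rintro (h | h) <;> rw [h] <;> exact hT.edge_diagonal d ⟨h4, rfl⟩
  rw [this, ncard_pair]
  simp

end IsCellDecomposition

end PlanarComplex

/-! ### Functions without local extrema on a multiply connected region -/

theorem IsPreconnected.subset_of_isClosed {S A B : Set ℂ} (hS : IsPreconnected S) (hA : IsClosed A)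
    (hB : IsClosed B) (hAB : Disjoint A B) (hSAB : S ⊆ A ∪ B) (hSA : (S ∩ A).Nonempty) : S ⊆ A := by
  rcases isPreconnected_iff_subset_of_disjoint_closed.1 hS A B hA hB hSAB
    (by rw [hAB.inter_eq, inter_empty]) with h | h
  · exact h
  · obtain ⟨y, hyS, hyA⟩ := hSA
    exact absurd (h hyS) (disjoint_left.1 hAB hyA)

/-- A punctured disc is connected, as the image of a strip under polar coordinates. -/
theorem isPreconnected_ball_diff_center (y : ℂ) (r : ℝ) :
    IsPreconnected (Metric.ball y r \ {y}) := by
  have h : Metric.ball y r \ {y} =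
      (fun p : ℝ × ℝ => y + p.1 * Complex.exp (p.2 * Complex.I)) '' (Ioo 0 r ×ˢ univ) := by
    ext z
    constructor
    · rintro ⟨hz, hzy⟩
      refine ⟨(‖z - y‖, (z - y).arg), ⟨⟨norm_pos_iff.2 (sub_ne_zero.2 hzy), ?_⟩, mem_univ _⟩, ?_⟩
      · rwa [Metric.mem_ball, dist_eq_norm] at hz
      · simp only
        rw [Complex.norm_mul_exp_arg_mul_I]
        ring
    · rintro ⟨⟨ρ, θ⟩, ⟨⟨h0, hr⟩, -⟩, rfl⟩
      simp only at h0 hr ⊢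
      refine ⟨?_, ?_⟩
      · rw [Metric.mem_ball, dist_eq_norm, add_sub_cancel_left, norm_mul,
          Complex.norm_exp_ofReal_mul_I, Complex.norm_real, Real.norm_eq_abs, abs_of_pos h0, mul_one]
        exact hr
      · simp [h0.ne']
  rw [h]
  refine (isPreconnected_Ioo.prod isPreconnected_univ).image _ (Continuous.continuousOn ?_)
  fun_prop

/-- The function `h` on the closure of `Ω` has no local extremum in `Ω`. -/
structure HasNoLocalExtr (Ω : Set ℂ) (h : ℂ → ℝ) : Prop where
  continuousOn : ContinuousOn h (closure Ω)
  exists_higher : ∀ z ∈ Ω, ∀ N ∈ 𝓝 z, ∃ w ∈ N, w ∈ closure Ω ∧ h z < h w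
  exists_lower : ∀ z ∈ Ω, ∀ N ∈ 𝓝 z, ∃ w ∈ N, w ∈ closure Ω ∧ h w < h z

theorem HasNoLocalExtr.neg {Ω : Set ℂ} {h : ℂ → ℝ} (H : HasNoLocalExtr Ω h) :
    HasNoLocalExtr Ω fun z => -h z where
  continuousOn := H.continuousOn.neg
  exists_higher z hz N hN := by simpa using H.exists_lower z hz N hN
  exists_lower z hz N hN := by simpa using H.exists_higher z hz N hN

/-- The maximum principle. -/
theorem HasNoLocalExtr.lt_of_forall_frontier_le {Ω : Set ℂ} {h : ℂ → ℝ} (H : HasNoLocalExtr Ω h)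
    (hΩ : IsCompact (closure Ω)) {M : ℝ} (hM : ∀ z ∈ frontier Ω, h z ≤ M) {z : ℂ} (hz : z ∈ Ω) :
    h z < M := by
  obtain ⟨p, hp, hpmax⟩ := hΩ.exists_isMaxOn ⟨z, subset_closure hz⟩ H.continuousOn
  obtain ⟨w, -, hw, hwz⟩ := H.exists_higher z hz univ univ_mem
  refine hwz.trans_le ((hpmax hw).trans ?_)
  have hpΩ : p ∉ Ω := fun hpΩ => by
    obtain ⟨w, -, hw, hwp⟩ := H.exists_higher p hpΩ univ univ_mem
    exact absurd (hpmax hw) (not_le.2 hwp)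
  exact hM p ⟨hp, fun hi => hpΩ (interior_subset hi)⟩

namespace IsMultiplyConnectedRegion

variable {m : ℕ} {Ω E₁ : Set ℂ} {E₂ : Fin (m - 1) → Set ℂ} {h : ℂ → ℝ} {k l : ℝ}

theorem isCompact_closure (hΩ : IsMultiplyConnectedRegion m Ω E₁ E₂) : IsCompact (closure Ω) :=
  hΩ.isBounded.isCompact_closure

theorem notMem_of_mem_frontier (hΩ : IsMultiplyConnectedRegion m Ω E₁ E₂) {z : ℂ}
    (hz : z ∈ frontier Ω) : z ∉ Ω := by
  rw [frontier, hΩ.isOpen.interior_eq] at hz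
  exact hz.2

theorem mem_frontier (hΩ : IsMultiplyConnectedRegion m Ω E₁ E₂) {z : ℂ} (hz : z ∈ closure Ω)
    (hzΩ : z ∉ Ω) : z ∈ frontier Ω := by
  rw [frontier, hΩ.isOpen.interior_eq]
  exact ⟨hz, hzΩ⟩

theorem outer_subset (hΩ : IsMultiplyConnectedRegion m Ω E₁ E₂) : E₁ ⊆ frontier Ω := by
  rw [hΩ.frontier_eq]
  exact subset_union_left

theorem inner_subset (hΩ : IsMultiplyConnectedRegion m Ω E₁ E₂) (i : Fin (m - 1)) :
    E₂ i ⊆ frontier Ω := by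
  rw [hΩ.frontier_eq]
  exact (subset_iUnion E₂ i).trans subset_union_right

theorem subset_outer (hΩ : IsMultiplyConnectedRegion m Ω E₁ E₂) {S : Set ℂ}
    (hS : IsPreconnected S) (hSf : S ⊆ frontier Ω) (hSE : (S ∩ E₁).Nonempty) : S ⊆ E₁ := by
  rw [hΩ.frontier_eq] at hSf
  exact hS.subset_of_isClosed hΩ.outer_curve.isCompact.isClosed
    (isClosed_iUnion_of_finite fun i => (hΩ.inner_curve i).isCompact.isClosed)
    (disjoint_iUnion_right.2 hΩ.outer_disjoint) hSf hSE

theorem subset_inner (hΩ : IsMultiplyConnectedRegion m Ω E₁ E₂) {S : Set ℂ}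
    (hS : IsPreconnected S) (hSf : S ⊆ frontier Ω) {i : Fin (m - 1)}
    (hSE : (S ∩ E₂ i).Nonempty) : S ⊆ E₂ i := by
  rw [hΩ.frontier_eq] at hSf
  refine hS.subset_of_isClosed (B := E₁ ∪ ⋃ j ∈ {j | j ≠ i}, E₂ j)
    (hΩ.inner_curve i).isCompact.isClosed
    (hΩ.outer_curve.isCompact.isClosed.union ((Set.toFinite _).isClosed_biUnion fun j _ =>
      (hΩ.inner_curve j).isCompact.isClosed)) ?_ ?_ hSE
  · refine disjoint_union_right.2 ⟨(hΩ.outer_disjoint i).symm, disjoint_iUnion₂_right.2 fun j hj => ?_⟩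
    exact hΩ.inner_disjoint i j (Ne.symm hj)
  · refine hSf.trans (union_subset (subset_union_left.trans subset_union_right) ?_)
    refine iUnion_subset fun j => ?_
    by_cases hj : j = i
    · rw [hj]
      exact subset_union_left
    · exact ((subset_biUnion_of_mem (u := E₂) (show j ∈ {j | j ≠ i} from hj)).trans
        subset_union_right).trans subset_union_right

/-- The region meets the component of the complement of `E₁` around a point of an inner boundary
curve, which is bounded. -/
theorem subset_inside (hΩ : IsMultiplyConnectedRegion m Ω E₁ E₂) (hm : 2 ≤ m) : Ω ⊆ inside E₁ := by
  have hE : IsClosed E₁ := hΩ.outer_curve.isCompact.isClosed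
  have hΩE : Ω ⊆ E₁ᶜ := fun z hz hzE => hΩ.notMem_of_mem_frontier (hΩ.outer_subset hzE) hz
  obtain ⟨p, hp⟩ := (hΩ.inner_curve ⟨0, by omega⟩).nonempty
  obtain ⟨hpE, hpb⟩ := hΩ.outermost _ hp
  have hopen : IsOpen (connectedComponentIn E₁ᶜ p) := hE.isOpen_compl.connectedComponentIn
  obtain ⟨q, hq, hqΩ⟩ := mem_closure_iff.1 (frontier_subset_closure (hΩ.inner_subset _ hp)) _ hopen
    (mem_connectedComponentIn hpE)
  intro z hz
  refine ⟨hΩE hz, ?_⟩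
  rwa [← connectedComponentIn_eq (hΩ.isConnected.isPreconnected.subset_connectedComponentIn hqΩ hΩE
    hz), ← connectedComponentIn_eq hq]

/-- The outer boundary curve is connected with infinity in the complement of a compact set in
`Ω`: the unbounded component of its complement does not meet the closure of `Ω`. -/
theorem not_isBounded_connectedComponentIn (hΩ : IsMultiplyConnectedRegion m Ω E₁ E₂) (hm : 2 ≤ m)
    {Y : Set ℂ} (hY : IsClosed Y) (hYΩ : Y ⊆ Ω) {e : ℂ} (he : e ∈ E₁) :
    ¬ Bornology.IsBounded (connectedComponentIn Yᶜ e) := by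
  have hE : IsClosed E₁ := hΩ.outer_curve.isCompact.isClosed
  obtain ⟨R, hR0, hR⟩ := hΩ.outer_curve.isCompact.isBounded.subset_closedBall_lt 0 0
  have hBE : (Metric.closedBall (0 : ℂ) R)ᶜ ⊆ E₁ᶜ := compl_subset_compl.2 hR
  have hBb : ¬ Bornology.IsBounded (Metric.closedBall (0 : ℂ) R)ᶜ := fun hb => by
    have := (Metric.isBounded_closedBall (x := (0 : ℂ)) (r := R)).union hb
    rw [union_compl_self] at this
    exact NormedSpace.unbounded_univ ℝ ℂ this
  obtain ⟨o, ho⟩ : ((Metric.closedBall (0 : ℂ) R)ᶜ).Nonempty := by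
    rw [nonempty_iff_ne_empty]
    intro h0
    exact hBb (h0 ▸ Bornology.isBounded_empty)
  set O := connectedComponentIn E₁ᶜ o with hO
  have hBO : (Metric.closedBall (0 : ℂ) R)ᶜ ⊆ O :=
    (isPreconnected_compl_closedBall hR0).subset_connectedComponentIn ho hBE
  have hOb : ¬ Bornology.IsBounded O := fun hb => hBb (hb.subset hBO)
  have hOΩ : O ⊆ Yᶜ := by
    intro z hz hzY
    have h1 := (hΩ.subset_inside hm (hYΩ hzY)).2
    rw [← connectedComponentIn_eq hz] at h1
    exact hOb h1
  -- `O` is not the whole plane, so it has a boundary point, which lies on the curve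
  obtain ⟨p, hp⟩ : (frontier O).Nonempty := by
    rw [nonempty_iff_ne_empty]
    intro h0
    rcases isClopen_iff.1 (isClopen_iff_frontier_eq_empty.2 h0) with h1 | h1
    · exact hOb (h1 ▸ Bornology.isBounded_empty)
    · have : e ∈ O := h1 ▸ mem_univ e
      exact connectedComponentIn_subset _ _ this he
  have hpE : p ∈ E₁ := frontier_connectedComponentIn_compl_subset hE o hp
  have hEY : E₁ ⊆ Yᶜ := fun z hz hzY =>
    hΩ.notMem_of_mem_frontier (hΩ.outer_subset hz) (hYΩ hzY)
  have hpW := hΩ.outer_curve.isConnected.isPreconnected.subset_connectedComponentIn he hEY hpE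
  obtain ⟨q, hqW, hqO⟩ := mem_closure_iff.1 (frontier_subset_closure hp) _
    hY.isOpen_compl.connectedComponentIn hpW
  have hOW : O ⊆ connectedComponentIn Yᶜ e := by
    rw [connectedComponentIn_eq hqW]
    exact isPreconnected_connectedComponentIn.subset_connectedComponentIn hqO hOΩ
  exact fun hb => hOb (hb.subset hOW)

theorem eq_or_eq_of_mem_frontier (hΩ : IsMultiplyConnectedRegion m Ω E₁ E₂)
    (h1 : ∀ z ∈ E₁, h z = k) (h2 : ∀ i, ∀ z ∈ E₂ i, h z = 0) {z : ℂ}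
    (hz : z ∈ frontier Ω) : h z = k ∨ h z = 0 := by
  rw [hΩ.frontier_eq] at hz
  rcases hz with hz | hz
  · exact Or.inl (h1 z hz)
  · obtain ⟨i, hi⟩ := mem_iUnion.1 hz
    exact Or.inr (h2 i z hi)

theorem lt_and_lt_of_mem (hΩ : IsMultiplyConnectedRegion m Ω E₁ E₂) (H : HasNoLocalExtr Ω h)
    (hk : 0 < k) (h1 : ∀ z ∈ E₁, h z = k) (h2 : ∀ i, ∀ z ∈ E₂ i, h z = 0)
    {z : ℂ} (hz : z ∈ Ω) : 0 < h z ∧ h z < k := by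
  have hfr := fun z hz => hΩ.eq_or_eq_of_mem_frontier h1 h2 (z := z) hz
  constructor
  · have := H.neg.lt_of_forall_frontier_le hΩ.isCompact_closure (M := 0) (fun z hz => by
      rcases hfr z hz with h | h <;> rw [h] <;> linarith) hz
    linarith
  · exact H.lt_of_forall_frontier_le hΩ.isCompact_closure (fun z hz => by
      rcases hfr z hz with h | h <;> rw [h]; exact hk.le) hz

/-- By the maximum principle, each component of the complement of a level set which has points
above the level meets the outer boundary curve. -/
theorem isSeparatingLevel (hΩ : IsMultiplyConnectedRegion m Ω E₁ E₂) (H : HasNoLocalExtr Ω h)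
    (h1 : ∀ z ∈ E₁, h z = k) (h2 : ∀ i, ∀ z ∈ E₂ i, h z = 0) (hm : 2 ≤ m)
    (h0l : 0 < l) (hlk : l < k) {e : ℂ} (he : e ∈ E₁) :
    IsSeparatingLevel (closure Ω) h l e := by
  have hfr := fun z hz => hΩ.eq_or_eq_of_mem_frontier h1 h2 (z := z) hz
  set Y := {z ∈ closure Ω | h z = l} with hY
  have hYΩ : Y ⊆ Ω := by
    rintro z ⟨hz, hzl⟩
    by_contra hzΩ
    rcases hfr z (hΩ.mem_frontier hz hzΩ) with h | h <;> linarith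
  have hYcpt : IsCompact Y :=
    hΩ.isCompact_closure.of_isClosed_subset
      (H.continuousOn.preimage_isClosed_of_isClosed isClosed_closure isClosed_singleton)
      fun z hz => hz.1
  refine ⟨hYcpt, ?_, hΩ.not_isBounded_connectedComponentIn hm hYcpt.isClosed hYΩ he, ?_, ?_⟩
  · intro z hz hlz
    set W := connectedComponentIn Yᶜ z with hW
    have hzY : z ∈ Yᶜ := fun h => hlz.ne' h.2
    have hWo : IsOpen W := hYcpt.isClosed.isOpen_compl.connectedComponentIn
    have hWfr : frontier W ⊆ Y := frontier_connectedComponentIn_compl_subset hYcpt.isClosed z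
    by_cases hWE : (W ∩ E₁).Nonempty
    · obtain ⟨p, hpW, hpE⟩ := hWE
      have hEY : E₁ ⊆ Yᶜ := fun w hw hwY => hlk.ne' ((h1 w hw).symm.trans hwY.2)
      have hpe := hΩ.outer_curve.isConnected.isPreconnected.subset_connectedComponentIn he hEY hpE
      rw [connectedComponentIn_eq hpe, ← connectedComponentIn_eq hpW]
      exact mem_connectedComponentIn hzY
    · exfalso
      obtain ⟨p, ⟨hpΩ, hpW⟩, hpmax⟩ := (hΩ.isCompact_closure.inter_right
        (isClosed_closure (s := W))).exists_isMaxOn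
          ⟨z, hz, subset_closure (mem_connectedComponentIn hzY)⟩
          (H.continuousOn.mono inter_subset_left)
      have hlp : l < h p := hlz.trans_le
        (hpmax ⟨hz, subset_closure (mem_connectedComponentIn hzY)⟩)
      have hpW' : p ∈ W := by
        by_contra hpn
        exact hlp.ne' (hWfr ⟨hpW, fun hi => hpn (interior_subset hi)⟩).2
      have hpO : p ∈ Ω := by
        by_contra hpO
        have hpf := hΩ.mem_frontier hpΩ hpO
        rw [hΩ.frontier_eq] at hpf
        rcases hpf with hpE | hpE
        · exact hWE ⟨p, hpW', hpE⟩
        · obtain ⟨i, hi⟩ := mem_iUnion.1 hpE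
          have := h2 i p hi
          linarith
      obtain ⟨w, hwW, hwΩ, hw⟩ := H.exists_higher p hpO W (hWo.mem_nhds hpW')
      exact absurd (hpmax ⟨hwΩ, subset_closure hwW⟩) (not_le.2 hw)
  · intro y hy N hN
    obtain ⟨w, hwN, hwΩ, hw⟩ := H.exists_higher y (hYΩ hy) N hN
    exact ⟨w, hwN, hwΩ, hy.2 ▸ hw⟩
  · intro y hy
    -- an isolated point of the level set would be a local extremum
    rw [Metric.mem_closure_iff]
    by_contra! hno
    obtain ⟨ε, hε, hno⟩ := hno
    obtain ⟨r, hr, hrΩ⟩ := Metric.isOpen_iff.1 hΩ.isOpen y (hYΩ hy)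
    set ρ := min ε r
    have hρ : 0 < ρ := lt_min hε hr
    have hB : Metric.ball y ρ ⊆ Ω := (Metric.ball_subset_ball (min_le_right _ _)).trans hrΩ
    obtain ⟨w, hwB, -, hw⟩ := H.exists_higher y (hYΩ hy) _ (Metric.ball_mem_nhds y hρ)
    obtain ⟨w', hwB', -, hw'⟩ := H.exists_lower y (hYΩ hy) _ (Metric.ball_mem_nhds y hρ)
    obtain ⟨p, ⟨hpB, hpy⟩, hp⟩ := (isPreconnected_ball_diff_center y ρ).intermediate_value
      ⟨hwB', fun h => hw'.ne (by rw [h])⟩ ⟨hwB, fun h => hw.ne' (by rw [h])⟩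
      (H.continuousOn.mono ((sdiff_subset.trans hB).trans subset_closure)) ⟨hw'.le, hw.le⟩
    have h3 := hno p ⟨⟨subset_closure (hB hpB), hp.trans hy.2⟩, hpy⟩
    rw [dist_comm] at h3
    exact absurd (Metric.mem_ball.1 hpB) (not_lt.2 ((min_le_left _ _).trans h3))

end IsMultiplyConnectedRegion

/-! ### Piecewise affine functions on a triangulated region -/

/-- A weighted mean lies strictly between the extreme values if two different values have positive
weights. -/
theorem AffineBasis.exists_lt_and_lt {b : AffineBasis (Fin 3) ℝ ℂ} {v : Fin 3 → ℝ} {w : ℂ}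
    (hw : w ∈ b.triangle) {i j : Fin 3} (hi : 0 < b.coord i w) (hj : 0 < b.coord j w)
    (hij : v i ≠ v j) : (∃ m, b.interpolate v w < v m) ∧ ∃ m, v m < b.interpolate v w := by
  set s := b.interpolate v w with hs
  have hzero : ∑ k, b.coord k w * (v k - s) = 0 := by
    simp only [mul_sub, Finset.sum_sub_distrib, ← Finset.sum_mul, b.sum_coord_apply_eq_one]
    rw [hs, interpolate_apply]
    ring
  have key : (∀ k, b.coord k w * (v k - s) = 0) → False := fun hall => by
    have h1 := (mul_eq_zero.1 (hall i)).resolve_left hi.ne'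
    have h2 := (mul_eq_zero.1 (hall j)).resolve_left hj.ne'
    exact hij (by linarith)
  constructor <;> by_contra! hno
  · exact key fun k => (Finset.sum_eq_zero_iff_of_nonpos (fun k _ =>
      mul_nonpos_of_nonneg_of_nonpos (hw k) (sub_nonpos.2 (hno k)))).1 hzero k (Finset.mem_univ k)
  · exact key fun k => (Finset.sum_eq_zero_iff_of_nonneg (fun k _ =>
      mul_nonneg (hw k) (sub_nonneg.2 (hno k)))).1 hzero k (Finset.mem_univ k)

namespace AffineTriangulation

variable {V Tri Edge : Type*} {X : AffineTriangulation V Tri Edge}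
  {D : Set ℂ} {g : V → ℝ} {h : ℂ → ℝ}

theorem Triangulates.continuousOn_of_interpolate [Finite Tri] (hX : X.Triangulates D)
    (hh : ∀ τ, ∀ z ∈ X.dom τ, h (X.chart τ z) = (X.basis τ).interpolate (g ∘ X.vert τ) z) :
    ContinuousOn h D := by
  rw [continuousOn_iff_isClosed]
  intro t ht
  refine ⟨⋃ τ, X.chart τ '' (X.dom τ ∩ (X.basis τ).interpolate (g ∘ X.vert τ) ⁻¹' t),
    isClosed_iUnion_of_finite fun τ => IsCompact.isClosed ?_, ?_⟩
  · exact ((X.basis τ).isCompact_triangle.inter_right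
      (ht.preimage AffineBasis.continuous_interpolate)).image_of_continuousOn
        ((hX.continuousOn τ).mono inter_subset_left)
  · ext y
    constructor
    · rintro ⟨hyt, hyD⟩
      refine ⟨?_, hyD⟩
      rw [hX.cover] at hyD
      obtain ⟨τ, z, hz, rfl⟩ := mem_iUnion.1 hyD
      refine mem_iUnion.2 ⟨τ, z, ⟨hz, ?_⟩, rfl⟩
      rw [mem_preimage, ← hh τ z hz]
      exact hyt
    · rintro ⟨hy, hyD⟩
      obtain ⟨τ, z, ⟨hz, hzt⟩, rfl⟩ := mem_iUnion.1 hy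
      refine ⟨?_, hyD⟩
      rw [mem_preimage, hh τ z hz]
      exact hzt

/-- Near the image of a point of a triangle, the function takes values in the direction of the
value at any corner of the triangle. -/
theorem Triangulates.exists_mem_nhds (hX : X.Triangulates D)
    (hh : ∀ τ, ∀ z ∈ X.dom τ, h (X.chart τ z) = (X.basis τ).interpolate (g ∘ X.vert τ) z)
    {τ : Tri} {w : ℂ} (hw : w ∈ X.dom τ) (m : Fin 3) {N : Set ℂ} (hN : N ∈ 𝓝 (X.chart τ w)) :
    ∃ p ∈ N, p ∈ D ∧ ∃ s : ℝ, 0 < s ∧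
      h p = h (X.chart τ w) + s * (g (X.vert τ m) - h (X.chart τ w)) := by
  have hmem : ∀ s ∈ Icc (0 : ℝ) 1, AffineMap.lineMap w (X.basis τ m) s ∈ X.dom τ := fun s hs =>
    (X.basis τ).convex_triangle.lineMap_mem hw ((X.basis τ).point_mem_triangle m) hs
  have hcont : ContinuousOn (fun s : ℝ => X.chart τ (AffineMap.lineMap w (X.basis τ m) s))
      (Icc 0 1) := (hX.continuousOn τ).comp AffineMap.lineMap_continuous.continuousOn hmem
  have h0 : Tendsto (fun s : ℝ => X.chart τ (AffineMap.lineMap w (X.basis τ m) s))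
      (𝓝[Icc 0 1] 0) (𝓝 (X.chart τ w)) := by
    have := hcont 0 (by simp)
    rw [ContinuousWithinAt, AffineMap.lineMap_apply_zero] at this
    exact this
  have h1 : 𝓝[Ioc (0 : ℝ) 1] 0 ≤ 𝓝[Icc (0 : ℝ) 1] 0 := nhdsWithin_mono _ Ioc_subset_Icc_self
  have : (𝓝[Ioc (0 : ℝ) 1] 0).NeBot := by
    rw [nhdsWithin_Ioc_eq_nhdsGT one_pos]
    infer_instance
  obtain ⟨s, hsN, hs⟩ := ((h0.mono_left h1).eventually_mem hN |>.and self_mem_nhdsWithin).exists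
  have hs' := Ioc_subset_Icc_self hs
  refine ⟨_, hsN, hX.chart_mem (hmem s hs'), s, hs.1, ?_⟩
  rw [hh τ _ (hmem s hs'), hh τ w hw, AffineBasis.interpolate_lineMap, AffineBasis.interpolate_point]
  simp only [Function.comp]
  ring

end AffineTriangulation

namespace PlanarComplex

variable {V F : Type*} {T : PlanarComplex V F} {Ω E₁ : Set ℂ} {m : ℕ} {E₂ : Fin (m - 1) → Set ℂ}
  {c : V → V → ℝ} {k l : ℝ} {g : V → ℝ} {h : ℂ → ℝ} {hT : T.IsCellDecomposition Ω}
  {d : ∀ f, ZMod (T.sides f)}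

/-! ### The piecewise affine extension of a solution of the Dirichlet problem -/

/-- The function `h` is affine on the triangles obtained by cutting each quadrilateral `f` along the
diagonal at the corner `d f`, and `g` has different values at the ends of the diagonals. -/
structure IsCut (hT : T.IsCellDecomposition Ω) (g : V → ℝ) (h : ℂ → ℝ)
    (d : ∀ f, ZMod (T.sides f)) : Prop where
  apply_chart : ∀ τ, ∀ z ∈ (triangulation hT d).dom τ, h ((triangulation hT d).chart τ z) =
    ((triangulation hT d).basis τ).interpolate (g ∘ (triangulation hT d).vert τ) z
  diagonal_ne : ∀ f, T.sides f = 4 → g (T.corner f (d f)) ≠ g (T.corner f (d f + 2))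

theorem IsPiecewiseAffineExtension.exists_isCut (hT : T.IsCellDecomposition Ω)
    (hh : T.IsPiecewiseAffineExtension g h) : ∃ d, IsCut hT g h d := by
  have hex : ∀ f, ∃ i : ZMod (T.sides f),
      (T.sides f = 4 → g (T.corner f i) ≠ g (T.corner f (i + 2))) ∧
      ∀ b : Bool, (T.sides f = 3 → b = false) → T.IsAffineOnTriangle g h f
        (triangleCorner _ i b 0) (triangleCorner _ i b 1) (triangleCorner _ i b 2) := by
    intro f
    rcases hT.sides_eq f with h3 | h4
    · refine ⟨0, fun h4 => absurd h4 (by omega), fun b hb => ?_⟩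
      rw [hb h3]
      have := (hh f).1 h3
      simpa [triangleCorner] using this
    · obtain ⟨i, hi, h1, h2⟩ := (hh f).2 h4
      refine ⟨i, fun _ => hi, fun b _ => ?_⟩
      cases b
      · simpa [triangleCorner] using h1
      · simpa [triangleCorner] using h2
  choose d hd using hex
  refine ⟨d, fun τ z hz => ?_, fun f => (hd f).1⟩
  have h1 := (hd τ.1.1).2 τ.1.2 τ.2 _ _ _ (hz 0) (hz 1) (hz 2)
    ((Fin.sum_univ_three fun j => ((triangulation hT d).basis τ).coord j z).symm.trans
      (AffineBasis.sum_coord_apply_eq_one _ z))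
  rw [AffineBasis.interpolate_apply, Fin.sum_univ_three]
  refine Eq.trans (congrArg _ ?_) h1
  have h2 := ((triangulation hT d).basis τ).sum_coord_smul z
  rw [Fin.sum_univ_three] at h2
  exact congrArg _ h2.symm

/-- In a triangle of the triangulation, `g` has different values at the ends of every side which is
not an edge in the boundary. -/
theorem IsCut.ne_or_subset_frontier (hd : IsCut hT g h d)
    (hne : ∀ u v, T.graph.Adj u v → T.openEdge u v ⊆ Ω → g u ≠ g v) (τ : T.Triangle) (j : Fin 3) :
    g ((triangulation hT d).vert τ (j + 1)) ≠ g ((triangulation hT d).vert τ (j + 2)) ∨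
      ¬ (T.sides τ.1.1 = 4 ∧ j = 1) ∧ T.openEdge ((triangulation hT d).vert τ (j + 1))
        ((triangulation hT d).vert τ (j + 2)) ⊆ frontier Ω := by
  by_cases hj : T.sides τ.1.1 = 4 ∧ j = 1
  · obtain ⟨h4, rfl⟩ := hj
    exact Or.inl (hd.diagonal_ne τ.1.1 h4).symm
  · rcases hT.edge_side _ _ (hT.adj_vert d hj) with h1 | h1
    · exact Or.inr ⟨hj, h1.1⟩
    · exact Or.inl (hne _ _ (hT.adj_vert d hj) h1.1)

namespace IsCellDecomposition

variable (hT) (d)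

theorem isPreconnected_closedEdge {τ : T.Triangle} {j : Fin 3}
    (hj : ¬ (T.sides τ.1.1 = 4 ∧ j = 1)) : IsPreconnected
      (T.closedEdge ((triangulation hT d).vert τ (j + 1)) ((triangulation hT d).vert τ (j + 2))) := by
  rw [← hT.image_side d hj, AffineTriangulation.dom, AffineBasis.side_eq_image]
  refine (isPreconnected_Icc.image _ AffineMap.lineMap_continuous.continuousOn).image _
    (((hT.triangulates_triangulation d).continuousOn τ).mono ?_)
  rw [← AffineBasis.side_eq_image]
  exact fun z hz => hz.1

theorem chart_mem_closedEdge {τ : T.Triangle} {i j : Fin 3}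
    (hj : ¬ (T.sides τ.1.1 = 4 ∧ j = 1)) (hij : i ≠ j) :
    T.pos ((triangulation hT d).vert τ i) ∈ T.closedEdge ((triangulation hT d).vert τ (j + 1))
      ((triangulation hT d).vert τ (j + 2)) := by
  rw [← hT.image_side d hj]
  refine ⟨(triangulation hT d).basis τ i, ⟨AffineBasis.point_mem_triangle _ i, ?_⟩,
    (hT.triangulates_triangulation d).chart_basis τ i⟩
  exact AffineBasis.coord_apply_ne _ hij.symm

theorem closedEdge_subset_frontier {τ : T.Triangle} {j : Fin 3}
    (hj : ¬ (T.sides τ.1.1 = 4 ∧ j = 1))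
    (hf : T.openEdge ((triangulation hT d).vert τ (j + 1))
      ((triangulation hT d).vert τ (j + 2)) ⊆ frontier Ω) :
    T.closedEdge ((triangulation hT d).vert τ (j + 1))
      ((triangulation hT d).vert τ (j + 2)) ⊆ frontier Ω := by
  have hc : ContinuousOn (T.edge ((triangulation hT d).vert τ (j + 1))
      ((triangulation hT d).vert τ (j + 2))) (Icc 0 1) := by
    have h1 : MapsTo (AffineMap.lineMap ((triangulation hT d).basis τ (j + 1))
        ((triangulation hT d).basis τ (j + 2)) : ℝ → ℂ) (Icc 0 1) ((triangulation hT d).dom τ) :=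
      fun t ht => (AffineBasis.convex_triangle _).lineMap_mem (AffineBasis.point_mem_triangle _ _)
        (AffineBasis.point_mem_triangle _ _) ht
    refine (((hT.triangulates_triangulation d).continuousOn τ).comp
      AffineMap.lineMap_continuous.continuousOn h1).congr fun t ht => ?_
    exact (hT.chart_lineMap d hj ht).symm
  rw [closedEdge, ← closure_Ioo (zero_ne_one' ℝ)]
  rw [← closure_Ioo (zero_ne_one' ℝ)] at hc
  exact hc.image_closure.trans (closure_minimal hf isClosed_frontier)

/-- A point of the boundary lies on an open edge in the boundary or is a vertex. -/
theorem frontier_cases (hΩ : IsMultiplyConnectedRegion m Ω E₁ E₂) {τ : T.Triangle} {z : ℂ}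
    (hz : z ∈ (triangulation hT d).dom τ) (hzf : (triangulation hT d).chart τ z ∈ frontier Ω) :
    (∃ j, ((triangulation hT d).basis τ).OnSide j z ∧ ¬ (T.sides τ.1.1 = 4 ∧ j = 1) ∧
      T.openEdge ((triangulation hT d).vert τ (j + 1)) ((triangulation hT d).vert τ (j + 2)) ⊆
        frontier Ω) ∨ ∃ j, z = (triangulation hT d).basis τ j := by
  have hzΩ := hΩ.notMem_of_mem_frontier hzf
  rcases AffineBasis.mem_triangle_cases hz with ho | ⟨j, hj⟩ | hj
  · exact absurd (hT.openCell_subset _ (hT.chart_mem_openCell d ho)) hzΩ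
  · left
    by_cases hdj : T.sides τ.1.1 = 4 ∧ j = 1
    · obtain ⟨h4, rfl⟩ := hdj
      exact absurd (hT.openCell_subset _ (hT.chart_mem_openCell_of_diagonal d h4 hj)) hzΩ
    · refine ⟨j, hj, hdj, ?_⟩
      rcases hT.edge_side _ _ (hT.adj_vert d hdj) with h1 | h1
      · exact h1.1
      · exact absurd (h1.1 (hT.chart_mem_openEdge d hdj hj)) hzΩ
  · exact Or.inr hj

theorem isPiecewiseLinear_of_triangles [Finite F] {C : Set ℂ}
    (hC : ∀ τ, ∃ S : Set (ℂ × ℂ), S.Finite ∧ {z ∈ (triangulation hT d).dom τ |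
      (triangulation hT d).chart τ z ∈ C} = ⋃ s ∈ S, segment ℝ s.1 s.2) :
    T.IsPiecewiseLinear C := by
  intro f
  choose S hS hSC using hC
  refine ⟨⋃ τ ∈ {τ : T.Triangle | τ.1.1 = f}, S τ,
    Set.Finite.biUnion (Set.toFinite _) fun τ _ => hS τ, ?_⟩
  ext z
  constructor
  · rintro ⟨hz, hzC⟩
    obtain ⟨τ, rfl, hzτ⟩ := hT.exists_mem_dom d hz
    have h1 : z ∈ ⋃ s ∈ S τ, segment ℝ s.1 s.2 := hSC τ ▸ ⟨hzτ, hzC⟩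
    obtain ⟨s, hs, hzs⟩ := mem_iUnion₂.1 h1
    exact mem_iUnion₂.2 ⟨s, mem_iUnion₂.2 ⟨τ, rfl, hs⟩, hzs⟩
  · intro hz
    obtain ⟨s, hs, hzs⟩ := mem_iUnion₂.1 hz
    obtain ⟨τ, rfl, hsτ⟩ := mem_iUnion₂.1 hs
    have h1 : z ∈ {z ∈ (triangulation hT d).dom τ | (triangulation hT d).chart τ z ∈ C} :=
      (hSC τ).symm ▸ mem_iUnion₂.2 ⟨s, hsτ, hzs⟩
    exact ⟨hT.dom_subset d τ h1.1, h1.2⟩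

/-- A component of the boundary is piecewise linear: it contains each edge in the boundary which it
meets. -/
theorem isPiecewiseLinear_of_subset_frontier [Finite F] (hT : T.IsCellDecomposition Ω)
    (hΩ : IsMultiplyConnectedRegion m Ω E₁ E₂)
    {E : Set ℂ} (hE : E ⊆ frontier Ω)
    (hcomp : ∀ S, IsPreconnected S → S ⊆ frontier Ω → (S ∩ E).Nonempty → S ⊆ E) :
    T.IsPiecewiseLinear E := by
  have d : ∀ f, ZMod (T.sides f) := fun f => 0
  refine hT.isPiecewiseLinear_of_triangles d fun τ => ?_
  set X := triangulation hT d with hX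
  refine ⟨(fun j => (X.basis τ (j + 1), X.basis τ (j + 2))) ''
      {j | X.chart τ '' {z ∈ X.dom τ | (X.basis τ).coord j z = 0} ⊆ E} ∪
    (fun j => (X.basis τ j, X.basis τ j)) '' {j | X.chart τ (X.basis τ j) ∈ E},
    ((Set.toFinite _).image _).union ((Set.toFinite _).image _), ?_⟩
  rw [biUnion_union, biUnion_image, biUnion_image]
  ext z
  constructor
  · rintro ⟨hz, hzE⟩
    rcases hT.frontier_cases d hΩ hz (hE hzE) with ⟨j, hj, hdj, hf⟩ | ⟨j, rfl⟩
    · left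
      refine mem_iUnion₂.2 ⟨j, ?_, ?_⟩
      · change X.chart τ '' {z ∈ X.dom τ | (X.basis τ).coord j z = 0} ⊆ E
        rw [hT.image_side d hdj]
        exact hcomp _ (hT.isPreconnected_closedEdge d hdj)
          (hT.closedEdge_subset_frontier d hdj hf)
          ⟨_, openEdge_subset_closedEdge _ _ (hT.chart_mem_openEdge d hdj hj), hzE⟩
      · obtain ⟨t, ht, rfl⟩ := hj.exists_lineMap
        rw [segment_eq_image_lineMap]
        exact ⟨t, Ioo_subset_Icc_self ht, rfl⟩
    · right
      exact mem_iUnion₂.2 ⟨j, hzE, left_mem_segment ℝ _ _⟩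
  · rintro (hz | hz)
    · obtain ⟨j, hj, hzj⟩ := mem_iUnion₂.1 hz
      rw [segment_eq_image_lineMap, ← AffineBasis.side_eq_image] at hzj
      exact ⟨hzj.1, hj ⟨z, hzj, rfl⟩⟩
    · obtain ⟨j, hj, hzj⟩ := mem_iUnion₂.1 hz
      rw [segment_same, mem_singleton_iff] at hzj
      rw [hzj]
      exact ⟨AffineBasis.point_mem_triangle _ j, hj⟩

end IsCellDecomposition

variable [Fintype V]

/-- A boundary edge is connected, so it lies in one boundary curve, and `g` has the boundary value of
this curve at both of its ends. -/
theorem IsDirichletSolution.boundary_edge (hΩ : IsMultiplyConnectedRegion m Ω E₁ E₂)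
    (hg : T.IsDirichletSolution Ω E₁ (⋃ i, E₂ i) c k g) (hT : T.IsCellDecomposition Ω)
    (d : ∀ f, ZMod (T.sides f)) {τ : T.Triangle} {j : Fin 3} (hj : ¬ (T.sides τ.1.1 = 4 ∧ j = 1))
    (hf : T.openEdge ((triangulation hT d).vert τ (j + 1))
      ((triangulation hT d).vert τ (j + 2)) ⊆ frontier Ω) :
    (T.closedEdge ((triangulation hT d).vert τ (j + 1))
        ((triangulation hT d).vert τ (j + 2)) ⊆ E₁ ∧
      ∀ i, i ≠ j → g ((triangulation hT d).vert τ i) = k) ∨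
    (T.closedEdge ((triangulation hT d).vert τ (j + 1))
        ((triangulation hT d).vert τ (j + 2)) ⊆ ⋃ i, E₂ i ∧
      ∀ i, i ≠ j → g ((triangulation hT d).vert τ i) = 0) := by
  have hcf := hT.closedEdge_subset_frontier d hj hf
  have hpre := hT.isPreconnected_closedEdge d hj
  have hmem := fun i (hi : i ≠ j) => hT.chart_mem_closedEdge d hj hi
  have h0 := hmem (j + 1) (Fin.ne_add_one_three j).1.symm
  have h1 := hcf h0
  rw [hΩ.frontier_eq] at h1
  rcases h1 with h1 | h1
  · have h2 := hΩ.subset_outer hpre hcf ⟨_, h0, h1⟩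
    exact Or.inl ⟨h2, fun i hi => hg.outer _ (h2 (hmem i hi))⟩
  · obtain ⟨a, ha⟩ := mem_iUnion.1 h1
    have h2 := (hΩ.subset_inner hpre hcf ⟨_, h0, ha⟩).trans (subset_iUnion E₂ a)
    exact Or.inr ⟨h2, fun i hi => hg.inner _ (h2 (hmem i hi))⟩

theorem IsCut.eq_on_boundary (hd : IsCut hT g h d) (hΩ : IsMultiplyConnectedRegion m Ω E₁ E₂)
    (hg : T.IsDirichletSolution Ω E₁ (⋃ i, E₂ i) c k g) :
    (∀ z ∈ E₁, h z = k) ∧ ∀ i, ∀ z ∈ E₂ i, h z = 0 := by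
  have hdisj : Disjoint E₁ (⋃ i, E₂ i) := disjoint_iUnion_right.2 hΩ.outer_disjoint
  have key : ∀ y ∈ frontier Ω, (y ∈ E₁ ∧ h y = k) ∨ (y ∈ ⋃ i, E₂ i) ∧ h y = 0 := by
    intro y hy
    have hX := hT.triangulates_triangulation d
    have hyD := frontier_subset_closure hy
    rw [hX.cover] at hyD
    obtain ⟨τ, z, hz, rfl⟩ := mem_iUnion.1 hyD
    rcases hT.frontier_cases d hΩ hz hy with ⟨j, hj, hdj, hf⟩ | ⟨j, rfl⟩
    · have hval : ∀ a : ℝ, (∀ i, i ≠ j → g ((triangulation hT d).vert τ i) = a) →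
          h ((triangulation hT d).chart τ z) = a := by
        intro a ha
        rw [hd.apply_chart τ z hz, AffineBasis.interpolate_apply]
        have h1 : ∀ i, ((triangulation hT d).basis τ).coord i z *
            (g ∘ (triangulation hT d).vert τ) i =
            ((triangulation hT d).basis τ).coord i z * a := by
          intro i
          by_cases hi : i = j
          · rw [hi, hj.1]
            ring
          · rw [Function.comp, ha i hi]
        simp only [h1, ← Finset.sum_mul, AffineBasis.sum_coord_apply_eq_one, one_mul]
      have hmem := IsCellDecomposition.openEdge_subset_closedEdge _ _ (hT.chart_mem_openEdge d hdj hj)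
      rcases hg.boundary_edge hΩ hT d hdj hf with ⟨h1, h2⟩ | ⟨h1, h2⟩
      · exact Or.inl ⟨h1 hmem, hval k h2⟩
      · exact Or.inr ⟨h1 hmem, hval 0 h2⟩
    · rw [hd.apply_chart τ _ hz, AffineBasis.interpolate_point, hX.chart_basis] at *
      rw [hΩ.frontier_eq] at hy
      rcases hy with hy | hy
      · exact Or.inl ⟨hy, hg.outer _ hy⟩
      · exact Or.inr ⟨hy, hg.inner _ hy⟩
  constructor
  · intro z hz
    rcases key z (hΩ.outer_subset hz) with h1 | h1
    · exact h1.2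
    · exact absurd h1.1 (disjoint_left.1 hdisj hz)
  · intro i z hz
    rcases key z (hΩ.inner_subset i hz) with h1 | h1
    · exact absurd (mem_iUnion.2 ⟨i, hz⟩) (disjoint_left.1 hdisj h1.1)
    · exact h1.2

/-- The extension is not constant on any triangle: otherwise the sides of the triangle would be in
the boundary, and the triangle would be all of `Ω`. -/
theorem IsCut.exists_ne (hd : IsCut hT g h d) (hΩ : IsMultiplyConnectedRegion m Ω E₁ E₂)
    (hm : 2 ≤ m) (hk : 0 < k) (hg : T.IsDirichletSolution Ω E₁ (⋃ i, E₂ i) c k g)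
    (hne : ∀ u v, T.graph.Adj u v → T.openEdge u v ⊆ Ω → g u ≠ g v) (τ : T.Triangle) :
    ∃ i j, g ((triangulation hT d).vert τ i) ≠ g ((triangulation hT d).vert τ j) := by
  by_contra! hall
  set X := triangulation hT d with hXdef
  have hX : X.Triangulates (closure Ω) := hT.triangulates_triangulation d
  have hside := fun j => (hd.ne_or_subset_frontier hne τ j).resolve_left (not_not.2 (hall _ _))
  have hcap : ∀ y ∈ Ω, y ∈ X.chart τ '' X.dom τ → y ∈ X.chart τ '' (X.basis τ).openTriangle := by
    rintro _ hy ⟨z, hz, rfl⟩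
    rcases AffineBasis.mem_triangle_cases hz with ho | ⟨j, hj⟩ | ⟨j, rfl⟩
    · exact ⟨z, ho, rfl⟩
    · exact absurd hy (hΩ.notMem_of_mem_frontier
        ((hside j).2 (hT.chart_mem_openEdge d (hside j).1 hj)))
    · obtain ⟨i, hij, -⟩ := Fin.exists_ne_and_ne j j
      rw [hX.chart_basis] at hy
      exact absurd hy (hΩ.notMem_of_mem_frontier (hT.closedEdge_subset_frontier d (hside i).1
        (hside i).2 (hT.chart_mem_closedEdge d (hside i).1 hij.symm)))
  have hcpt : IsCompact (X.chart τ '' X.dom τ) :=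
    (X.basis τ).isCompact_triangle.image_of_continuousOn (hX.continuousOn τ)
  obtain ⟨p, hp⟩ : (X.basis τ).openTriangle.Nonempty := by
    rw [AffineBasis.openTriangle_eq_interior, AffineBasis.triangle_eq_convexHull]
    exact ⟨_, (X.basis τ).centroid_mem_interior_convexHull⟩
  have hsub : Ω ⊆ X.chart τ '' (X.basis τ).openTriangle := by
    refine hΩ.isConnected.isPreconnected.subset_left_of_subset_union
      (AffineTriangulation.isOpen_chart_openTriangle hX τ) hcpt.isClosed.isOpen_compl ?_ ?_ ?_
    · rw [disjoint_compl_right_iff_subset]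
      exact image_mono (AffineBasis.openTriangle_subset_triangle _)
    · intro y hy
      by_cases hyτ : y ∈ X.chart τ '' X.dom τ
      · exact Or.inl (hcap y hy hyτ)
      · exact Or.inr hyτ
    · exact ⟨_, hT.openCell_subset _ (hT.chart_mem_openCell d hp), p, hp, rfl⟩
  have hcl : closure Ω ⊆ X.chart τ '' X.dom τ := closure_minimal
    (hsub.trans (image_mono (AffineBasis.openTriangle_subset_triangle _))) hcpt.isClosed
  have hconst : ∀ y ∈ closure Ω, h y = g (X.vert τ 0) := by
    intro y hy
    obtain ⟨z, hz, rfl⟩ := hcl hy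
    rw [hd.apply_chart τ z hz, AffineBasis.interpolate_apply]
    have h1 : ∀ i, ((triangulation hT d).basis τ).coord i z *
        (g ∘ (triangulation hT d).vert τ) i =
        ((triangulation hT d).basis τ).coord i z * g (X.vert τ 0) := fun i => by
      rw [Function.comp, hall i 0]
    simp only [h1, ← Finset.sum_mul, AffineBasis.sum_coord_apply_eq_one, one_mul]
  obtain ⟨h1, h2⟩ := hd.eq_on_boundary hΩ hg
  obtain ⟨a, ha⟩ := hΩ.outer_curve.nonempty
  obtain ⟨b, hb⟩ := (hΩ.inner_curve ⟨0, by omega⟩).nonempty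
  have h3 := hconst a (frontier_subset_closure (hΩ.outer_subset ha))
  have h4 := hconst b (frontier_subset_closure (hΩ.inner_subset _ hb))
  rw [h1 a ha] at h3
  rw [h2 _ b hb] at h4
  linarith

/-- A vertex in `Ω` has neighbours with greater and with smaller values. -/
theorem IsDirichletSolution.exists_adj (hΩ : IsMultiplyConnectedRegion m Ω E₁ E₂)
    (hT : T.IsCellDecomposition Ω) (hc : T.IsConductance c)
    (hg : T.IsDirichletSolution Ω E₁ (⋃ i, E₂ i) c k g)
    (hne : ∀ u v, T.graph.Adj u v → T.openEdge u v ⊆ Ω → g u ≠ g v) {v : V} (hv : T.pos v ∈ Ω) :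
    (∃ u, T.graph.Adj v u ∧ g v < g u) ∧ ∃ u, T.graph.Adj v u ∧ g u < g v := by
  classical
  have hadj : ∀ u, T.graph.Adj v u → g v ≠ g u := by
    intro u hu
    refine hne v u hu (((hT.edge_side v u hu).resolve_left fun h1 => ?_).1)
    obtain ⟨f, j, hj⟩ := IsCellDecomposition.exists_isSide hu
    obtain ⟨b, i, hb, hi, hji⟩ := exists_triangleCorner_side (hT.sides_eq f) (0 : ZMod (T.sides f)) j
    set τ : T.Triangle := ⟨(f, b), hb⟩
    have he : s(v, u) = s((triangulation hT fun _ => 0).vert τ (i + 1),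
        (triangulation hT fun _ => 0).vert τ (i + 2)) :=
      hj.symm.trans (congrArg (Sym2.map (T.corner f)) hji).symm
    have hf := h1.1
    rw [hT.openEdge_congr hu he] at hf
    refine hΩ.notMem_of_mem_frontier (hT.closedEdge_subset_frontier _ (τ := τ) hi hf ?_) hv
    obtain ⟨h2, h3, -⟩ := Fin.ne_add_one_three i
    rcases Sym2.eq_iff.1 he with ⟨h4, -⟩ | ⟨h4, -⟩ <;> rw [h4]
    · exact hT.chart_mem_closedEdge _ hi h2.symm
    · exact hT.chart_mem_closedEdge _ hi h3.symm
  obtain ⟨u₀, hu₀⟩ : ∃ u, T.graph.Adj v u := by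
    obtain ⟨f, j, rfl⟩ := hT.exists_corner v
    exact ⟨_, hT.adj_corner f j⟩
  have hlap := hg.harmonic v hv
  rw [laplacian] at hlap
  constructor <;> by_contra! hno
  · refine (Finset.sum_pos (fun u hu => ?_) ⟨u₀, ?_⟩).ne' hlap
    · have hu' := (Finset.mem_filter.1 hu).2
      exact mul_pos (hc v u hu').1 (sub_pos.2 ((hno u hu').lt_of_ne (hadj u hu').symm))
    · simpa using hu₀
  · refine (Finset.sum_neg (fun u hu => ?_) ⟨u₀, ?_⟩).ne hlap
    · have hu' := (Finset.mem_filter.1 hu).2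
      exact mul_neg_of_pos_of_neg (hc v u hu').1 (sub_neg.2 ((hno u hu').lt_of_ne (hadj u hu')))
    · simpa using hu₀

/-- At a point inside a triangle or an edge because the extension is not constant there, and at a
vertex by harmonicity. -/
theorem IsCut.hasNoLocalExtr [Finite F] (hd : IsCut hT g h d)
    (hΩ : IsMultiplyConnectedRegion m Ω E₁ E₂) (hm : 2 ≤ m) (hc : T.IsConductance c) (hk : 0 < k)
    (hg : T.IsDirichletSolution Ω E₁ (⋃ i, E₂ i) c k g)
    (hne : ∀ u v, T.graph.Adj u v → T.openEdge u v ⊆ Ω → g u ≠ g v) : HasNoLocalExtr Ω h := by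
  set X := triangulation hT d with hXdef
  have hX : X.Triangulates (closure Ω) := hT.triangulates_triangulation d
  have key : ∀ y ∈ Ω,
      (∃ τ, ∃ w ∈ X.dom τ, X.chart τ w = y ∧ ∃ i, h y < g (X.vert τ i)) ∧
      ∃ τ, ∃ w ∈ X.dom τ, X.chart τ w = y ∧ ∃ i, g (X.vert τ i) < h y := by
    intro y hy
    have hyD := subset_closure hy
    rw [hX.cover] at hyD
    obtain ⟨τ, w, hw, rfl⟩ := mem_iUnion.1 hyD
    have hmain : (∃ i j, 0 < (X.basis τ).coord i w ∧ 0 < (X.basis τ).coord j w ∧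
        g (X.vert τ i) ≠ g (X.vert τ j)) → _ := fun ⟨i, j, hi, hj, hij⟩ =>
      AffineBasis.exists_lt_and_lt (v := g ∘ X.vert τ) hw hi hj hij
    rw [← hd.apply_chart τ w hw] at hmain
    rcases AffineBasis.mem_triangle_cases hw with ho | ⟨j, hj⟩ | ⟨j, rfl⟩
    · obtain ⟨i, j, hij⟩ := hd.exists_ne hΩ hm hk hg hne τ
      obtain ⟨h1, h2⟩ := hmain ⟨i, j, ho i, ho j, hij⟩
      exact ⟨⟨τ, w, hw, rfl, h1⟩, ⟨τ, w, hw, rfl, h2⟩⟩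
    · have hij : g (X.vert τ (j + 1)) ≠ g (X.vert τ (j + 2)) := by
        refine (hd.ne_or_subset_frontier hne τ j).resolve_right fun hf => ?_
        exact hΩ.notMem_of_mem_frontier (hf.2 (hT.chart_mem_openEdge d hf.1 hj)) hy
      obtain ⟨h3, h4, -⟩ := Fin.ne_add_one_three j
      obtain ⟨h1, h2⟩ := hmain ⟨_, _, hj.2 _ h3.symm, hj.2 _ h4.symm, hij⟩
      exact ⟨⟨τ, w, hw, rfl, h1⟩, ⟨τ, w, hw, rfl, h2⟩⟩
    · have hval : h (X.chart τ (X.basis τ j)) = g (X.vert τ j) := by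
        rw [hd.apply_chart τ _ hw, AffineBasis.interpolate_point]
        rfl
      rw [hval]
      have hnb : ∀ u, T.graph.Adj (X.vert τ j) u → ∃ τ', ∃ w ∈ X.dom τ',
          X.chart τ' w = X.chart τ (X.basis τ j) ∧ ∃ i, X.vert τ' i = u := by
        intro u hu
        obtain ⟨f, a, ha⟩ := IsCellDecomposition.exists_isSide hu
        obtain ⟨b, i, hb, hi, hai⟩ := exists_triangleCorner_side (hT.sides_eq f) (d f) a
        set τ' : T.Triangle := ⟨(f, b), hb⟩
        have he : s(X.vert τ j, u) = s(X.vert τ' (i + 1), X.vert τ' (i + 2)) :=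
          ha.symm.trans (congrArg (Sym2.map (T.corner f)) hai).symm
        rcases Sym2.eq_iff.1 he with ⟨h1, h2⟩ | ⟨h1, h2⟩
        · exact ⟨τ', X.basis τ' (i + 1), AffineBasis.point_mem_triangle _ _,
            by rw [hX.chart_basis, hX.chart_basis, h1], _, h2.symm⟩
        · exact ⟨τ', X.basis τ' (i + 2), AffineBasis.point_mem_triangle _ _,
            by rw [hX.chart_basis, hX.chart_basis, h1], _, h2.symm⟩
      rw [hX.chart_basis] at hy
      obtain ⟨⟨u, hu, hgu⟩, u', hu', hgu'⟩ := hg.exists_adj hΩ hT hc hne hy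
      obtain ⟨τ₁, w₁, hw₁, h1, i₁, rfl⟩ := hnb u hu
      obtain ⟨τ₂, w₂, hw₂, h2, i₂, rfl⟩ := hnb u' hu'
      exact ⟨⟨τ₁, w₁, hw₁, h1, i₁, hgu⟩, ⟨τ₂, w₂, hw₂, h2, i₂, hgu'⟩⟩
  refine ⟨hX.continuousOn_of_interpolate hd.apply_chart, fun y hy N hN => ?_, fun y hy N hN => ?_⟩
  · obtain ⟨τ, w, hw, rfl, i, hi⟩ := (key y hy).1
    obtain ⟨p, hpN, hpD, s, hs, hp⟩ := hX.exists_mem_nhds hd.apply_chart hw i hN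
    exact ⟨p, hpN, hpD, by rw [hp]; linarith [mul_pos hs (sub_pos.2 hi)]⟩
  · obtain ⟨τ, w, hw, rfl, i, hi⟩ := (key y hy).2
    obtain ⟨p, hpN, hpD, s, hs, hp⟩ := hX.exists_mem_nhds hd.apply_chart hw i hN
    exact ⟨p, hpN, hpD, by rw [hp]; linarith [mul_neg_of_pos_of_neg hs (sub_neg.2 hi)]⟩

/-- A level strictly between the boundary values avoids the boundary edges; the other edges and the
diagonals have different values at their ends and lie in two triangles. -/
theorem IsCut.isRegularAt (hd : IsCut hT g h d) (hΩ : IsMultiplyConnectedRegion m Ω E₁ E₂)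
    (hg : T.IsDirichletSolution Ω E₁ (⋃ i, E₂ i) c k g)
    (hne : ∀ u v, T.graph.Adj u v → T.openEdge u v ⊆ Ω → g u ≠ g v) (h0l : 0 < l) (hlk : l < k) :
    (triangulation hT d).IsRegularAt g h l where
  apply_chart := hd.apply_chart
  not_both τ i j hij hgl := by
    obtain ⟨a, hai, haj⟩ := Fin.exists_ne_and_ne i j
    have hall : ∀ a i j : Fin 3, a ≠ i → a ≠ j → i ≠ j →
        (i = a + 1 ∧ j = a + 2) ∨ (j = a + 1 ∧ i = a + 2) := by decide
    rcases hd.ne_or_subset_frontier hne τ a with h1 | h1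
    · rcases hall a i j hai haj hij with ⟨rfl, rfl⟩ | ⟨rfl, rfl⟩
      · exact h1 (hgl.1.trans hgl.2.symm)
      · exact h1 (hgl.2.trans hgl.1.symm)
    · have := hgl.1
      rcases hg.boundary_edge hΩ hT d h1.1 h1.2 with ⟨-, h2⟩ | ⟨-, h2⟩ <;>
        rw [h2 i hai.symm] at this <;> linarith
  ncard_edge τ i j a hij hia hja hgij := by
    by_cases hda : T.sides τ.1.1 = 4 ∧ a = 1
    · rw [hT.edge_diagonal d hda]
      exact hT.ncard_diagonal d hda.1
    · rw [hT.edge_side_eq d hda, hT.ncard_sides d]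
      refine ((hT.edge_side _ _ (hT.adj_vert d hda)).resolve_left fun hf => hgij ?_).2
      rcases hg.boundary_edge hΩ hT d hda hf.1 with ⟨-, h2⟩ | ⟨-, h2⟩ <;> rw [h2 i hia, h2 j hja]

end PlanarComplex

/-! ### The components of the level sets -/

namespace PlanarComplex

variable {V F : Type*} {T : PlanarComplex V F}

theorem IsAtMostVertex.of_subsingleton [Nonempty V] {A : Set ℂ} (hA : A.Subsingleton)
    (hAV : A ⊆ range T.pos) : T.IsAtMostVertex A := by
  rcases A.eq_empty_or_nonempty with rfl | ⟨p, hp⟩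
  · exact ⟨Classical.arbitrary V, empty_subset _⟩
  · obtain ⟨v, rfl⟩ := hAV hp
    exact ⟨v, fun q hq => hA hq hp⟩

/-- A union of finitely many piecewise linear circles which meet in at most a vertex and do not
enter the domains bounded by each other is a generalized bouquet: each circle is a bouquet by
itself. -/
theorem isGeneralizedBouquet_sUnion {𝒞 : Set (Set ℂ)} (hfin : 𝒞.Finite)
    (hC : ∀ C ∈ 𝒞, IsSimpleClosedCurve C ∧ T.IsPiecewiseLinear C)
    (hmeet : ∀ C ∈ 𝒞, ∀ C' ∈ 𝒞, C ≠ C' → T.IsAtMostVertex (C ∩ C') ∧ Disjoint C' (inside C)) :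
    T.IsGeneralizedBouquet (⋃₀ 𝒞) := by
  refine ⟨(fun C => {C}) '' 𝒞, hfin.image _, ?_, ?_, ?_, ?_⟩
  · rintro _ ⟨C, hCC, rfl⟩
    obtain ⟨p, hp⟩ := (hC C hCC).1.nonempty
    refine ⟨finite_singleton C, singleton_nonempty C, ?_, p, ?_, ?_, ?_⟩
    · rintro _ rfl
      exact hC _ hCC
    · rintro _ rfl
      exact hp
    · rintro _ rfl _ rfl h
      exact absurd rfl h
    · exact fun h => absurd h not_nontrivial_singleton
  · rw [biUnion_image, sUnion_eq_biUnion]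
    simp
  · rintro _ ⟨C, hCC, rfl⟩ _ ⟨C', hCC', rfl⟩ h
    simp only [sUnion_singleton]
    exact (hmeet C hCC C' hCC' fun h' => h (by rw [h'])).1
  · rintro _ ⟨C, hCC, rfl⟩ _ rfl _ ⟨C', hCC', rfl⟩ _ rfl h
    exact (hmeet _ hCC _ hCC' h).2

end PlanarComplex

theorem mainTheorem5 {V F : Type*} [Fintype V] [Fintype F]
    (m : ℕ) (hm : 2 ≤ m) (Ω E₁ : Set ℂ) (E₂ : Fin (m - 1) → Set ℂ)
    (hΩ : IsMultiplyConnectedRegion m Ω E₁ E₂)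
    (T : PlanarComplex V F) (hT : T.IsCellDecomposition Ω)
    (c : V → V → ℝ) (hc : T.IsConductance c)
    (k : ℝ) (hk : 0 < k)
    (g : V → ℝ) (hg : T.IsDirichletSolution Ω E₁ (⋃ i, E₂ i) c k g)
    (hne : ∀ u v, T.graph.Adj u v → T.openEdge u v ⊆ Ω → g u ≠ g v)
    (gbar : ℂ → ℝ) (hgbar : T.IsPiecewiseAffineExtension g gbar)
    (l : ℝ) (x : ℂ) (hx : x ∈ closure Ω) (hxl : gbar x = l)
    (L : Set ℂ) (hL : L = connectedComponentIn {z ∈ closure Ω | gbar z = l} x) :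
    T.IsGeneralizedBouquet L ∧
      ∀ C C' : Set ℂ, IsSimpleClosedCurve C → IsSimpleClosedCurve C' → C ⊆ L → C' ⊆ L → C ≠ C' →
        T.IsAtMostVertex (C ∩ C') ∧ Disjoint C' (inside C) := by
  obtain ⟨d, hd⟩ := hgbar.exists_isCut hT
  have H := hd.hasNoLocalExtr hΩ hm hc hk hg hne
  obtain ⟨h1, h2⟩ := hd.eq_on_boundary hΩ hg
  have hX := hT.triangulates_triangulation d
  have hxY : x ∈ {z ∈ closure Ω | gbar z = l} := ⟨hx, hxl⟩
  have hLY : L ⊆ {z ∈ closure Ω | gbar z = l} := hL ▸ connectedComponentIn_subset _ _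
  have hval := fun z (hz : z ∈ Ω) => hΩ.lt_and_lt_of_mem H hk h1 h2 hz
  by_cases hxΩ : x ∈ Ω
  · obtain ⟨h0l, hlk⟩ := hval x hxΩ
    rw [hxl] at h0l hlk
    have hl := hd.isRegularAt hΩ hg hne h0l hlk
    obtain ⟨e, he⟩ := hΩ.outer_curve.nonempty
    have hs := hΩ.isSeparatingLevel H h1 h2 hm h0l hlk he
    have hV : Nonempty V := by
      rw [hX.cover] at hx
      obtain ⟨τ, -⟩ := mem_iUnion.1 hx
      exact ⟨(PlanarComplex.triangulation hT d).vert τ 0⟩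
    have hmeet : ∀ C C' : Set ℂ, IsSimpleClosedCurve C → IsSimpleClosedCurve C' → C ⊆ L → C' ⊆ L →
        C ≠ C' → T.IsAtMostVertex (C ∩ C') ∧ Disjoint C' (inside C) := by
      intro C C' hC hC' hCL hCL' hCC
      have hvert : ∀ C C', IsSimpleClosedCurve C → IsSimpleClosedCurve C' →
          C ⊆ {z ∈ closure Ω | gbar z = l} → C' ⊆ {z ∈ closure Ω | gbar z = l} → C ≠ C' →
          C ∩ C' ⊆ range T.pos := fun C C' hC hC' hCY hCY' hCC =>
        AffineTriangulation.inter_subset_range_pos hX hl hs hC hC' hCY hCY' hCC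
      exact ⟨.of_subsingleton (IsSimpleClosedCurve.subsingleton_inter (finite_range T.pos) hvert hC
        hC' (hCL.trans hLY) (hCL'.trans hLY) hCC) (hvert C C' hC hC' (hCL.trans hLY)
        (hCL'.trans hLY) hCC),
        (hs.disjoint_inside hC.isCompact (hCL.trans hLY)).mono_left (hCL'.trans hLY)⟩
    refine ⟨?_, hmeet⟩
    have hcover : L = ⋃₀ {C | IsSimpleClosedCurve C ∧ C ⊆ L} := by
      refine Subset.antisymm (fun y hy => ?_) (sUnion_subset fun C hC => hC.2)
      obtain ⟨τ, hτ, z, ⟨hz, hzl⟩, rfl⟩ :=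
        AffineTriangulation.exists_isCrossing hX hl hs (hLY hy)
      have : Fintype T.Triangle := Fintype.ofFinite _
      have : Fintype (Sym2 V ⊕ F) := Fintype.ofFinite _
      obtain ⟨C, hC, hCY, hyC⟩ :=
        AffineTriangulation.exists_isSimpleClosedCurve_through hX hl hτ hz hzl
      refine mem_sUnion.2 ⟨C, ⟨hC, ?_⟩, hyC⟩
      rw [hL] at hy ⊢
      rw [connectedComponentIn_eq hy]
      exact hC.isConnected.isPreconnected.subset_connectedComponentIn hyC hCY
    rw [hcover]
    refine PlanarComplex.isGeneralizedBouquet_sUnion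
      ((AffineTriangulation.finite_isSimpleClosedCurve hX hl hs).subset
        fun C hC => ⟨hC.1, hC.2.trans hLY⟩)
      (fun C hC => ⟨hC.1, hT.isPiecewiseLinear_of_triangles d fun τ =>
        AffineTriangulation.exists_finite_segments hX hl hC.1 (hC.2.trans hLY) τ⟩)
      fun C hC C' hC' hCC => hmeet C C' hC.1 hC'.1 hC.2 hC'.2 hCC
  · -- the level is `k` or `0`, and the component is one of the boundary curves
    have hxf := hΩ.mem_frontier hx hxΩ
    have hYf : {z ∈ closure Ω | gbar z = l} ⊆ frontier Ω := by
      rintro z ⟨hz, hzl⟩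
      refine hΩ.mem_frontier hz fun hzΩ => ?_
      obtain ⟨h3, h4⟩ := hval z hzΩ
      rcases hΩ.eq_or_eq_of_mem_frontier h1 h2 hxf with h5 | h5 <;> linarith
    obtain ⟨E, hE, hxE, hEf, hEl, hEc⟩ : ∃ E, IsSimpleClosedCurve E ∧ x ∈ E ∧ E ⊆ frontier Ω ∧
        (∀ z ∈ E, gbar z = l) ∧
        ∀ S, IsPreconnected S → S ⊆ frontier Ω → (S ∩ E).Nonempty → S ⊆ E := by
      have hxf' := hxf
      rw [hΩ.frontier_eq] at hxf'
      rcases hxf' with hxE | hxE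
      · exact ⟨E₁, hΩ.outer_curve, hxE, hΩ.outer_subset,
          fun z hz => (h1 z hz).trans ((h1 x hxE).symm.trans hxl),
          fun S hS hSf => hΩ.subset_outer hS hSf⟩
      · obtain ⟨i, hi⟩ := mem_iUnion.1 hxE
        exact ⟨E₂ i, hΩ.inner_curve i, hi, hΩ.inner_subset i,
          fun z hz => (h2 i z hz).trans ((h2 i x hi).symm.trans hxl),
          fun S hS hSf => hΩ.subset_inner hS hSf⟩
    have hLE : L = E := by
      rw [hL]
      refine Subset.antisymm ?_ ?_
      · exact hEc _ isPreconnected_connectedComponentIn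
          ((connectedComponentIn_subset _ _).trans hYf) ⟨x, mem_connectedComponentIn hxY, hxE⟩
      · exact hE.isConnected.isPreconnected.subset_connectedComponentIn hxE
          fun z hz => ⟨frontier_subset_closure (hEf hz), hEl z hz⟩
    rw [hLE]
    refine ⟨?_, fun C C' hC hC' hCE hCE' hCC => absurd
      ((hC.eq_of_subset hE hCE).trans (hC'.eq_of_subset hE hCE').symm) hCC⟩
    rw [← sUnion_singleton E]
    refine PlanarComplex.isGeneralizedBouquet_sUnion (finite_singleton E) ?_ ?_
    · rintro _ rfl
      exact ⟨hE, hT.isPiecewiseLinear_of_subset_frontier hΩ hEf hEc⟩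
    · rintro _ rfl _ rfl h
      exact absurd rfl h
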